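/- Let $V_6$ be a complex vector space of dimension $6$, and endow $\bigwedge^3V_6$ with the ($\bigwedge^6V_6$-valued) symplectic form given by the wedge product. For a $3$-dimensional subspace $U\subset V_6$ set $T_U:=\bigwedge^2U\wedge V_6\subset\bigwedge^3V_6$, a subspace of dimension $10$. For a Lagrangian subspace $A\subset\bigwedge^3V_6$ and an integer $k\ge 0$, let $$Z_A^{\ge k}:=\{[U]\in \mathrm{Gr}(3,V_6)\mid \dim(A\cap T_U)\ge k\},\qquad Z_A^k:=Z_A^{\ge k}\smallsetminus Z_A^{\ge k+1},$$ where $Z_A^{\ge k}$ is endowed with its structure of closed subscheme of $\mathrm{Gr}(3,V_6)$ as the degeneracy locus of corank at least $k$ of the morphism of rank-$10$ vector bundles with fibre $T_U\to\bigwedge^3V_6/A$ at $[U]$ (locally defined by the minors of size $11-k$), and $Z_A^k$ is open in $Z_A^{\ge k}$. Assume that $A$ has no decomposable vectors, that is, contains no nonzero vector of the form $v_1\wedge v_2\wedge v_3$. Then: 1. $Z_A^{\ge 5}$ is empty. 2. $Z_A^{\ge 4}$ is finite and smooth, and it is the singular locus of $Z_A^{\ge 3}$. 3. For every $k\in\{0,1,2,3\}$,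 the scheme $Z_A^k$ is smooth of dimension $9-\frac{k(k+1)}2$ at each of its points, and $Z_A^4$ is smooth of dimension $0$ at each of its points. Moreover, $Z_A^{\ge 4}$ is empty for $A$ general, that is, for all $[A]$ in some dense Zariski-open subset of the Lagrangian Grassmannian $\mathrm{LG}(\bigwedge^3V_6)$. -/

import Mathlib

open scoped TensorProduct

noncomputable section

namespace EPW

open ExteriorAlgebra

variable {V : Type*} [AddCommGroup V] [Module ℂ V]

/-- For `dim V = 6`: a Lagrangian subspace `A ⊆ ⋀³V` for the (conformal) symplectic form given by
the wedge product `⋀³V × ⋀³V → ⋀⁶V`, i.e. an isotropic subspace of dimension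
`10 = (dim ⋀³V) / 2`. All exterior powers are viewed inside the exterior algebra of `V`, whose
multiplication is the wedge product. -/
structure IsLagrangian (A : Submodule ℂ (ExteriorAlgebra ℂ V)) : Prop where
  le_exteriorPower : A ≤ ⋀[ℂ]^3 V
  finrank_eq : Module.finrank ℂ A = 10
  wedge_eq_zero : ∀ a ∈ A, ∀ b ∈ A, a * b = 0

/-- `A` contains no (nonzero) decomposable vector `v₁ ∧ v₂ ∧ v₃`. -/
def NoDecomposable (A : Submodule ℂ (ExteriorAlgebra ℂ V)) : Prop :=
  ∀ v₁ v₂ v₃ : V, ι ℂ v₁ * ι ℂ v₂ * ι ℂ v₃ ∈ A → ι ℂ v₁ * ι ℂ v₂ * ι ℂ v₃ = 0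

/-- `T_U = ⋀²U ∧ V ⊆ ⋀³V`. -/
def tangentSubspace (U : Submodule ℂ V) : Submodule ℂ (ExteriorAlgebra ℂ V) :=
  Submodule.span ℂ {t | ∃ u ∈ U, ∃ u' ∈ U, ∃ v : V, t = ι ℂ u * ι ℂ u' * ι ℂ v}

/-! ### The degeneracy loci as sets of points of `Gr(3, V)` -/

/-- The points of `Z_A^{≥ k} = {[U] ∈ Gr(3, V) | dim (A ∩ T_U) ≥ k}`. -/
def locusGE (A : Submodule ℂ (ExteriorAlgebra ℂ V)) (k : ℕ) : Set (Submodule ℂ V) :=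
  {U | Module.finrank ℂ U = 3 ∧
    k ≤ Module.finrank ℂ (A ⊓ tangentSubspace U : Submodule ℂ (ExteriorAlgebra ℂ V))}

/-- The points of `Z_A^k = Z_A^{≥ k} ∖ Z_A^{≥ k+1}`. -/
def locusEq (A : Submodule ℂ (ExteriorAlgebra ℂ V)) (k : ℕ) : Set (Submodule ℂ V) :=
  locusGE A k \ locusGE A (k + 1)

/-! ### The scheme structure of the degeneracy loci

A basis `e` of `V` indexed by `Fin 3 ⊕ Fin 3` splits `V = U₀ ⊕ U_∞`, with `U₀` spanned by the
vectors `e (inl i)` and `U_∞` by the vectors `e (inr j)`. It gives the standard affine chart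
`{[U] | U ∩ U_∞ = 0} ≃ Hom(U₀, U_∞) ≃ 𝔸⁹` of `Gr(3, V)` centred at `[U₀]`, the point with
coordinates `x` being the graph, spanned by the vectors `e (inl i) + ∑ j, x (i, j) • e (inr j)`. -/

/-- The coordinate ring of the affine chart `𝔸⁹` of `Gr(3, V)`. -/
abbrev ChartRing : Type := MvPolynomial (Fin 3 × Fin 3) ℂ

/-- The vectors `u_i = e (inl i) + ∑ j, x_{ij} e (inr j)`, with coefficients in the ring of the
chart, that form a basis of the tautological rank `3` subbundle over the chart. -/
def tautVector (e : Module.Basis (Fin 3 ⊕ Fin 3) ℂ V) (i : Fin 3) :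
    ChartRing ⊗[ℂ] ExteriorAlgebra ℂ V :=
  1 ⊗ₜ ι ℂ (e (Sum.inl i)) + ∑ j : Fin 3, MvPolynomial.X (i, j) ⊗ₜ ι ℂ (e (Sum.inr j))

/-- The module of sections over the chart of the rank `10` vector bundle with fibre `T_U` at `[U]`,
inside the trivial bundle `⋀³V`. -/
def tautTangent (e : Module.Basis (Fin 3 ⊕ Fin 3) ℂ V) :
    Submodule ChartRing (ChartRing ⊗[ℂ] ExteriorAlgebra ℂ V) :=
  Submodule.span ChartRing
    {t | ∃ (i j : Fin 3) (v : V), t = tautVector e i * tautVector e j * (1 ⊗ₜ ι ℂ v)}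

/-- The extension of scalars `ChartRing ⊗ ⋀V → ChartRing` of a linear form on `⋀V`. -/
def extendForm (φ : ExteriorAlgebra ℂ V →ₗ[ℂ] ℂ) :
    ChartRing ⊗[ℂ] ExteriorAlgebra ℂ V →ₗ[ChartRing] ChartRing :=
  (Algebra.TensorProduct.rid ℂ ChartRing ChartRing).toLinearMap ∘ₗ φ.baseChange ChartRing

/-- The ideal of `Z_A^{≥ k}` in the chart: the locus where the map `T_U → ⋀³V / A` of rank `10`
bundles has corank at least `k` is the closed subscheme defined by its minors of size `11 - k`.
(For `k = 0` they vanish, and for `k ≥ 11` the empty minor gives the unit ideal.) -/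
def degeneracyIdeal (A : Submodule ℂ (ExteriorAlgebra ℂ V)) (k : ℕ)
    (e : Module.Basis (Fin 3 ⊕ Fin 3) ℂ V) : Ideal ChartRing :=
  Ideal.span {d | ∃ (t : Fin (11 - k) → ChartRing ⊗[ℂ] ExteriorAlgebra ℂ V)
    (φ : Fin (11 - k) → ExteriorAlgebra ℂ V →ₗ[ℂ] ℂ),
    (∀ i, t i ∈ tautTangent e) ∧ (∀ j, ∀ a ∈ A, φ j a = 0) ∧
    d = (Matrix.of fun i j => extendForm (φ j) (t i)).det}

/-- The maximal ideal of the centre of the chart. -/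
def originIdeal : Ideal ChartRing :=
  RingHom.ker (MvPolynomial.constantCoeff : ChartRing →+* ℂ)

instance : originIdeal.IsPrime := RingHom.ker_isPrime _

/-- The local ring of the scheme `Z_A^{≥ k}` at the centre `[U₀]` of the chart (the zero ring when
`[U₀]` is not in `Z_A^{≥ k}`). Since `Z_A^k` is open in `Z_A^{≥ k}`, this is also the local ring of
`Z_A^k` when `[U₀]` lies in `Z_A^k`. -/
abbrev LocalRingAt (A : Submodule ℂ (ExteriorAlgebra ℂ V)) (k : ℕ)
    (e : Module.Basis (Fin 3 ⊕ Fin 3) ℂ V) : Type :=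
  Localization.AtPrime originIdeal ⧸
    (degeneracyIdeal A k e).map (algebraMap ChartRing (Localization.AtPrime originIdeal))

/-- The chart given by `e` is centred at `[U]`. -/
def IsCentredAt (e : Module.Basis (Fin 3 ⊕ Fin 3) ℂ V) (U : Submodule ℂ V) : Prop :=
  Submodule.span ℂ (Set.range fun i => e (Sum.inl i)) = U

/-- The complex scheme `Z_A^{≥ k}` is smooth at `[U]`: its local ring there, computed in any chart
centred at `[U]`, is a regular local ring. -/
def IsSmoothAt (A : Submodule ℂ (ExteriorAlgebra ℂ V)) (k : ℕ) (U : Submodule ℂ V) : Prop :=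
  ∀ e : Module.Basis (Fin 3 ⊕ Fin 3) ℂ V, IsCentredAt e U → IsRegularLocalRing (LocalRingAt A k e)

/-- The scheme `Z_A^{≥ k}` has dimension `d` at `[U]`. -/
def HasDimAt (A : Submodule ℂ (ExteriorAlgebra ℂ V)) (k : ℕ) (U : Submodule ℂ V) (d : ℕ) : Prop :=
  ∀ e : Module.Basis (Fin 3 ⊕ Fin 3) ℂ V, IsCentredAt e U → ringKrullDim (LocalRingAt A k e) = d

/-- The singular locus of the scheme `Z_A^{≥ k}`. -/
def singularLocus (A : Submodule ℂ (ExteriorAlgebra ℂ V)) (k : ℕ) : Set (Submodule ℂ V) :=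
  {U | U ∈ locusGE A k ∧ ¬ IsSmoothAt A k U}

/-! ### The Lagrangian Grassmannian with its Zariski topology -/

/-- The set of points of the Lagrangian Grassmannian `LG(⋀³V)`. -/
def LagrangianGrassmannian (V : Type*) [AddCommGroup V] [Module ℂ V] : Type _ :=
  {A : Submodule ℂ (ExteriorAlgebra ℂ V) // IsLagrangian A}

/-- The set of Lagrangian subspaces that have a basis `a₁, …, a₁₀` at which the polynomial `P` in
the coordinates of `(a₁, …, a₁₀)` does not vanish (the variable `(i, φ)` stands for the
coordinate `φ(a_i)`). -/
def zariskiBasicOpen (P : MvPolynomial (Fin 10 × (ExteriorAlgebra ℂ V →ₗ[ℂ] ℂ)) ℂ) :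
    Set (LagrangianGrassmannian V) :=
  {A | ∃ a : Fin 10 → ExteriorAlgebra ℂ V, Submodule.span ℂ (Set.range a) = A.1 ∧
    MvPolynomial.eval (fun q => q.2 (a q.1)) P ≠ 0}

/-- The Zariski topology of `LG(⋀³V)`, as the quotient of the variety of bases of Lagrangian
subspaces by the group `GL₁₀`: the quotient map is open, so the images of the principal open
subsets generate the topology. -/
instance : TopologicalSpace (LagrangianGrassmannian V) :=
  TopologicalSpace.generateFrom (Set.range zariskiBasicOpen)

end EPW

end

open scoped TensorProduct
noncomputable section
namespace EPW
open Matrix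

/-! ### Linear spaces of `3 × 3` matrices without elements of rank one -/

/-! Fix a point [U₀] and put k = dim (A ∩ T_{U₀}). In the affine chart at [U₀], the spaces T_U are
the graphs of a symmetric matrix Q(x) over T_{U₀}, with respect to a symplectic basis (`tau`, `lam`)
of ⋀³V. Adapt this basis to A, so that k of the vectors `tau` span A ∩ T_{U₀}. Then the map T_U →
⋀³V/A becomes a 10 × 10 matrix with an invertible block of size 10 - k at the origin. Its Schur
complement S is a symmetric k × k matrix, and its entries generate the local ideal of Z^{≥k}
(`SympFrame.IsAdapted.exists_local_equations`). The smoothness assertions thus become statements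
about the linear parts of the entries of S.

These linear parts are read off from Q. Modulo ⋀³U₀, the space T_{U₀} is the space of 3 × 3
matrices, and the linear part of Q is, up to sign, the polarised matrix of 2 × 2 minors `mixedCof`.
A vector of T_{U₀} whose matrix has rank at most one is decomposable. Hence A ∩ T_{U₀} embeds as a
k-dimensional space K of matrices without elements of rank one (`NoDecomposable.noRankOne`).
Everything local follows from three facts of linear algebra about the map Sym²K → Mat₃ induced by
`mixedCof`: (a) k ≤ 4, because the cone of matrices of rank at most one has dimension 5 in a space
of dimension 9 (`NoRankOne.card_le`); (b) no nonzero symmetric tensor of rank at most 3 lies in the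
kernel (`NoRankOne.eq_zero_of_sum_mixedCof`), so that the map is injective for k ≤ 3; (c) for k = 4
the kernel has dimension at most 1, since a pencil of symmetric tensors has a degenerate member,
which (b) excludes; as dim Sym²K = 10, the map onto the 9-dimensional target is surjective. For (b),
a tensor of rank 2 or 3 is written as PQ or PQ - R², and normal forms of singular 3 × 3 matrices
produce an element of rank one.

If k ≤ 3, the k(k+1)/2 equations have independent linear parts in a regular local ring of dimension
9, which gives smoothness and the dimension. If k = 4, the linear parts span the cotangent space, so
the ideal of Z^{≥4} is the maximal ideal: the point is reduced and isolated, and finiteness follows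
because a Noetherian ring has finitely many minimal primes over an ideal. At such a point the ideal
of Z^{≥3} is nonzero and lies in the square of the maximal ideal, so Z^{≥3} is singular there.

For general A the argument is a parameter count in each chart. If the graph of a symmetric matrix q
meets T_U in dimension at least 4, then q - Q(x) has corank at least 4, which leaves 9 + 21 + 24 =
54 parameters in the 55-dimensional space of symmetric matrices. So q satisfies a fixed nontrivial
polynomial equation. The complement of this equation is open in LG, and it is dense because points
of LG can be joined to it by affine curves. -/

/-- Some nontrivial member of a pencil of complex square matrices is singular. -/
theorem exists_det_pencil_eq_zero {n : Type*} [Fintype n] [DecidableEq n] [Nonempty n]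
    (A B : Matrix n n ℂ) : ∃ s t : ℂ, (s ≠ 0 ∨ t ≠ 0) ∧ (s • A + t • B).det = 0 := by
  by_cases hB : B.det = 0
  · exact ⟨0, 1, by simp, by simpa using hB⟩
  -- An eigenvalue μ of B⁻¹A makes μB - A = B(μ - B⁻¹A) singular.
  obtain ⟨μ, hμ⟩ := IsAlgClosed.exists_root (B⁻¹ * A).charpoly
    (by rw [Matrix.charpoly_degree_eq_dim]; exact_mod_cast Fintype.card_ne_zero)
  refine ⟨-1, μ, by simp, ?_⟩
  rw [Polynomial.IsRoot, Matrix.eval_charpoly] at hμ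
  have h : (-1 : ℂ) • A + μ • B = B * (Matrix.scalar n μ - B⁻¹ * A) := by
    rw [Matrix.mul_sub, ← Matrix.mul_assoc, Matrix.mul_nonsing_inv B (Ne.isUnit hB), Matrix.one_mul,
      Matrix.scalar_apply, ← Matrix.smul_one_eq_diagonal, Matrix.mul_smul, Matrix.mul_one]
    rw [neg_smul, one_smul]; abel
  rw [h, det_mul, hμ, mul_zero]

/-- A quadratic pencil of complex square matrices has a singular member. -/
theorem exists_det_quadratic_pencil_eq_zero {n : Type*} [Fintype n] [DecidableEq n] [Nonempty n]
    (P R Q : Matrix n n ℂ) :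
    Q.det = 0 ∨ ∃ t : ℂ, (P + (2 * t) • R + t ^ 2 • Q).det = 0 := by
  -- Companion linearisation: a kernel vector (a, b) satisfies s b = t a and s P a + 2s R b + t Q b
  -- = 0. If s ≠ 0, then a is killed at the parameter t/s; s = 0 is the parameter at infinity, where
  -- Q b = 0.
  obtain ⟨s, t, hst, h⟩ := exists_det_pencil_eq_zero
    (fromBlocks P ((2 : ℂ) • R) 0 1) (fromBlocks 0 Q (-1) 0 : Matrix (n ⊕ n) (n ⊕ n) ℂ)
  obtain ⟨v, hv, hv0⟩ := exists_mulVec_eq_zero_iff.2 h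
  have hv1 : v = Sum.elim (v ∘ Sum.inl) (v ∘ Sum.inr) := (Sum.elim_comp_inl_inr v).symm
  set a := v ∘ Sum.inl
  set b := v ∘ Sum.inr
  rw [hv1, fromBlocks_smul, fromBlocks_smul, fromBlocks_add, fromBlocks_mulVec,
    ← Sum.elim_zero_zero, Sum.elim_eq_iff] at hv0
  simp only [Sum.elim_comp_inl, Sum.elim_comp_inr, smul_zero, add_zero, zero_add, smul_neg,
    add_mulVec, smul_mulVec, neg_mulVec, one_mulVec] at hv0
  obtain ⟨h1, h2⟩ := hv0
  by_cases hs : s = 0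
  · subst hs
    have ht : t ≠ 0 := by simpa using hst
    have ha : a = 0 := by simpa [ht] using h2
    left
    refine exists_mulVec_eq_zero_iff.1 ⟨b, ?_, by simpa [ha, ht] using h1⟩
    rintro hb
    exact hv (by rw [hv1, ha, hb]; simp)
  · right
    have hb : b = (t / s) • a := by
      have h3 : s • b = t • a := by rw [← sub_eq_zero]; simpa [sub_eq_neg_add] using h2
      rw [div_eq_inv_mul, mul_smul, ← h3, smul_smul, inv_mul_cancel₀ hs, one_smul]
    refine ⟨t / s, exists_mulVec_eq_zero_iff.1 ⟨a, ?_, ?_⟩⟩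
    · rintro ha
      exact hv (by rw [hv1, hb, ha]; simp)
    · rw [hb] at h1
      simp only [mulVec_smul, smul_smul] at h1
      rw [add_mulVec, add_mulVec, smul_mulVec, smul_mulVec]
      have : s • (P *ᵥ a + (2 * (t / s)) • R *ᵥ a + (t / s) ^ 2 • Q *ᵥ a) = 0 := by
        rw [← h1]; simp only [smul_add, smul_smul]
        have e1 : s * (t / s) ^ 2 = t * (t / s) := by field_simp
        rw [e1]
        module
      exact (smul_eq_zero.1 this).resolve_left hs

/-- Every column of the adjugate is proportional to a kernel vector w. Replacing row j by a row that
is orthogonal to w keeps w in the kernel, and expanding the vanishing determinant along that row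
gives the proportion. -/
theorem adjugate_mul_eq_of_mulVec_eq_zero {n : Type*} [Fintype n] [DecidableEq n]
    {B : Matrix n n ℂ} {w : n → ℂ} (h : B *ᵥ w = 0) (i j k : n) :
    B.adjugate i j * w k = B.adjugate k j * w i := by
  by_cases hw : w = 0
  · simp [hw]
  have h0 : (B.updateRow j (w k • Pi.single i 1 - w i • Pi.single k 1)).det = 0 := by
    refine exists_mulVec_eq_zero_iff.1 ⟨w, hw, ?_⟩
    ext l
    by_cases hl : l = j
    · subst hl
      rw [mulVec, updateRow_self, sub_dotProduct, smul_dotProduct, smul_dotProduct,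
        single_dotProduct, single_dotProduct]
      simp [mul_comm]
    · have := congrFun h l
      simpa [mulVec, updateRow_ne hl] using this
  rw [sub_eq_add_neg, ← neg_smul, det_updateRow_add, det_updateRow_smul, det_updateRow_smul,
    ← adjugate_apply, ← adjugate_apply] at h0
  linear_combination h0

theorem adjugate_mul_eq_of_vecMul_eq_zero {n : Type*} [Fintype n] [DecidableEq n]
    {B : Matrix n n ℂ} {w : n → ℂ} (h : w ᵥ* B = 0) (i j k : n) :
    B.adjugate i j * w k = B.adjugate i k * w j := by
  have := adjugate_mul_eq_of_mulVec_eq_zero (B := Bᵀ) (w := w) (by rw [mulVec_transpose, h]) j i k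
  simpa [← adjugate_transpose] using this

abbrev Mat3 : Type := Matrix (Fin 3) (Fin 3) ℂ

/-- The polarisation of the matrix of cofactors: `mixedCof X X` is twice the matrix of cofactors
of `X`. -/
def mixedCof : Mat3 →ₗ[ℂ] Mat3 →ₗ[ℂ] Mat3 :=
  LinearMap.mk₂ ℂ (fun X Y => Matrix.of fun b m =>
      X (b + 1) (m + 1) * Y (b + 2) (m + 2) + X (b + 2) (m + 2) * Y (b + 1) (m + 1)
      - X (b + 1) (m + 2) * Y (b + 2) (m + 1) - X (b + 2) (m + 1) * Y (b + 1) (m + 2))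
    (by intros; ext; simp; ring) (by intros; ext; simp; ring)
    (by intros; ext; simp; ring) (by intros; ext; simp; ring)

theorem mixedCof_apply (X Y : Mat3) (b m : Fin 3) : mixedCof X Y b m =
    X (b + 1) (m + 1) * Y (b + 2) (m + 2) + X (b + 2) (m + 2) * Y (b + 1) (m + 1)
      - X (b + 1) (m + 2) * Y (b + 2) (m + 1) - X (b + 2) (m + 1) * Y (b + 1) (m + 2) := rfl

theorem mixedCof_comm (X Y : Mat3) : mixedCof X Y = mixedCof Y X := by
  ext b m; simp only [mixedCof_apply]; ring

theorem mixedCof_self (X : Mat3) : mixedCof X X = (2 : ℂ) • X.adjugateᵀ := by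
  ext b m
  rw [mixedCof_apply, adjugate_fin_three]
  fin_cases b <;> fin_cases m <;> simp <;> ring

theorem mixedCof_self_eq_zero_iff (X : Mat3) : mixedCof X X = 0 ↔ X.adjugate = 0 := by
  rw [mixedCof_self]; simp

theorem adjugate_smul_add_smul (s t : ℂ) (X Y : Mat3) :
    (s • X + t • Y).adjugate =
      s ^ 2 • X.adjugate + (s * t) • (mixedCof X Y)ᵀ + t ^ 2 • Y.adjugate := by
  ext b m
  simp only [adjugate_fin_three, Matrix.add_apply, Matrix.smul_apply, transpose_apply, mixedCof_apply]
  fin_cases b <;> fin_cases m <;> simp <;> ring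

/-- The coefficient of t in (X + tY) adj(X + tY) = det(X + tY). -/
theorem mul_adjugate_polar (X Y : Mat3) :
    Y * X.adjugate + X * (mixedCof X Y)ᵀ = (X.adjugate * Y).trace • 1 := by
  ext b m
  simp only [adjugate_fin_three, Matrix.add_apply, Matrix.smul_apply, transpose_apply, mixedCof_apply, mul_apply,
    Fin.sum_univ_three, trace_fin_three]
  fin_cases b <;> fin_cases m <;> simp <;> ring

theorem adjugate_polar_mul (X Y : Mat3) :
    X.adjugate * Y + (mixedCof X Y)ᵀ * X = (X.adjugate * Y).trace • 1 := by
  ext b m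
  simp only [adjugate_fin_three, Matrix.add_apply, Matrix.smul_apply, transpose_apply, mixedCof_apply, mul_apply,
    Fin.sum_univ_three, trace_fin_three]
  fin_cases b <;> fin_cases m <;> simp <;> ring

theorem exists_sq_mul_add_sq_mul_eq_zero (a b : ℂ) :
    ∃ s t : ℂ, (s ≠ 0 ∨ t ≠ 0) ∧ s ^ 2 * a + t ^ 2 * b = 0 := by
  by_cases ha : a = 0
  · exact ⟨1, 0, by simp, by simp [ha]⟩
  obtain ⟨z, hz⟩ := IsAlgClosed.exists_pow_nat_eq (-b / a) (n := 2) (by norm_num)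
  exact ⟨z, 1, by simp, by rw [hz]; field_simp; ring⟩

/-- In a pencil of `3 × 3` matrices without elements of rank one, no two independent elements are
conjugate with respect to all `2 × 2` minors. -/
theorem mixedCof_ne_zero_of_pencil {X Y : Mat3}
    (H : ∀ s t : ℂ, (s • X + t • Y).adjugate = 0 → s = 0 ∧ t = 0) : mixedCof X Y ≠ 0 := by
  intro h0
  -- If the polar term vanishes, then Y adj X = c·1 for a scalar c. An invertible X would make Y a
  -- multiple of X; so det X = 0, and taking determinants forces c = 0.
  have hsing : ∀ X Y : Mat3, (∀ s t : ℂ, (s • X + t • Y).adjugate = 0 → s = 0 ∧ t = 0) →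
      mixedCof X Y = 0 → X.det = 0 ∧ Y * X.adjugate = 0 ∧ X.adjugate * Y = 0 := by
    intro X Y H h0
    have h1 := mul_adjugate_polar X Y
    have h2 := adjugate_polar_mul X Y
    rw [h0] at h1 h2
    simp only [transpose_zero, mul_zero, zero_mul, add_zero] at h1 h2
    set c := (X.adjugate * Y).trace
    have hX : X.det = 0 := by
      by_contra hd
      have h3 : (c • X + (-X.det) • Y) * X.adjugate = 0 := by
        rw [add_mul, smul_mul_assoc, smul_mul_assoc, h1, mul_adjugate, smul_smul, smul_smul]
        rw [← add_smul]; ring_nf; simp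
      have h4 : c • X + (-X.det) • Y = 0 := by
        have h5 : (c • X + (-X.det) • Y) * X.adjugate * X = 0 := by rw [h3, zero_mul]
        rw [Matrix.mul_assoc, adjugate_mul, Matrix.mul_smul, Matrix.mul_one] at h5
        exact (smul_eq_zero.1 h5).resolve_left hd
      have h5 := H c (-X.det) (by rw [h4]; exact adjugate_zero)
      exact hd (by simpa using h5.2)
    have hc : c = 0 := by
      have h3 := congrArg det h1
      rw [det_mul, det_adjugate, hX] at h3
      simpa using h3.symm
    rw [hc, zero_smul] at h1 h2
    exact ⟨hX, h1, h2⟩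
  have hX := hsing X Y H h0
  have hY := hsing Y X (fun s t h => (H t s (by rwa [add_comm])).symm) (by rw [mixedCof_comm, h0])
  have hX0 : X.adjugate ≠ 0 := fun h => by simpa using (H 1 0 (by simpa using h)).1
  obtain ⟨i, j, hij⟩ : ∃ i j, X.adjugate i j ≠ 0 := by
    by_contra! hcon
    exact hX0 (by ext i j; simpa using hcon i j)
  -- Both adj X and N = adj(sX + tY) are annihilated by X on either side. Since adj X ≠ 0, this
  -- makes N a multiple of adj X, so killing the one entry where adj X is nonzero kills N.
  obtain ⟨s, t, hst, hN⟩ := exists_sq_mul_add_sq_mul_eq_zero (X.adjugate i j) (Y.adjugate i j)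
  set N := s ^ 2 • X.adjugate + t ^ 2 • Y.adjugate with hNdef
  have hNij : N i j = 0 := by simpa [hNdef] using hN
  have h1 : X * N = 0 := by
    rw [hNdef, Matrix.mul_add, Matrix.mul_smul, Matrix.mul_smul, hY.2.1, mul_adjugate, hX.1]; simp
  have h2 : N * X = 0 := by
    rw [hNdef, Matrix.add_mul, Matrix.smul_mul, Matrix.smul_mul, hY.2.2, adjugate_mul, hX.1]; simp
  have hN0 : N = 0 := by
    ext k l
    have e1 := adjugate_mul_eq_of_mulVec_eq_zero (B := X) (w := fun k => N k l)
      (by ext a; exact congrFun (congrFun h1 a) l) i j k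
    have e2 := adjugate_mul_eq_of_vecMul_eq_zero (B := X) (w := fun l => N i l)
      (by ext a; exact congrFun (congrFun h2 i) a) i j l
    simp only [hNij, mul_zero] at e1 e2
    have e3 : N i l = 0 := by simpa [hij] using e2
    rw [e3, mul_zero] at e1
    simpa [hij] using e1
  have := H s t (by rw [adjugate_smul_add_smul, h0, transpose_zero, smul_zero, add_zero, ← hNdef, hN0])
  rcases hst with h | h
  · exact h this.1
  · exact h this.2

/-- A net of `3 × 3` matrices with zero last row contains a matrix of rank at most one. -/
theorem exists_adjugate_eq_zero_of_row_eq_zero {P Q R : Mat3}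
    (hP : ∀ j, P 2 j = 0) (hQ : ∀ j, Q 2 j = 0) (hR : ∀ j, R 2 j = 0) :
    ¬ ∀ x y z : ℂ, (x • P + y • Q + z • R).adjugate = 0 → x = 0 ∧ y = 0 ∧ z = 0 := by
  intro H
  -- The vector v found here makes the first two rows of B satisfy s B₀ + t B₁ = 0; as the last row
  -- is zero, B has rank at most one.
  obtain ⟨s, t, hst, h⟩ := exists_det_pencil_eq_zero
    (Matrix.of ![P 0, Q 0, R 0]) (Matrix.of ![P 1, Q 1, R 1])
  obtain ⟨v, hv, hv0⟩ := exists_vecMul_eq_zero_iff.2 h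
  set B := v 0 • P + v 1 • Q + v 2 • R with hB
  have hrow : ∀ j, s * B 0 j + t * B 1 j = 0 := by
    intro j
    have := congrFun hv0 j
    simp only [vecMul, dotProduct, Fin.sum_univ_three, Matrix.add_apply, Matrix.smul_apply, of_apply,
      cons_val_zero, cons_val_one, cons_val, smul_eq_mul, Pi.zero_apply] at this
    simp only [hB, Matrix.add_apply, Matrix.smul_apply, smul_eq_mul]
    linear_combination this
  have hrow2 : ∀ j, B 2 j = 0 := by intro j; simp [hB, hP, hQ, hR]
  have hmin : ∀ i j, B 0 i * B 1 j - B 0 j * B 1 i = 0 := by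
    intro i j
    rcases hst with hs | ht
    · refine (mul_eq_zero.1 ?_).resolve_left hs
      linear_combination B 1 j * hrow i - B 1 i * hrow j
    · refine (mul_eq_zero.1 ?_).resolve_left ht
      linear_combination B 0 i * hrow j - B 0 j * hrow i
  have hadj : B.adjugate = 0 := by
    rw [adjugate_fin_three]
    ext i j
    fin_cases i <;> fin_cases j <;> simp [hrow2]
    · linear_combination hmin 1 2
    · linear_combination -hmin 0 2
    · linear_combination hmin 0 1
  have h3 := H _ _ _ hadj
  exact hv (by ext i; fin_cases i; exacts [h3.1, h3.2.1, h3.2.2])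

end EPW
end

/-! ### Normal form of matrices of rank two, and nets of matrices -/

open scoped TensorProduct
noncomputable section
namespace EPW
open Matrix

theorem transpose_mixedCof (X Y : Mat3) :
    (mixedCof X Y)ᵀ = (X + Y).adjugate - X.adjugate - Y.adjugate := by
  have := adjugate_smul_add_smul 1 1 X Y
  simp only [one_smul, one_pow, mul_one] at this
  rw [this]; abel

theorem transpose_mixedCof_mul_mul (g h X Y : Mat3) :
    (mixedCof (g * X * h) (g * Y * h))ᵀ = h.adjugate * (mixedCof X Y)ᵀ * g.adjugate := by
  simp only [transpose_mixedCof, ← Matrix.add_mul, ← Matrix.mul_add, adjugate_mul_distrib,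
    Matrix.mul_sub, Matrix.sub_mul, Matrix.mul_assoc]

theorem adjugate_mul_mul_eq_zero_iff {g h : Mat3} (hg : g.det ≠ 0) (hh : h.det ≠ 0) (X : Mat3) :
    (g * X * h).adjugate = 0 ↔ X.adjugate = 0 := by
  constructor
  · intro H
    rw [adjugate_mul_distrib, adjugate_mul_distrib] at H
    have h1 : h * (h.adjugate * (X.adjugate * g.adjugate)) * g = 0 := by rw [H]; simp
    have h2 : h * (h.adjugate * (X.adjugate * g.adjugate)) * g
        = (h * h.adjugate) * X.adjugate * (g.adjugate * g) := by
      simp only [Matrix.mul_assoc]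
    rw [h2, mul_adjugate, adjugate_mul, Matrix.smul_mul, Matrix.smul_mul, Matrix.mul_smul] at h1
    simpa [hg, hh] using h1
  · intro H
    rw [adjugate_mul_distrib, adjugate_mul_distrib, H]; simp

theorem exists_det_ne_zero_col_eq {v : Fin 3 → ℂ} (hv : v ≠ 0) :
    ∃ h : Mat3, h.det ≠ 0 ∧ ∀ i, h i 2 = v i := by
  obtain ⟨k, hk⟩ : ∃ k, v k ≠ 0 := by
    by_contra! hcon; exact hv (funext hcon)
  have hd : ((1 : Mat3).updateCol k v).det = v k := by
    rw [← cramer_apply, cramer_one]; rfl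
  refine ⟨((1 : Mat3).updateCol k v).submatrix id (Equiv.swap k 2), ?_, ?_⟩
  · rw [det_permute', hd]
    simp [hk]
  · intro i
    simp

/-- Put a right and a left kernel vector into the last column of h and the last row of the left
factor. This clears the last column and row, and the remaining 2 × 2 block is invertible because the
adjugate is nonzero. -/
theorem exists_mul_mul_eq_diagonal {P : Mat3} (hdet : P.det = 0) (hadj : P.adjugate ≠ 0) :
    ∃ g h : Mat3, g.det ≠ 0 ∧ h.det ≠ 0 ∧ g * P * h = diagonal ![1, 1, 0] := by
  obtain ⟨v, hv, hPv⟩ := exists_mulVec_eq_zero_iff.2 hdet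
  obtain ⟨w, hw, hPw⟩ := exists_vecMul_eq_zero_iff.2 hdet
  obtain ⟨h, hh, hh2⟩ := exists_det_ne_zero_col_eq hv
  obtain ⟨g, hg, hg2⟩ := exists_det_ne_zero_col_eq hw
  have hg' : gᵀ.det ≠ 0 := by rwa [det_transpose]
  set N := gᵀ * P * h with hN
  have hcol : ∀ i, N i 2 = 0 := by
    intro i
    have : (P * h).col 2 = 0 := by
      rw [← hPv]; ext a; simp [mul_apply, mulVec, dotProduct, hh2]
    rw [hN, Matrix.mul_assoc, mul_apply]
    exact Finset.sum_eq_zero fun a _ => by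
      have := congrFun this a
      simp only [col_apply, Pi.zero_apply] at this
      rw [this, mul_zero]
  have hrow : ∀ j, N 2 j = 0 := by
    intro j
    have : (gᵀ * P).row 2 = 0 := by
      rw [← hPw]; ext a; simp [mul_apply, vecMul, dotProduct, hg2]
    rw [hN, mul_apply]
    exact Finset.sum_eq_zero fun a _ => by
      have := congrFun this a
      simp only [row_apply, Pi.zero_apply] at this
      rw [this, zero_mul]
  have hNadj : N.adjugate ≠ 0 := fun H => hadj ((adjugate_mul_mul_eq_zero_iff hg' hh P).1 H)
  have hΔ : N 0 0 * N 1 1 - N 0 1 * N 1 0 ≠ 0 := by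
    intro H
    apply hNadj
    rw [adjugate_fin_three]
    ext i j
    fin_cases i <;> fin_cases j <;> simp [hrow, hcol, H]
  set Δ := N 0 0 * N 1 1 - N 0 1 * N 1 0
  set g' : Mat3 := !![N 1 1 / Δ, -N 0 1 / Δ, 0; -N 1 0 / Δ, N 0 0 / Δ, 0; 0, 0, 1] with hg'def
  refine ⟨g' * gᵀ, h, ?_, hh, ?_⟩
  · rw [det_mul]
    refine mul_ne_zero ?_ hg'
    have : g'.det = 1 / Δ := by
      rw [det_fin_three]
      simp [hg'def]
      field_simp
      simp only [Δ]; ring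
    rw [this]
    exact one_div_ne_zero hΔ
  · rw [Matrix.mul_assoc, Matrix.mul_assoc, ← Matrix.mul_assoc gᵀ, ← hN]
    ext i j
    rw [mul_apply, Fin.sum_univ_three]
    fin_cases i <;> fin_cases j <;> simp [hg'def, hrow, hcol] <;> field_simp <;> ring

/-- The case of a standard matrix of rank two in `mixedCof_ne_of_net`. -/
theorem mixedCof_diagonal_ne_of_net {Q R : Mat3}
    (H : ∀ x y z : ℂ, (x • diagonal ![1, 1, 0] + y • Q + z • R : Mat3).adjugate = 0 →
      x = 0 ∧ y = 0 ∧ z = 0) (hdet : R.det = 0) :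
    mixedCof (diagonal ![1, 1, 0]) Q ≠ mixedCof R R := by
  intro h
  rw [mixedCof_self] at h
  have hR : R.adjugate ≠ 0 := fun h0 => by simpa using (H 0 0 1 (by simpa using h0)).2.2
  have hRR := R.adjugate_mul
  have hRR' := R.mul_adjugate
  rw [hdet, zero_smul] at hRR hRR'
  -- The adjugate N of R has vanishing 2 × 2 minors, while the equation forces N₀₁ = N₁₀ = 0 and N₀₀
  -- = N₁₁. So the upper left block of N is zero, and N lives in its last column or its last row.
  -- Then Q and R, like the diagonal matrix, have zero last row or zero last column, which is
  -- excluded.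
  have hmin : R.adjugate.adjugate = 0 := by
    rw [adjugate_adjugate _ (by simp)]; simp [hdet]
  set N := R.adjugate with hN
  have e : ∀ b m, mixedCof (diagonal ![1, 1, 0]) Q b m = 2 * N m b := by
    intro b m; rw [h]; simp
  have e00 := e 0 0
  have e01 := e 0 1
  have e02 := e 0 2
  have e10 := e 1 0
  have e11 := e 1 1
  have e12 := e 1 2
  have e20 := e 2 0
  have e21 := e 2 1
  have e22 := e 2 2
  simp [mixedCof_apply, diagonal] at e00 e01 e02 e10 e11 e12 e20 e21 e22
  rw [adjugate_fin_three] at hmin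
  have m22 := congrFun (congrFun hmin 2) 2
  have m00 := congrFun (congrFun hmin 0) 0
  have m01 := congrFun (congrFun hmin 0) 1
  have m10 := congrFun (congrFun hmin 1) 0
  have m11 := congrFun (congrFun hmin 1) 1
  simp at m22 m00 m01 m10 m11
  have n00 : N 0 0 = N 1 1 := by linear_combination (e11 - e00) / 2
  have n11 : N 1 1 = 0 := by
    have : N 1 1 ^ 2 = 0 := by
      linear_combination m22 - N 1 1 * n00 + N 0 1 * e01
    simpa using this
  have n00' : N 0 0 = 0 := n00.trans n11
  have q22 : Q 2 2 = 0 := by linear_combination e00 + 2 * n00'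
  simp only [n11, n00', e01, e10, zero_mul, neg_zero, zero_add, zero_sub, neg_eq_zero,
    mul_eq_zero] at m00 m01 m10 m11
  have hcases : (N 2 0 = 0 ∧ N 2 1 = 0) ∨ (N 0 2 = 0 ∧ N 1 2 = 0) := by
    by_cases a : N 0 2 = 0
    · by_cases b : N 1 2 = 0
      · exact Or.inr ⟨a, b⟩
      · exact Or.inl ⟨m10.resolve_left b, m00.resolve_left b⟩
    · exact Or.inl ⟨m11.resolve_left a, m01.resolve_left a⟩
  rcases hcases with ⟨h1, h2⟩ | ⟨h1, h2⟩
  · rw [h1] at e02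
    rw [h2] at e12
    have hq : ∀ j, Q 2 j = 0 := by
      intro j; fin_cases j
      · simpa using e02
      · simpa using e12
      · exact q22
    have hr : ∀ j, R 2 j = 0 := by
      intro j
      by_contra hj
      refine hR ?_
      ext a b
      have h3 := congrFun (congrFun hRR a) j
      rw [mul_apply, Fin.sum_univ_three] at h3
      have h4 : N a 0 = 0 := by fin_cases a; exacts [n00', e01, h1]
      have h5 : N a 1 = 0 := by fin_cases a; exacts [e10, n11, h2]
      rw [h4, h5, zero_mul, zero_mul, zero_add, zero_add] at h3
      have h6 : N a 2 = 0 := (mul_eq_zero.1 h3).resolve_right hj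
      fin_cases b; exacts [h4, h5, h6]
    exact exists_adjugate_eq_zero_of_row_eq_zero (by intro j; fin_cases j <;> simp) hq hr H
  · rw [h1] at e20
    rw [h2] at e21
    have hq : ∀ j, Q j 2 = 0 := by
      intro j; fin_cases j
      · simpa using e20
      · simpa using e21
      · exact q22
    have hr : ∀ j, R j 2 = 0 := by
      intro j
      by_contra hj
      refine hR ?_
      ext a b
      have h3 := congrFun (congrFun hRR' j) b
      rw [mul_apply, Fin.sum_univ_three] at h3
      have h4 : N 0 b = 0 := by fin_cases b; exacts [n00', e10, h1]
      have h5 : N 1 b = 0 := by fin_cases b; exacts [e01, n11, h2]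
      rw [h4, h5, mul_zero, mul_zero, zero_add, zero_add] at h3
      have h6 : N 2 b = 0 := (mul_eq_zero.1 h3).resolve_left hj
      fin_cases a; exacts [h4, h5, h6]
    refine exists_adjugate_eq_zero_of_row_eq_zero (P := diagonal ![1, 1, 0]) (Q := Qᵀ) (R := Rᵀ)
      (by intro j; fin_cases j <;> simp) hq hr fun x y z hxyz => H x y z ?_
    have : x • diagonal ![1, 1, 0] + y • Qᵀ + z • Rᵀ
        = (x • diagonal ![1, 1, 0] + y • Q + z • R : Mat3)ᵀ := by
      simp [diagonal_transpose]
    rw [this, ← adjugate_transpose] at hxyz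
    simpa using hxyz

/-- In a net of `3 × 3` matrices without elements of rank one, no nondegenerate dual conic
is apolar to all `2 × 2` minors. -/
theorem mixedCof_ne_of_net {P Q R : Mat3}
    (H : ∀ x y z : ℂ, (x • P + y • Q + z • R).adjugate = 0 → x = 0 ∧ y = 0 ∧ z = 0) :
    mixedCof P Q ≠ mixedCof R R := by
  have step1 : ∀ P Q R : Mat3,
      (∀ x y z : ℂ, (x • P + y • Q + z • R).adjugate = 0 → x = 0 ∧ y = 0 ∧ z = 0) →
      P.det = 0 → mixedCof P Q = mixedCof R R → False := by
    intro P Q R H hdet hPQ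
    have hP : P.adjugate ≠ 0 := fun h0 => by simpa using (H 1 0 0 (by simpa using h0)).1
    obtain ⟨g, h, hg, hh, hgh⟩ := exists_mul_mul_eq_diagonal hdet hP
    have H' : ∀ x y z : ℂ, (x • diagonal ![1, 1, 0] + y • (g * Q * h) + z • (g * R * h) :
        Mat3).adjugate = 0 → x = 0 ∧ y = 0 ∧ z = 0 := by
      intro x y z hxyz
      refine H x y z ((adjugate_mul_mul_eq_zero_iff hg hh _).1 ?_)
      rw [← hxyz, ← hgh]
      simp only [Matrix.mul_add, Matrix.add_mul, Matrix.mul_smul, Matrix.smul_mul]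
    have hPQ' : mixedCof (diagonal ![1, 1, 0]) (g * Q * h)
        = mixedCof (g * R * h) (g * R * h) := by
      rw [← hgh]
      apply transpose_injective
      rw [transpose_mixedCof_mul_mul, transpose_mixedCof_mul_mul, hPQ]
    generalize g * Q * h = Q' at H' hPQ'
    generalize g * R * h = R' at H' hPQ'
    -- move the third matrix along the tangent line to a singular matrix
    obtain ⟨t, ht⟩ : ∃ t : ℂ, (R' + t • diagonal ![1, 1, 0] : Mat3).det = 0 := by
      have hdet : ∀ t : ℂ, (R' + t • diagonal ![1, 1, 0] : Mat3).det =
          R' 2 2 * t ^ 2 + (R'.adjugate 0 0 + R'.adjugate 1 1) * t + R'.det := by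
        intro t
        simp [det_fin_three, adjugate_fin_three, diagonal]
        ring
      by_cases h0 : R'.det = 0
      · exact ⟨0, by simpa using h0⟩
      have hN : R'.adjugate.det ≠ 0 := by
        rw [det_adjugate]; exact pow_ne_zero _ h0
      have e : ∀ b m, mixedCof (diagonal ![1, 1, 0]) Q' b m = 2 * R'.adjugate m b := by
        intro b m; rw [hPQ', mixedCof_self]; simp
      have e00 := e 0 0
      have e01 := e 0 1
      have e10 := e 1 0
      have e11 := e 1 1
      simp [mixedCof_apply, diagonal] at e00 e01 e10 e11
      -- The determinant is a polynomial of degree at most two in t. Its linear coefficient cannot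
      -- vanish, since otherwise the upper left block of the adjugate would be zero and the adjugate
      -- singular. So a root exists even when the quadratic coefficient is zero.
      have ha : R'.adjugate 0 0 + R'.adjugate 1 1 ≠ 0 := by
        intro ha
        have n0 : R'.adjugate 0 0 = 0 := by linear_combination (ha + (e11 - e00) / 2) / 2
        have n1 : R'.adjugate 1 1 = 0 := by linear_combination ha - n0
        apply hN
        rw [det_fin_three, n0, n1, e01, e10]
        ring
      simp only [hdet]
      by_cases h2 : R' 2 2 = 0
      · exact ⟨-R'.det / (R'.adjugate 0 0 + R'.adjugate 1 1), by rw [h2]; field_simp; ring⟩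
      · obtain ⟨z, hz⟩ := IsAlgClosed.exists_pow_nat_eq
          ((R'.adjugate 0 0 + R'.adjugate 1 1) ^ 2 - 4 * R' 2 2 * R'.det) (n := 2) (by norm_num)
        obtain ⟨x, hx⟩ := exists_quadratic_eq_zero h2 ⟨z, by rw [discrim, ← hz, sq]⟩
        exact ⟨x, by linear_combination hx⟩
    refine mixedCof_diagonal_ne_of_net (Q := Q' + (2 * t) • R' + t ^ 2 • diagonal ![1, 1, 0])
      (R := R' + t • diagonal ![1, 1, 0]) ?_ ht ?_
    · intro x y z hxyz
      have h3 := H' (x + y * t ^ 2 + z * t) y (2 * t * y + z) (by rw [← hxyz]; congr 1; module)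
      obtain ⟨h3, h4, h5⟩ := h3
      subst h4
      have h5 : z = 0 := by simpa using h5
      subst h5
      simpa using h3
    · simp only [map_add, map_smul, LinearMap.add_apply, LinearMap.smul_apply, hPQ',
        mixedCof_comm R' (diagonal ![1, 1, 0])]
      module
  intro hPQ
  -- The form PQ - R² is unchanged when P becomes P + 2tR + t²Q and R becomes R + tQ. This freedom
  -- makes P singular, unless Q already is.
  rcases exists_det_quadratic_pencil_eq_zero P R Q with h | ⟨t, ht⟩
  · refine step1 Q P R (fun x y z hxyz => ?_) h (by rw [mixedCof_comm, hPQ])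
    have := H y x z (by rw [← hxyz]; congr 1; module)
    tauto
  · refine step1 (P + (2 * t) • R + t ^ 2 • Q) Q (R + t • Q) ?_ ht ?_
    · intro x y z hxyz
      have h3 := H x (y + x * t ^ 2 + z * t) (2 * t * x + z) (by rw [← hxyz]; congr 1; module)
      obtain ⟨h3, h4, h5⟩ := h3
      subst h3
      have h5 : z = 0 := by simpa using h5
      subst h5
      simpa using h4
    · simp only [map_add, map_smul, LinearMap.add_apply, LinearMap.smul_apply, hPQ,
        mixedCof_comm Q R]
      module
end EPW
end

/-! ### Symmetric tensors killed by all 2 × 2 minors -/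

open scoped TensorProduct
noncomputable section
namespace EPW
open Matrix

theorem exists_diagonalization {κ : Type*} [Fintype κ] [DecidableEq κ] {S : Matrix κ κ ℂ}
    (hS : S.IsSymm) : ∃ (W : Matrix κ κ ℂ) (d : κ → ℂ), W.det ≠ 0 ∧ S = Wᵀ * diagonal d * W := by
  haveI : Invertible (2 : ℂ) := invertibleOfNonzero two_ne_zero
  have hsymm : LinearMap.IsSymm (Matrix.toBilin' S) := by
    rw [LinearMap.isSymm_def]
    intro x y
    simp only [Matrix.toBilin'_apply', RingHom.id_apply]
    rw [dotProduct_mulVec, ← mulVec_transpose, hS.eq, dotProduct_comm]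
  obtain ⟨v, hv⟩ := LinearMap.BilinForm.exists_orthogonal_basis hsymm
  have e : Fin (Module.finrank ℂ (κ → ℂ)) ≃ κ :=
    Fintype.equivOfCardEq (by simp)
  let v' := v.reindex e
  let M : Matrix κ κ ℂ := (Pi.basisFun ℂ κ).toMatrix v'
  have hMinv : M * v'.toMatrix (Pi.basisFun ℂ κ) = 1 :=
    Module.Basis.toMatrix_mul_toMatrix_flip _ _
  have hdet : M.det ≠ 0 := by
    intro h
    have := congrArg det hMinv
    rw [det_mul, h] at this
    simp at this
  have hM : Mᵀ * S * M = diagonal fun i => Matrix.toBilin' S (v' i) (v' i) := by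
    ext i j
    have h1 : (Mᵀ * S * M) i j = Matrix.toBilin' S (v' i) (v' j) := by
      rw [Matrix.toBilin'_apply', Matrix.mul_assoc, mul_apply]
      rfl
    rw [h1]
    by_cases hij : i = j
    · subst hij; simp
    · rw [diagonal_apply_ne _ hij]
      simp only [v', Module.Basis.reindex_apply]
      exact hv (fun h => hij (e.symm.injective h))
  refine ⟨M⁻¹, fun i => Matrix.toBilin' S (v' i) (v' i), ?_, ?_⟩
  · rw [det_nonsing_inv, Ring.inverse_eq_inv']; exact inv_ne_zero hdet
  · rw [← hM, transpose_nonsing_inv]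
    have hu : IsUnit M.det := Ne.isUnit hdet
    have hu' : IsUnit Mᵀ.det := by rwa [det_transpose]
    simp only [Matrix.mul_assoc]
    rw [mul_nonsing_inv _ hu, ← Matrix.mul_assoc Mᵀ⁻¹, nonsing_inv_mul _ hu']
    simp

/-- A family of `3 × 3` matrices that is linearly independent and whose span contains no matrix of
rank one. -/
def NoRankOne {κ : Type*} [Fintype κ] (B : κ → Mat3) : Prop :=
  ∀ c : κ → ℂ, (∑ i, c i • B i).adjugate = 0 → c = 0

theorem NoRankOne.pair {κ : Type*} [Fintype κ] [DecidableEq κ] {B : κ → Mat3} (hB : NoRankOne B)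
    {a b : κ} (hab : a ≠ b) (x y : ℂ) (h : (x • B a + y • B b).adjugate = 0) : x = 0 ∧ y = 0 := by
  have := hB (Pi.single a x + Pi.single b y) (by
    simpa [add_smul, Finset.sum_add_distrib, Pi.single_apply, ite_smul] using h)
  have h1 := congrFun this a
  have h2 := congrFun this b
  simp [hab, hab.symm] at h1 h2
  exact ⟨h1, h2⟩

theorem NoRankOne.triple {κ : Type*} [Fintype κ] [DecidableEq κ] {B : κ → Mat3} (hB : NoRankOne B)
    {a b c : κ} (hab : a ≠ b) (hac : a ≠ c) (hbc : b ≠ c) (x y z : ℂ)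
    (h : (x • B a + y • B b + z • B c).adjugate = 0) : x = 0 ∧ y = 0 ∧ z = 0 := by
  have := hB (Pi.single a x + Pi.single b y + Pi.single c z) (by
    simpa [add_smul, Finset.sum_add_distrib, Pi.single_apply, ite_smul] using h)
  have h1 := congrFun this a
  have h2 := congrFun this b
  have h3 := congrFun this c
  simp [hab, hab.symm, hac, hac.symm, hbc, hbc.symm] at h1 h2 h3
  exact ⟨h1, h2, h3⟩

theorem NoRankOne.comp_det_ne_zero {κ : Type*} [Fintype κ] [DecidableEq κ] {B : κ → Mat3}
    (hB : NoRankOne B) {W : Matrix κ κ ℂ} (hW : W.det ≠ 0) :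
    NoRankOne fun l => ∑ i, W l i • B i := by
  intro c hc
  have h1 : ∑ l, c l • ∑ i, W l i • B i = ∑ i, (c ᵥ* W) i • B i := by
    simp only [Finset.smul_sum, smul_smul, vecMul, dotProduct, Finset.sum_smul]
    exact Finset.sum_comm
  rw [h1] at hc
  by_contra hne
  exact hW (exists_vecMul_eq_zero_iff.1 ⟨c, hne, hB _ hc⟩)

/-- A symmetric tensor of rank at most three in a space of `3 × 3` matrices without elements of
rank one is not killed by all `2 × 2` minors. -/
theorem NoRankOne.eq_zero_of_sum_mixedCof {κ : Type*} [Fintype κ] [DecidableEq κ] {B : κ → Mat3}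
    (hB : NoRankOne B) {S : Matrix κ κ ℂ} (hS : S.IsSymm)
    (hrank : Fintype.card κ ≤ 3 ∨ (Fintype.card κ ≤ 4 ∧ S.det = 0))
    (h : ∑ i, ∑ j, S i j • mixedCof (B i) (B j) = 0) : S = 0 := by
  obtain ⟨W, d, hW, hd⟩ := exists_diagonalization hS
  set C : κ → Mat3 := fun l => ∑ i, W l i • B i with hC
  have hCn : NoRankOne C := hB.comp_det_ne_zero hW
  have hsum : ∑ l, d l • mixedCof (C l) (C l) = 0 := by
    rw [← h]
    simp only [hC, map_sum, LinearMap.sum_apply, map_smul, LinearMap.smul_apply, Finset.smul_sum]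
    rw [Finset.sum_comm]
    refine Finset.sum_congr rfl fun i _ => ?_
    rw [Finset.sum_comm]
    refine Finset.sum_congr rfl fun j _ => ?_
    rw [hd, mul_apply, Finset.sum_smul]
    refine Finset.sum_congr rfl fun l _ => ?_
    rw [mul_diagonal, transpose_apply, smul_smul, smul_smul]
    rw [mixedCof_comm]
    congr 1; ring
  -- In diagonal form the tensor is ∑ d_l C_l², and only the at most three terms with d_l ≠ 0 count.
  set s : Finset κ := Finset.univ.filter fun l => d l ≠ 0 with hs
  have hscard : s.card ≤ 3 := by
    rcases hrank with h3 | ⟨h4, hdet⟩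
    · exact (Finset.card_le_univ s).trans h3
    · rw [hd, det_mul, det_mul, det_transpose, det_diagonal] at hdet
      have : ∏ i, d i = 0 := by simpa [hW] using hdet
      obtain ⟨l, -, hl⟩ := Finset.prod_eq_zero_iff.1 this
      have hlt : s.card < (Finset.univ : Finset κ).card :=
        Finset.card_lt_card ⟨Finset.subset_univ _, fun hcon => by
          have := hcon (Finset.mem_univ l)
          simp [hs, hl] at this⟩
      rw [Finset.card_univ] at hlt
      omega
  have hsum' : ∑ l ∈ s, d l • mixedCof (C l) (C l) = 0 := by
    rw [← hsum, hs, Finset.sum_filter]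
    refine Finset.sum_congr rfl fun l _ => ?_
    split_ifs with h0
    · rfl
    · simp only [ne_eq, not_not] at h0; rw [h0, zero_smul]
  have hmem : ∀ l ∈ s, d l ≠ 0 := fun l hl => by simpa [hs] using hl
  have hcases : s.card = 0 ∨ s.card = 1 ∨ s.card = 2 ∨ s.card = 3 := by omega
  rcases hcases with h0 | h1 | h2 | h3
  · have hd0 : d = 0 := by
      ext l
      by_contra hl
      have : l ∈ s := by simpa [hs] using hl
      rw [Finset.card_eq_zero.1 h0] at this
      simp at this
    rw [hd, hd0]
    simp
  · exfalso
    obtain ⟨a, ha⟩ := Finset.card_eq_one.1 h1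
    rw [ha, Finset.sum_singleton] at hsum'
    have hda := hmem a (by simp [ha])
    have := (smul_eq_zero.1 hsum').resolve_left hda
    rw [mixedCof_self_eq_zero_iff] at this
    have h5 := congrFun (hCn (Pi.single a 1) (by simpa [Pi.single_apply, ite_smul] using this)) a
    simp at h5
  · exfalso
    obtain ⟨a, b, hab, ha⟩ := Finset.card_eq_two.1 h2
    rw [ha, Finset.sum_pair hab] at hsum'
    have hda := hmem a (by simp [ha])
    have hdb := hmem b (by simp [ha])
    obtain ⟨α, hα⟩ := IsAlgClosed.exists_pow_nat_eq (d a) (n := 2) (by norm_num)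
    obtain ⟨β, hβ⟩ := IsAlgClosed.exists_pow_nat_eq (-d b) (n := 2) (by norm_num)
    have hα0 : α ≠ 0 := by rintro rfl; exact hda (by simpa using hα.symm)
    have hβ0 : β ≠ 0 := by rintro rfl; exact hdb (by simpa using hβ.symm)
    -- With α² = d_a and β² = -d_b the tensor is the product of αC_a + βC_b and αC_a - βC_b.
    refine mixedCof_ne_zero_of_pencil (X := α • C a + β • C b) (Y := α • C a - β • C b) ?_ ?_
    · intro x y hxy
      have := hCn.pair hab (α * (x + y)) (β * (x - y)) (by rw [← hxy]; congr 1; module)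
      simp only [mul_eq_zero, hα0, hβ0, false_or] at this
      constructor
      · linear_combination (this.1 + this.2) / 2
      · linear_combination (this.1 - this.2) / 2
    · rw [← hsum', ← hα, ← neg_eq_iff_eq_neg.2 hβ]
      simp only [map_add, map_sub, map_smul, LinearMap.add_apply, LinearMap.smul_apply,
        mixedCof_comm (C b) (C a)]
      module
  · exfalso
    obtain ⟨a, b, c, hab, hac, hbc, ha⟩ := Finset.card_eq_three.1 h3
    rw [ha, Finset.sum_insert (by simp [hab, hac]), Finset.sum_pair hbc] at hsum'
    have hda := hmem a (by simp [ha])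
    have hdb := hmem b (by simp [ha])
    have hdc := hmem c (by simp [ha])
    obtain ⟨α, hα⟩ := IsAlgClosed.exists_pow_nat_eq (d a) (n := 2) (by norm_num)
    obtain ⟨β, hβ⟩ := IsAlgClosed.exists_pow_nat_eq (-d b) (n := 2) (by norm_num)
    obtain ⟨γ, hγ⟩ := IsAlgClosed.exists_pow_nat_eq (-d c) (n := 2) (by norm_num)
    have hα0 : α ≠ 0 := by rintro rfl; exact hda (by simpa using hα.symm)
    have hβ0 : β ≠ 0 := by rintro rfl; exact hdb (by simpa using hβ.symm)
    have hγ0 : γ ≠ 0 := by rintro rfl; exact hdc (by simpa using hγ.symm)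
    -- With α² = d_a, β² = -d_b and γ² = -d_c the tensor is PQ - R².
    refine mixedCof_ne_of_net (P := α • C a + β • C b) (Q := α • C a - β • C b) (R := γ • C c) ?_ ?_
    · intro x y z hxy
      have := hCn.triple hab hac hbc (α * (x + y)) (β * (x - y)) (γ * z)
        (by rw [← hxy]; congr 1; module)
      simp only [mul_eq_zero, hα0, hβ0, hγ0, false_or] at this
      refine ⟨?_, ?_, this.2.2⟩
      · linear_combination (this.1 + this.2.1) / 2
      · linear_combination (this.1 - this.2.1) / 2
    · rw [← sub_eq_zero, ← hsum', ← hα, ← neg_eq_iff_eq_neg.2 hβ, ← neg_eq_iff_eq_neg.2 hγ]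
      simp only [map_add, map_sub, map_smul, LinearMap.add_apply, LinearMap.smul_apply,
        mixedCof_comm (C b) (C a)]
      module

/-- The index set of the entries on and above the diagonal of a square matrix. -/
abbrev Upper (κ : Type*) [LinearOrder κ] : Type _ := {p : κ × κ // p.1 ≤ p.2}

/-- The symmetric matrix whose diagonal entries are twice, and whose entries above the diagonal are
once, the given ones. -/
def symmOfUpper {κ : Type*} [LinearOrder κ] : (Upper κ → ℂ) →ₗ[ℂ] Matrix κ κ ℂ where
  toFun c := Matrix.of fun i j =>
    (if h : i ≤ j then c ⟨(i, j), h⟩ else 0) + (if h : j ≤ i then c ⟨(j, i), h⟩ else 0)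
  map_add' c c' := by ext i j; simp only [of_apply, Matrix.add_apply, Pi.add_apply]; split_ifs <;> ring
  map_smul' a c := by
    ext i j
    simp only [of_apply, Matrix.smul_apply, Pi.smul_apply, smul_eq_mul, RingHom.id_apply]
    split_ifs <;> ring

theorem symmOfUpper_isSymm {κ : Type*} [LinearOrder κ] (c : Upper κ → ℂ) :
    (symmOfUpper c).IsSymm := by
  ext i j
  simp only [symmOfUpper, LinearMap.coe_mk, AddHom.coe_mk, transpose_apply, of_apply]
  ring

theorem symmOfUpper_injective {κ : Type*} [LinearOrder κ] :
    Function.Injective (symmOfUpper (κ := κ)) := by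
  rw [injective_iff_map_eq_zero]
  intro c hc
  ext ⟨⟨i, j⟩, hij⟩
  have := congrFun (congrFun hc i) j
  simp only [symmOfUpper, LinearMap.coe_mk, AddHom.coe_mk, of_apply, Matrix.zero_apply] at this
  rw [dif_pos hij] at this
  by_cases h : j ≤ i
  · obtain rfl : i = j := le_antisymm hij h
    rw [dif_pos hij] at this
    simpa using this
  · rw [dif_neg h, add_zero] at this
    exact this

/-- The diagonal of `symmOfUpper` is doubled precisely so that one factor 2 serves both diagonal and
off-diagonal terms. -/
theorem sum_symmOfUpper_smul {κ : Type*} [Fintype κ] [LinearOrder κ] (c : Upper κ → ℂ)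
    (B : κ → Mat3) : ∑ i, ∑ j, symmOfUpper c i j • mixedCof (B i) (B j) =
      (2 : ℂ) • ∑ p : Upper κ, c p • mixedCof (B p.1.1) (B p.1.2) := by
  have h1 : ∑ i, ∑ j, (if h : i ≤ j then c ⟨(i, j), h⟩ else 0) • mixedCof (B i) (B j)
      = ∑ p : Upper κ, c p • mixedCof (B p.1.1) (B p.1.2) := by
    rw [← Finset.sum_product', Finset.univ_product_univ]
    symm
    refine Finset.sum_of_injOn (fun p : Upper κ => p.1) (Subtype.val_injective.injOn)
      (fun _ _ => Finset.mem_coe.2 (Finset.mem_univ _)) ?_ ?_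
    · intro p _ hp
      have : ¬ p.1 ≤ p.2 := fun h => hp ⟨⟨p, h⟩, by simp⟩
      rw [dif_neg this, zero_smul]
    · rintro ⟨p, h⟩ -
      rw [dif_pos h]
  have h2 : ∑ i, ∑ j, (if h : j ≤ i then c ⟨(j, i), h⟩ else 0) • mixedCof (B i) (B j)
      = ∑ p : Upper κ, c p • mixedCof (B p.1.1) (B p.1.2) := by
    rw [Finset.sum_comm, ← h1]
    simp only [mixedCof_comm]
  simp only [symmOfUpper, LinearMap.coe_mk, AddHom.coe_mk, of_apply, add_smul,
    Finset.sum_add_distrib, h1, h2]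
  module

theorem NoRankOne.linearIndependent_mixedCof {κ : Type*} [Fintype κ] [LinearOrder κ]
    {B : κ → Mat3} (hB : NoRankOne B) (hκ : Fintype.card κ ≤ 3) :
    LinearIndependent ℂ fun p : Upper κ => mixedCof (B p.1.1) (B p.1.2) := by
  rw [Fintype.linearIndependent_iff]
  intro c hc
  have := hB.eq_zero_of_sum_mixedCof (symmOfUpper_isSymm c) (Or.inl hκ)
    (by rw [sum_symmOfUpper_smul, hc, smul_zero])
  rw [← map_zero symmOfUpper] at this
  exact congrFun (symmOfUpper_injective this)

/-- There are 10 products and the target has dimension 9, so it suffices to bound the space of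
relations by 1. Two independent relations would span a pencil of symmetric 4 × 4 matrices with a
nonzero singular member, that is, a relation of rank at most 3. -/
theorem NoRankOne.span_mixedCof {B : Fin 4 → Mat3} (hB : NoRankOne B) :
    Submodule.span ℂ (Set.range fun p : Upper (Fin 4) => mixedCof (B p.1.1) (B p.1.2)) = ⊤ := by
  set Φ := Fintype.linearCombination ℂ fun p : Upper (Fin 4) => mixedCof (B p.1.1) (B p.1.2) with hΦ
  rw [← Fintype.range_linearCombination, ← hΦ]
  have hker : Module.finrank ℂ (LinearMap.ker Φ) ≤ 1 := by
    by_contra! hlt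
    haveI : Nontrivial (LinearMap.ker Φ) := Module.nontrivial_of_finrank_pos (R := ℂ) (by omega)
    obtain ⟨x, hx⟩ := exists_ne (0 : LinearMap.ker Φ)
    obtain ⟨y, hxy⟩ := exists_linearIndependent_pair_of_one_lt_finrank hlt hx
    obtain ⟨s, t, hst, hdet⟩ := exists_det_pencil_eq_zero (symmOfUpper x.1) (symmOfUpper y.1)
    rw [← map_smul, ← map_smul, ← map_add] at hdet
    have h0 := hB.eq_zero_of_sum_mixedCof (symmOfUpper_isSymm _) (Or.inr ⟨by simp, hdet⟩) (by
      rw [sum_symmOfUpper_smul]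
      have : Φ (s • x.1 + t • y.1) = 0 := LinearMap.mem_ker.1 (s • x + t • y).2
      exact (congrArg ((2 : ℂ) • ·) this).trans (smul_zero _))
    rw [← map_zero symmOfUpper] at h0
    have h1 := symmOfUpper_injective h0
    have h2 : s • x + t • y = 0 := Subtype.ext h1
    have := LinearIndependent.pair_iff.1 hxy s t h2
    tauto
  have hdim := LinearMap.finrank_range_add_finrank_ker Φ
  have hcard : Fintype.card (Upper (Fin 4)) = 10 := by decide
  rw [Module.finrank_fintype_fun_eq_card, hcard] at hdim
  apply Submodule.eq_top_of_finrank_eq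
  have h9 : Module.finrank ℂ Mat3 = 9 := by simp [Module.finrank_matrix]
  have := Submodule.finrank_le (LinearMap.range Φ)
  omega
end EPW
end

/-! ### The Segre cone and the bound on the dimension -/

open scoped TensorProduct
noncomputable section
namespace EPW
open Matrix

section Segre

open MvPolynomial

/-- The homomorphism that sets the variables in `s` to zero. -/
def killVars {σ : Type*} (s : Set σ) [DecidablePred (· ∈ s)] :
    MvPolynomial σ ℂ →ₐ[ℂ] MvPolynomial σ ℂ :=
  aeval fun i => if i ∈ s then 0 else X i

/-- The parametrisation of the cone of matrices of rank at most one. -/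
def segreHom : MvPolynomial (Fin 3 × Fin 3) ℂ →ₐ[ℂ] MvPolynomial (Fin 3 ⊕ Fin 3) ℂ :=
  aeval fun p => X (Sum.inl p.1) * X (Sum.inr p.2)

/-- The coordinate ring of the cone of matrices of rank at most one. -/
abbrev SegreRing : Type := MvPolynomial (Fin 3 × Fin 3) ℂ ⧸ RingHom.ker segreHom.toRingHom

/-- The ideal of the matrices `v wᵀ` for which the variables in `s` vanish. -/
def segreIdeal (s : Set (Fin 3 ⊕ Fin 3)) [DecidablePred (· ∈ s)] : Ideal SegreRing :=
  RingHom.ker ((killVars s).toRingHom.comp (RingHom.kerLift segreHom.toRingHom))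

instance (s : Set (Fin 3 ⊕ Fin 3)) [DecidablePred (· ∈ s)] : (segreIdeal s).IsPrime :=
  RingHom.ker_isPrime _

theorem mk_mem_segreIdeal (s : Set (Fin 3 ⊕ Fin 3)) [DecidablePred (· ∈ s)]
    (f : MvPolynomial (Fin 3 × Fin 3) ℂ) :
    Ideal.Quotient.mk _ f ∈ segreIdeal s ↔ killVars s (segreHom f) = 0 := by
  rw [segreIdeal, RingHom.mem_ker]
  rfl

theorem mk_X_mem_segreIdeal (s : Set (Fin 3 ⊕ Fin 3)) [DecidablePred (· ∈ s)] (i j : Fin 3) :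
    Ideal.Quotient.mk _ (X (i, j)) ∈ segreIdeal s ↔ Sum.inl i ∈ s ∨ Sum.inr j ∈ s := by
  rw [mk_mem_segreIdeal]
  simp only [segreHom, killVars, aeval_X, map_mul, mul_eq_zero]
  split_ifs <;> simp [*]

theorem height_segreIdeal_add_one_le {s t : Set (Fin 3 ⊕ Fin 3)} [DecidablePred (· ∈ s)]
    [DecidablePred (· ∈ t)] (hst : s ⊆ t) (i j : Fin 3) (h1 : Sum.inl i ∈ t ∨ Sum.inr j ∈ t)
    (h2 : ¬ (Sum.inl i ∈ s ∨ Sum.inr j ∈ s)) :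
    (segreIdeal s).height + 1 ≤ (segreIdeal t).height := by
  refine Ideal.height_add_one_le_of_lt_of_isPrime (lt_of_le_of_ne ?_ ?_)
  · intro f hf
    obtain ⟨f, rfl⟩ := Ideal.Quotient.mk_surjective f
    rw [mk_mem_segreIdeal] at hf ⊢
    have : (killVars t).comp (killVars s) = killVars t := by
      ext1 a
      by_cases hs : a ∈ s
      · simp [killVars, hs, hst hs]
      · simp [killVars, hs]
    rw [← this, AlgHom.comp_apply, hf, map_zero]
  · intro h
    rw [← mk_X_mem_segreIdeal, ← h, mk_X_mem_segreIdeal] at h1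
    exact h2 h1

/-- Killing the variables y₀, y₁, z₀, z₁, y₂ in this order gives a chain of six primes. At each
stage some x_{ij} ↦ y_i z_j vanishes for the first time. With all y_i gone, the last prime is the
ideal of the vertex of the cone. -/
theorem five_le_height_segreIdeal :
    5 ≤ (segreIdeal {Sum.inl 0, Sum.inl 1, Sum.inr 0, Sum.inr 1, Sum.inl 2}).height := by
  have h1 := height_segreIdeal_add_one_le (s := ∅) (t := {Sum.inl 0}) (by simp) 0 2
    (by simp) (by simp)
  have h2 := height_segreIdeal_add_one_le (s := {Sum.inl 0}) (t := {Sum.inl 0, Sum.inl 1})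
    (by intro x; simp; tauto) 1 2 (by simp) (by simp)
  have h3 := height_segreIdeal_add_one_le (s := {Sum.inl 0, Sum.inl 1})
    (t := {Sum.inl 0, Sum.inl 1, Sum.inr 0}) (by intro x; simp; tauto) 2 0 (by simp) (by simp)
  have h4 := height_segreIdeal_add_one_le (s := {Sum.inl 0, Sum.inl 1, Sum.inr 0})
    (t := {Sum.inl 0, Sum.inl 1, Sum.inr 0, Sum.inr 1}) (by intro x; simp; tauto) 2 1
    (by simp) (by simp)
  have h5 := height_segreIdeal_add_one_le (s := {Sum.inl 0, Sum.inl 1, Sum.inr 0, Sum.inr 1})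
    (t := {Sum.inl 0, Sum.inl 1, Sum.inr 0, Sum.inr 1, Sum.inl 2})
    (by intro x; simp; tauto) 2 2 (by simp) (by simp)
  calc (5 : ℕ∞) = 0 + 1 + 1 + 1 + 1 + 1 := by norm_num
    _ ≤ (segreIdeal ∅).height + 1 + 1 + 1 + 1 + 1 := by gcongr; exact zero_le
    _ ≤ _ := by
      refine le_trans ?_ h5
      gcongr
      refine le_trans ?_ h4
      gcongr
      refine le_trans ?_ h3
      gcongr
      refine le_trans ?_ h2
      gcongr

/-- A linear form on `3 × 3` matrices as a linear polynomial. -/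
def linearPoly (l : Mat3 →ₗ[ℂ] ℂ) : MvPolynomial (Fin 3 × Fin 3) ℂ :=
  ∑ p : Fin 3 × Fin 3, C (l (Matrix.single p.1 p.2 1)) * X p

theorem aeval_linearPoly (l : Mat3 →ₗ[ℂ] ℂ) (x : Fin 3 × Fin 3 → ℂ) :
    aeval x (linearPoly l) = l (Matrix.of fun i j => x (i, j)) := by
  rw [matrix_eq_sum_single (Matrix.of fun i j => x (i, j)), map_sum, linearPoly, map_sum,
    Fintype.sum_prod_type]
  refine Finset.sum_congr rfl fun i _ => ?_
  rw [map_sum]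
  refine Finset.sum_congr rfl fun j _ => ?_
  have : Matrix.single i j (x (i, j)) = x (i, j) • (Matrix.single i j 1 : Mat3) := by
    rw [smul_single, smul_eq_mul, mul_one]
  simp only [of_apply, map_mul, aeval_X]
  rw [this, map_smul, smul_eq_mul, mul_comm]
  simp

/-- A space of `3 × 3` matrices without elements of rank one has dimension at most four. -/
theorem NoRankOne.card_le {κ : Type*} [Fintype κ] {B : κ → Mat3} (hB : NoRankOne B) :
    Fintype.card κ ≤ 4 := by
  by_contra! hcard
  have hli : LinearIndependent ℂ B := by
    rw [Fintype.linearIndependent_iff]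
    intro c hc
    exact congrFun (hB c (by rw [hc]; exact adjugate_zero))
  set K := Submodule.span ℂ (Set.range B) with hK
  have hKdim : Module.finrank ℂ K = Fintype.card κ := finrank_span_eq_card hli
  have h9 : Module.finrank ℂ Mat3 = 9 := by simp [Module.finrank_matrix]
  have hq := Submodule.finrank_quotient_add_finrank K
  set b := Module.finBasis ℂ (Mat3 ⧸ K)
  set l : Fin (Module.finrank ℂ (Mat3 ⧸ K)) → Mat3 →ₗ[ℂ] ℂ := fun i => b.coord i ∘ₗ K.mkQ with hl
  have hlK : ∀ M : Mat3, (∀ i, l i M = 0) → M ∈ K := by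
    intro M hM
    rw [← Submodule.Quotient.mk_eq_zero]
    refine b.ext_elem fun i => ?_
    have := hM i
    simpa [hl] using this
  have hzero : ∀ M ∈ K, M.adjugate = 0 → M = 0 := by
    intro M hM hadj
    rw [hK, Submodule.mem_span_range_iff_exists_fun] at hM
    obtain ⟨c, rfl⟩ := hM
    rw [hB c hadj]; simp
  -- If K had dimension at least 5, it would be cut out by at most 4 linear forms. The cone meets K
  -- only in its vertex, so the ideal m of the vertex would be minimal over these forms, and Krull's
  -- theorem would bound its height by 4.
  set m := segreIdeal {Sum.inl 0, Sum.inl 1, Sum.inr 0, Sum.inr 1, Sum.inl 2} with hm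
  set I : Ideal SegreRing :=
    Ideal.span (Set.range fun i => Ideal.Quotient.mk _ (linearPoly (l i))) with hI
  have hall : ∀ i : Fin 3, (Sum.inl i : Fin 3 ⊕ Fin 3) ∈
      ({Sum.inl 0, Sum.inl 1, Sum.inr 0, Sum.inr 1, Sum.inl 2} : Set (Fin 3 ⊕ Fin 3)) := by
    intro i; fin_cases i <;> simp
  have hkill : ∀ f, killVars {Sum.inl 0, Sum.inl 1, Sum.inr 0, Sum.inr 1, Sum.inl 2}
      (segreHom f) = C (constantCoeff f) := by
    intro f
    have : (killVars {Sum.inl 0, Sum.inl 1, Sum.inr 0, Sum.inr 1, Sum.inl 2}).comp segreHom =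
        (Algebra.ofId ℂ _).comp (aeval (fun _ => (0 : ℂ))) := by
      ext1 ⟨i, j⟩
      simp only [AlgHom.comp_apply, segreHom, killVars, aeval_X, map_mul, if_pos (hall i),
        zero_mul, map_zero]
    have h2 := AlgHom.congr_fun this f
    simp only [AlgHom.comp_apply] at h2
    rw [h2, Algebra.ofId_apply, algebraMap_eq]
    congr 1
    simp [constantCoeff_eq, aeval_zero']
  have hmin : m ∈ I.minimalPrimes := by
    refine ⟨⟨inferInstance, ?_⟩, ?_⟩
    · rw [hI, Ideal.span_le]
      rintro _ ⟨i, rfl⟩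
      rw [SetLike.mem_coe, mk_mem_segreIdeal, hkill]
      simp [linearPoly, constantCoeff_X]
    · rintro q ⟨hq1, hq2⟩ hqm f hf
      obtain ⟨f, rfl⟩ := Ideal.Quotient.mk_surjective f
      rw [mk_mem_segreIdeal, hkill] at hf
      have hf0 : constantCoeff f = 0 := by simpa using hf
      set q' := q.comap (Ideal.Quotient.mk (RingHom.ker segreHom.toRingHom))
      have hq' : q'.IsPrime := Ideal.comap_isPrime _ _
      change f ∈ q'
      -- By the Nullstellensatz it is enough to know that 0 is the only zero of q'. A zero is a
      -- matrix in K with vanishing 2 × 2 minors.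
      rw [← hq'.radical,
        ← vanishingIdeal_zeroLocus_eq_radical (K := ℂ), mem_vanishingIdeal_iff]
      intro x hx
      rw [mem_zeroLocus_iff] at hx
      have hx0 : x = 0 := by
        have h1 : (Matrix.of fun i j => x (i, j) : Mat3) = 0 := by
          refine hzero _ (hlK _ fun i => ?_) ?_
          · rw [← aeval_linearPoly]
            exact hx _ (hq2 (Ideal.subset_span ⟨i, rfl⟩))
          · have hmin : ∀ i j k l, x (i, j) * x (k, l) - x (i, l) * x (k, j) = 0 := by
              intro i j k l
              have := hx (X (i, j) * X (k, l) - X (i, l) * X (k, j)) (by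
                change Ideal.Quotient.mk _ _ ∈ q
                rw [Ideal.Quotient.eq_zero_iff_mem.2]
                · exact zero_mem _
                · rw [RingHom.mem_ker]
                  simp [segreHom]
                  ring)
              simpa using this
            rw [adjugate_fin_three]
            ext a b
            fin_cases a <;> fin_cases b <;> simp
            · exact hmin 1 1 2 2
            · linear_combination - hmin 0 1 2 2
            · exact hmin 0 1 1 2
            · linear_combination - hmin 1 0 2 2
            · exact hmin 0 0 2 2
            · linear_combination - hmin 0 0 1 2
            · exact hmin 1 0 2 1
            · linear_combination - hmin 0 0 2 1
            · exact hmin 0 0 1 1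
        ext ⟨i, j⟩
        exact congrFun (congrFun h1 i) j
      rw [hx0, aeval_zero]
      simp [hf0]
  have hle := Ideal.height_le_card_of_mem_minimalPrimes_span (Set.finite_range _) hmin
  have hcard2 : (Set.range fun i => Ideal.Quotient.mk (RingHom.ker segreHom.toRingHom)
      (linearPoly (l i))).ncard ≤ 4 := by
    rw [← Set.image_univ]
    refine (Set.ncard_image_le Set.finite_univ).trans ?_
    rw [Set.ncard_univ, Nat.card_eq_fintype_card, Fintype.card_fin]
    omega
  have h5 := five_le_height_segreIdeal.trans hle
  have : (5 : ℕ∞) ≤ ((4 : ℕ) : ℕ∞) := h5.trans (by exact_mod_cast hcard2)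
  norm_num at this

end Segre

end EPW
end

open scoped TensorProduct
noncomputable section
namespace EPW
open IsLocalRing

/-! ### Quotients of regular local rings -/

/-- Given a basis and a subspace, some of the basis vectors map to a basis of the quotient. -/
theorem exists_basis_subfamily_quotient {K V ι : Type*} [Field K] [AddCommGroup V] [Module K V]
    [Fintype ι] (b : Module.Basis ι K V) (W : Submodule K V) :
    ∃ s : Finset ι, W ⊔ Submodule.span K (b '' s) = ⊤ ∧ s.card + Module.finrank K W = Fintype.card ι := by
  classical
  haveI : Module.Finite K V := Module.Finite.of_basis b
  obtain ⟨κ, a, ha, hsp, hli⟩ := exists_linearIndependent' K (W.mkQ ∘ b)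
  have htop : Submodule.span K (Set.range (W.mkQ ∘ b)) = ⊤ := by
    rw [Set.range_comp, ← Submodule.map_span, b.span_eq, Submodule.map_top, Submodule.range_mkQ]
  rw [htop] at hsp
  haveI : Finite κ := Finite.of_injective a ha
  haveI := Fintype.ofFinite κ
  refine ⟨Finset.univ.image a, ?_, ?_⟩
  · rw [← Submodule.map_mkQ_eq_top, Submodule.map_span, ← hsp, Finset.coe_image, Finset.coe_univ,
      Set.image_univ, ← Set.range_comp, ← Set.range_comp]
    rfl
  · rw [Finset.card_image_of_injective _ ha, Finset.card_univ,
      ← Module.finrank_eq_card_basis (Module.Basis.mk hli hsp.ge),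
      Submodule.finrank_quotient_add_finrank, Module.finrank_eq_card_basis b]

/-- Nakayama's lemma for elements of the maximal ideal with given linear parts. -/
theorem maximalIdeal_le_span_of_linearPart {R σ τ : Type*} [CommRing R] [IsLocalRing R]
    [IsNoetherianRing R] [Algebra ℂ R] [Fintype σ] [Fintype τ] {x : σ → R}
    (hx : maximalIdeal R = Ideal.span (Set.range x)) {f : τ → R} {c : τ → σ → ℂ}
    (hc : Submodule.span ℂ (Set.range c) = ⊤)
    (hf : ∀ i, f i - ∑ p, c i p • x p ∈ maximalIdeal R ^ 2) :
    maximalIdeal R ≤ Ideal.span (Set.range f) := by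
  classical
  refine Submodule.le_of_le_smul_of_le_jacobson_bot (I := maximalIdeal R)
    (IsNoetherian.noetherian _) (maximalIdeal_le_jacobson _) ?_
  rw [smul_eq_mul, ← sq]
  conv_lhs => rw [hx]
  rw [Ideal.span_le]
  rintro _ ⟨p, rfl⟩
  have hp : (Pi.single p 1 : σ → ℂ) ∈ Submodule.span ℂ (Set.range c) := by rw [hc]; trivial
  rw [Submodule.mem_span_range_iff_exists_fun] at hp
  obtain ⟨a, ha⟩ := hp
  have h1 : x p = ∑ i, a i • f i - ∑ i, a i • (f i - ∑ q, c i q • x q) := by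
    rw [← Finset.sum_sub_distrib]
    simp only [← smul_sub, sub_sub_cancel]
    simp only [Finset.smul_sum, smul_smul]
    rw [Finset.sum_comm]
    have : ∀ q, ∑ i, (a i * c i q) • x q = (Pi.single p 1 : σ → ℂ) q • x q := by
      intro q
      rw [← ha, ← Finset.sum_smul]
      congr 1
      simp [Finset.sum_apply]
    simp only [this, Pi.single_apply, ite_smul, one_smul, zero_smul]
    simp
  rw [h1]
  refine Submodule.sub_mem _ ?_ ?_
  · refine Submodule.mem_sup_left (Submodule.sum_mem _ fun i _ => ?_)
    rw [Algebra.smul_def]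
    exact Ideal.mul_mem_left _ _ (Ideal.subset_span ⟨i, rfl⟩)
  · refine Submodule.mem_sup_right (Submodule.sum_mem _ fun i _ => ?_)
    rw [Algebra.smul_def]
    exact Ideal.mul_mem_left _ _ (hf i)

theorem maximalIdeal_quotient_eq_map {R : Type*} [CommRing R] [IsLocalRing R] (I : Ideal R)
    [IsLocalRing (R ⧸ I)] :
    maximalIdeal (R ⧸ I) = (maximalIdeal R).map (Ideal.Quotient.mk I) := by
  have := IsLocalHom.of_surjective (Ideal.Quotient.mk I) Ideal.Quotient.mk_surjective
  have h : (maximalIdeal (R ⧸ I)).comap (Ideal.Quotient.mk I) = maximalIdeal R :=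
    ((local_hom_TFAE (Ideal.Quotient.mk I)).out 0 4).1 this
  rw [← h, Ideal.map_comap_of_surjective _ Ideal.Quotient.mk_surjective]

/-- The quotient of a regular local ring by elements with linearly independent linear parts. -/
theorem isRegularLocalRing_quotient_span {R σ τ : Type*} [CommRing R] [IsLocalRing R]
    [IsNoetherianRing R] [Algebra ℂ R] [Fintype σ] [Fintype τ] {x : σ → R}
    (hx : maximalIdeal R = Ideal.span (Set.range x)) (hdim : ringKrullDim R = Fintype.card σ)
    {f : τ → R} {c : τ → σ → ℂ} (hc : LinearIndependent ℂ c)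
    (hf : ∀ i, f i - ∑ p, c i p • x p ∈ maximalIdeal R ^ 2) :
    IsRegularLocalRing (R ⧸ Ideal.span (Set.range f)) ∧
      ringKrullDim (R ⧸ Ideal.span (Set.range f)) = (Fintype.card σ - Fintype.card τ : ℕ) := by
  classical
  set I := Ideal.span (Set.range f) with hI
  have hxm : ∀ p, x p ∈ maximalIdeal R := fun p => hx ▸ Ideal.subset_span ⟨p, rfl⟩
  have hfm : ∀ i, f i ∈ maximalIdeal R := by
    intro i
    have h1 := Ideal.pow_le_self two_ne_zero (hf i)
    rw [← sub_add_cancel (f i) (∑ p, c i p • x p)]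
    refine add_mem h1 (sum_mem fun p _ => ?_)
    rw [Algebra.smul_def]
    exact Ideal.mul_mem_left _ _ (hxm p)
  have hIm : I ≤ maximalIdeal R := by
    rw [hI, Ideal.span_le]; rintro _ ⟨i, rfl⟩; exact hfm i
  have hItop : I ≠ ⊤ := fun h => (maximalIdeal.isMaximal R).ne_top (top_le_iff.1 (h ▸ hIm))
  haveI : Nontrivial (R ⧸ I) := Ideal.Quotient.nontrivial_iff.2 hItop
  haveI : IsLocalRing (R ⧸ I) := IsLocalRing.of_surjective' (Ideal.Quotient.mk I)
    Ideal.Quotient.mk_surjective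
  -- The coordinates x_p with p in s complete the f_i to generators of the maximal ideal. Hence s
  -- bounds the embedding dimension of the quotient from above, while Krull's theorem bounds the
  -- dimension of the quotient below by the same number.
  obtain ⟨s, hs, hcard⟩ := exists_basis_subfamily_quotient (Pi.basisFun ℂ σ)
    (Submodule.span ℂ (Set.range c))
  rw [finrank_span_eq_card hc] at hcard
  have hm := maximalIdeal_le_span_of_linearPart (τ := τ ⊕ s) hx (f := Sum.elim f fun p => x p)
    (c := Sum.elim c fun p => Pi.single p.1 1) (by
      rw [← hs, Set.Sum.elim_range, Submodule.span_union]
      congr 2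
      ext v; simp) (by
      rintro (i | p)
      · exact hf i
      · simp [Pi.single_apply, ite_smul])
  have hmax : maximalIdeal (R ⧸ I) = Ideal.span ((Ideal.Quotient.mk I ∘ x) '' s) := by
    rw [maximalIdeal_quotient_eq_map]
    apply le_antisymm
    · refine (Ideal.map_mono hm).trans ?_
      rw [Ideal.map_span, Ideal.span_le]
      rintro _ ⟨_, ⟨i | p, rfl⟩, rfl⟩
      · have : Ideal.Quotient.mk I (f i) = 0 :=
          Ideal.Quotient.eq_zero_iff_mem.2 (Ideal.subset_span ⟨i, rfl⟩)
        simp [this]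
      · exact Ideal.subset_span ⟨p, p.2, rfl⟩
    · rw [Ideal.span_le]
      rintro _ ⟨p, -, rfl⟩
      exact Ideal.mem_map_of_mem _ (hxm p)
  have hspan : (maximalIdeal (R ⧸ I)).spanFinrank ≤ s.card := by
    rw [hmax]
    refine (Submodule.spanFinrank_span_le_ncard_of_finite (s.finite_toSet.image _)).trans ?_
    refine (Set.ncard_image_le s.finite_toSet).trans ?_
    rw [Set.ncard_coe_finset]
  have hkrull : ringKrullDim R ≤ ringKrullDim (R ⧸ I) + Fintype.card τ := by
    have h1 := ringKrullDim_le_ringKrullDim_quotient_add_card (Finset.univ.image f) (by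
      intro y hy
      rw [ringJacobson_eq_maximalIdeal]
      simp only [Finset.coe_image, Finset.coe_univ, Set.image_univ] at hy
      obtain ⟨i, rfl⟩ := hy
      exact hfm i)
    have h2 : Ideal.span ((Finset.univ.image f : Finset R) : Set R) = I := by simp [hI]
    rw [h2] at h1
    refine h1.trans ?_
    gcongr
    exact_mod_cast Finset.card_image_le
  have hle : ringKrullDim (R ⧸ I) ≤ s.card :=
    (ringKrullDim_le_spanFinrank_maximalIdeal _).trans (by exact_mod_cast hspan)
  have hge : (s.card : WithBot ℕ∞) ≤ ringKrullDim (R ⧸ I) := by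
    rw [hdim, ← hcard] at hkrull
    generalize ringKrullDim (R ⧸ I) = d at hkrull hle
    induction d using WithBot.recBotCoe with
    | bot => simp at hkrull
    | coe d =>
      induction d using ENat.recTopCoe with
      | top => exact le_top
      | coe d =>
        have h1 : s.card + Fintype.card τ ≤ d + Fintype.card τ := by exact_mod_cast hkrull
        have h2 : s.card ≤ d := by omega
        exact_mod_cast h2
  have hs' : s.card = Fintype.card σ - Fintype.card τ := by omega
  refine ⟨IsRegularLocalRing.of_spanFinrank_maximalIdeal_le _ (le_trans ?_ hge), ?_⟩
  · exact_mod_cast hspan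
  · rw [← hs']; exact le_antisymm hle hge

/-- The quotient of a regular local domain by a nonzero ideal that is contained in the square of
the maximal ideal is not regular. -/
theorem not_isRegularLocalRing_quotient {R : Type*} [CommRing R] [IsDomain R]
    [IsRegularLocalRing R] {I : Ideal R} (hI : I ≤ maximalIdeal R ^ 2) (hI0 : I ≠ ⊥) :
    ¬ IsRegularLocalRing (R ⧸ I) := by
  classical
  intro hreg
  obtain ⟨r, hr, hr0⟩ := Submodule.exists_mem_ne_zero_of_ne_bot hI0
  obtain ⟨s, hscard, hs⟩ := Submodule.FG.exists_span_finset_card_eq_spanFinrank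
    (IsNoetherian.noetherian (maximalIdeal (R ⧸ I)))
  set g : R ⧸ I → R := Function.surjInv Ideal.Quotient.mk_surjective
  have hg : ∀ y, Ideal.Quotient.mk I (g y) = y := Function.surjInv_eq _
  -- As I lies in the square of the maximal ideal, lifts of generators of the maximal ideal of R/I
  -- generate that of R by Nakayama. So the embedding dimension does not drop, whereas the dimension
  -- does, since R is a domain and I ≠ 0.
  have hm : maximalIdeal R ≤ Ideal.span (g '' s) := by
    refine Submodule.le_of_le_smul_of_le_jacobson_bot (I := maximalIdeal R)
      (IsNoetherian.noetherian _) (maximalIdeal_le_jacobson _) ?_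
    rw [smul_eq_mul, ← sq]
    refine le_trans ?_ (sup_le_sup_left hI _)
    intro y hy
    have h1 : Ideal.Quotient.mk I y ∈ (Ideal.span (g '' s)).map (Ideal.Quotient.mk I) := by
      have h2 : Ideal.Quotient.mk I y ∈ maximalIdeal (R ⧸ I) := by
        rw [maximalIdeal_quotient_eq_map]; exact Ideal.mem_map_of_mem _ hy
      rw [← hs] at h2
      rw [Ideal.map_span, ← Set.image_comp]
      convert h2
      simp [hg]
    have h3 := Ideal.mem_comap.2 h1
    rwa [Ideal.comap_map_of_surjective _ Ideal.Quotient.mk_surjective, ← RingHom.ker_eq_comap_bot,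
      Ideal.mk_ker] at h3
  have hmeq : maximalIdeal R = Ideal.span (g '' s) := by
    refine le_antisymm hm (Ideal.span_le.2 ?_)
    rintro _ ⟨y, hy, rfl⟩
    have h2 : y ∈ maximalIdeal (R ⧸ I) := hs ▸ Submodule.subset_span hy
    rw [maximalIdeal_quotient_eq_map] at h2
    have h3 : g y ∈ ((maximalIdeal R).map (Ideal.Quotient.mk I)).comap (Ideal.Quotient.mk I) := by
      rw [Ideal.mem_comap, hg]; exact h2
    rw [Ideal.comap_map_of_surjective _ Ideal.Quotient.mk_surjective, ← RingHom.ker_eq_comap_bot,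
      Ideal.mk_ker] at h3
    exact (sup_le le_rfl (hI.trans (Ideal.pow_le_self two_ne_zero))) h3
  have h1 : (maximalIdeal R).spanFinrank ≤ (maximalIdeal (R ⧸ I)).spanFinrank := by
    rw [← hscard, hmeq]
    refine (Submodule.spanFinrank_span_le_ncard_of_finite (s.finite_toSet.image _)).trans ?_
    refine (Set.ncard_image_le s.finite_toSet).trans ?_
    rw [Set.ncard_coe_finset]
  have h2 : ringKrullDim (R ⧸ I) ≤ ringKrullDim (R ⧸ Ideal.span {r}) :=
    ringKrullDim_le_of_surjective (Ideal.Quotient.factor ((Ideal.span_singleton_le_iff_mem I).2 hr))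
      (Ideal.Quotient.factor_surjective _)
  have h3 := ringKrullDim_quotient_succ_le_of_nonZeroDivisor (mem_nonZeroDivisors_of_ne_zero hr0)
  have h4 := (isRegularLocalRing_iff R).1 inferInstance
  have h5 := (isRegularLocalRing_iff (R ⧸ I)).1 hreg
  have h6 : ringKrullDim (R ⧸ I) + 1 ≤ ringKrullDim R := le_trans (by gcongr) h3
  rw [← h4, ← h5] at h6
  have : (maximalIdeal (R ⧸ I)).spanFinrank + 1 ≤ (maximalIdeal R).spanFinrank := by
    exact_mod_cast h6
  omega

end EPW
end

open scoped TensorProduct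
noncomputable section
namespace EPW
open IsLocalRing Matrix

/-! ### The local ring of the chart at its centre -/

theorem mem_originIdeal_iff (f : ChartRing) :
    f ∈ originIdeal ↔ MvPolynomial.constantCoeff f = 0 := RingHom.mem_ker

theorem originIdeal_eq_span :
    originIdeal = Ideal.span (Set.range (MvPolynomial.X : Fin 3 × Fin 3 → ChartRing)) := by
  have h : MvPolynomial.idealOfVars (Fin 3 × Fin 3) ℂ = originIdeal := by
    ext f
    rw [← pow_one (MvPolynomial.idealOfVars _ _), MvPolynomial.mem_pow_idealOfVars_iff',
      mem_originIdeal_iff, MvPolynomial.constantCoeff_eq]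
    constructor
    · intro h
      exact h 0 (by simp)
    · intro h a ha
      have : a = 0 := by simpa [Finsupp.degree_eq_zero_iff] using ha
      rw [this]; exact h
  exact h.symm

theorem X_mem_originIdeal (p : Fin 3 × Fin 3) : (MvPolynomial.X p : ChartRing) ∈ originIdeal := by
  rw [mem_originIdeal_iff, MvPolynomial.constantCoeff_X]

/-- The local ring of the Grassmannian at the centre of the chart. -/
abbrev ChartLocalRing : Type := Localization.AtPrime originIdeal

theorem maximalIdeal_chartLocalRing :
    maximalIdeal ChartLocalRing = Ideal.span (Set.range fun p : Fin 3 × Fin 3 =>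
      algebraMap ChartRing ChartLocalRing (MvPolynomial.X p)) := by
  rw [← Localization.AtPrime.map_eq_maximalIdeal]
  have h := congrArg (Ideal.map (algebraMap ChartRing ChartLocalRing)) originIdeal_eq_span
  rw [Ideal.map_span, ← Set.range_comp] at h
  exact h

/-- Killing the variables one at a time gives a strictly increasing chain of primes. -/
theorem card_le_height_ker_killVars (s : Finset (Fin 3 × Fin 3)) :
    (s.card : ℕ∞) ≤ (RingHom.ker (killVars (s : Set (Fin 3 × Fin 3))).toRingHom).height := by
  classical
  induction s using Finset.induction_on with
  | empty => simp
  | insert a s ha ih =>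
    haveI := RingHom.ker_isPrime (killVars (s : Set (Fin 3 × Fin 3))).toRingHom
    haveI := RingHom.ker_isPrime (killVars ((insert a s : Finset _) : Set (Fin 3 × Fin 3))).toRingHom
    rw [Finset.card_insert_of_notMem ha, Nat.cast_add, Nat.cast_one]
    refine (by gcongr : (s.card : ℕ∞) + 1 ≤ _ + 1).trans
      (Ideal.height_add_one_le_of_lt_of_isPrime (lt_of_le_of_ne ?_ ?_))
    · intro f hf
      have : (killVars ((insert a s : Finset _) : Set (Fin 3 × Fin 3))).comp
          (killVars (s : Set (Fin 3 × Fin 3))) =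
          killVars ((insert a s : Finset _) : Set (Fin 3 × Fin 3)) := by
        ext1 b
        by_cases hs : b ∈ s
        · simp [killVars, hs]
        · simp [killVars, hs]
      have hf' : killVars (s : Set (Fin 3 × Fin 3)) f = 0 := hf
      change killVars _ f = 0
      rw [← this, AlgHom.comp_apply, hf', map_zero]
    · intro h
      have h1 : (MvPolynomial.X a : ChartRing) ∈
          RingHom.ker (killVars ((insert a s : Finset _) : Set (Fin 3 × Fin 3))).toRingHom := by
        change killVars _ _ = 0
        simp [killVars]
      rw [← h] at h1
      change killVars _ _ = 0 at h1
      simp [killVars, ha] at h1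

theorem ringKrullDim_chartLocalRing : ringKrullDim ChartLocalRing = 9 := by
  rw [IsLocalization.AtPrime.ringKrullDim_eq_height originIdeal ChartLocalRing]
  have h1 : (9 : ℕ∞) ≤ originIdeal.height := by
    have h2 := card_le_height_ker_killVars Finset.univ
    have h3 : RingHom.ker (killVars ((Finset.univ : Finset (Fin 3 × Fin 3)) :
        Set (Fin 3 × Fin 3))).toRingHom = originIdeal := by
      ext f
      rw [mem_originIdeal_iff]
      change killVars _ f = 0 ↔ _
      have : killVars ((Finset.univ : Finset (Fin 3 × Fin 3)) : Set (Fin 3 × Fin 3)) f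
          = MvPolynomial.C (MvPolynomial.constantCoeff f) := by
        simp only [killVars, Finset.coe_univ, Set.mem_univ, if_true]
        rw [← MvPolynomial.algebraMap_eq]
        exact MvPolynomial.aeval_zero' f
      rw [this]; simp
    rw [h3] at h2
    simpa using h2
  have h2 : originIdeal.height ≤ 9 := by
    refine (Ideal.height_le_spanFinrank _ Ideal.IsPrime.ne_top').trans ?_
    have : Submodule.spanFinrank originIdeal ≤ 9 := by
      rw [originIdeal_eq_span]
      refine (Submodule.spanFinrank_span_le_ncard_of_finite (Set.finite_range _)).trans ?_
      rw [← Set.image_univ]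
      refine (Set.ncard_image_le Set.finite_univ).trans ?_
      rw [Set.ncard_univ]; simp
    exact_mod_cast this
  rw [le_antisymm h2 h1]
  rfl

instance : IsRegularLocalRing ChartLocalRing := inferInstance

/-! ### Minors and Schur complements -/

theorem det_mul_eq_zero_of_card_lt {R n ρ : Type*} [CommRing R] [Fintype n] [DecidableEq n]
    [Fintype ρ] (h : Fintype.card ρ < Fintype.card n) (U : Matrix n ρ R) (W : Matrix ρ n R) :
    (U * W).det = 0 := by
  classical
  obtain ⟨d, hd⟩ := Nat.exists_eq_add_of_lt h
  have e : n ≃ ρ ⊕ Fin (d + 1) := Fintype.equivOfCardEq (by simp; omega)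
  have h1 : U * W = (fromCols U (0 : Matrix n (Fin (d + 1)) R)).submatrix id e *
      (fromRows W (0 : Matrix (Fin (d + 1)) n R)).submatrix e id := by
    rw [submatrix_mul_equiv, fromCols_mul_fromRows]
    simp
  rw [h1, det_mul, det_eq_zero_of_column_eq_zero (e.symm (Sum.inr 0)), zero_mul]
  intro i
  simp

/-- A minor that contains the whole invertible block D is, up to the factor det D, a minor of the
Schur complement. -/
theorem det_submatrix_schur {R n κ ρ : Type*} [CommRing R] [Fintype n] [DecidableEq n]
    [Fintype ρ] [DecidableEq ρ] (A : Matrix κ κ R) (B : Matrix κ ρ R)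
    (C : Matrix ρ κ R) (D : Matrix ρ ρ R) [Invertible D] (f g : n → κ) :
    ((fromBlocks A B C D).submatrix (Sum.map f id) (Sum.map g id)).det =
      D.det * ((A - B * ⅟D * C).submatrix f g).det := by
  have : (fromBlocks A B C D).submatrix (Sum.map f id) (Sum.map g id) =
      fromBlocks (A.submatrix f g) (B.submatrix f id) (C.submatrix id g) D := by
    ext (i | i) (j | j) <;> rfl
  rw [this, det_fromBlocks₂₂]
  congr 2

/-- Modulo the entries of the Schur complement, the block matrix factors through a free module of
rank |ρ|, so all larger minors vanish. -/
theorem det_mul_fromBlocks_mul_mem {R n κ ρ : Type*} [CommRing R] [Fintype n] [DecidableEq n]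
    [Fintype κ] [Fintype ρ] [DecidableEq ρ] (hn : Fintype.card ρ < Fintype.card n)
    (A : Matrix κ κ R) (B : Matrix κ ρ R) (C : Matrix ρ κ R) (D : Matrix ρ ρ R) [Invertible D]
    {I : Ideal R} (hI : ∀ i j, (A - B * ⅟D * C) i j ∈ I)
    (U : Matrix n (κ ⊕ ρ) R) (W : Matrix (κ ⊕ ρ) n R) :
    (U * fromBlocks A B C D * W).det ∈ I := by
  have h1 : fromBlocks A B C D = fromBlocks (A - B * ⅟D * C) 0 0 0 +
      fromRows B D * (⅟D * fromCols C D) := by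
    rw [mul_fromCols, fromRows_mul_fromCols, fromBlocks_add]
    simp [Matrix.mul_assoc]
  rw [← Ideal.Quotient.eq_zero_iff_mem, RingHom.map_det, h1]
  have h2 : (Ideal.Quotient.mk I).mapMatrix (U * (fromBlocks (A - B * ⅟D * C) 0 0 0 +
      fromRows B D * (⅟D * fromCols C D)) * W) =
      ((U * fromRows B D).map (Ideal.Quotient.mk I)) *
        ((⅟D * fromCols C D * W).map (Ideal.Quotient.mk I)) := by
    have h3 : (fromBlocks (A - B * ⅟D * C) 0 0 0 : Matrix (κ ⊕ ρ) (κ ⊕ ρ) R).map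
        (Ideal.Quotient.mk I) = 0 := by
      ext (i | i) (j | j)
      · exact Ideal.Quotient.eq_zero_iff_mem.2 (hI i j)
      all_goals simp
    rw [RingHom.mapMatrix_apply, Matrix.mul_add, Matrix.add_mul, Matrix.map_add _ (map_add _),
      Matrix.map_mul, Matrix.map_mul, h3, ← Matrix.map_mul]
    simp only [Matrix.mul_zero, Matrix.zero_mul, zero_add, Matrix.mul_assoc]
  rw [h2, det_mul_eq_zero_of_card_lt hn]

/-- The Schur complement is A + B P (1 - EP)⁻¹ Bᵀ, and P (1 - EP)⁻¹ = (1 - PE)⁻¹ P shows that its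
middle factor is symmetric. -/
theorem isSymm_schur {R κ ρ : Type*} [CommRing R] [Fintype ρ] [DecidableEq ρ]
    {A : Matrix κ κ R} {B : Matrix κ ρ R} {E : Matrix ρ ρ R} {P : Matrix ρ ρ R}
    (hA : A.IsSymm) (hE : E.IsSymm) (hP : P.IsSymm) [Invertible (1 - E * P)] :
    (A - -(B * P) * ⅟(1 - E * P) * Bᵀ).IsSymm := by
  have h1 : P * (1 - E * P) = (1 - E * P)ᵀ * P := by
    rw [transpose_sub, transpose_mul, hE.eq, hP.eq, transpose_one]
    noncomm_ring
  have h2 : P * ⅟(1 - E * P) = (⅟(1 - E * P))ᵀ * P := by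
    have h3 : (⅟(1 - E * P))ᵀ * (1 - E * P)ᵀ = 1 := by
      rw [← transpose_mul, mul_invOf_self, transpose_one]
    calc P * ⅟(1 - E * P) = ((⅟(1 - E * P))ᵀ * (1 - E * P)ᵀ) * P * ⅟(1 - E * P) := by
          rw [h3, Matrix.one_mul]
      _ = (⅟(1 - E * P))ᵀ * P * ((1 - E * P) * ⅟(1 - E * P)) := by
          simp only [Matrix.mul_assoc]
          rw [← Matrix.mul_assoc P, h1]
          simp only [Matrix.mul_assoc]
      _ = _ := by rw [mul_invOf_self, Matrix.mul_one]
  unfold Matrix.IsSymm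
  rw [transpose_sub, hA.eq]
  congr 1
  simp only [transpose_mul, transpose_neg, transpose_transpose, hP.eq, Matrix.neg_mul,
    Matrix.mul_assoc]
  rw [← Matrix.mul_assoc P, h2, Matrix.mul_assoc]

/-- Row and column operations over ℂ diagonalise the constant terms. Two rows then have all entries
in the maximal ideal, and every term of the determinant takes one factor from each. -/
theorem det_mem_sq_of_rank {n : Type*} [Fintype n] [DecidableEq n] (N : Matrix n n ChartRing)
    (h : (N.map MvPolynomial.constantCoeff).rank + 2 ≤ Fintype.card n) :
    N.det ∈ originIdeal ^ 2 := by
  obtain ⟨L, L', D, hD⟩ := Matrix.Pivot.exists_list_transvec_mul_mul_list_transvec_eq_diagonal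
    (N.map (MvPolynomial.constantCoeff (R := ℂ)))
  set G := (L.map TransvectionStruct.toMatrix).prod with hG
  set G' := (L'.map TransvectionStruct.toMatrix).prod with hG'
  have hGdet : G.det = 1 := TransvectionStruct.det_toMatrix_prod L
  have hGdet' : G'.det = 1 := TransvectionStruct.det_toMatrix_prod L'
  have hrank : (N.map (MvPolynomial.constantCoeff (R := ℂ))).rank = (diagonal D).rank := by
    rw [← hD, rank_mul_eq_left_of_isUnit_det _ _ (by rw [hGdet']; exact isUnit_one),
      rank_mul_eq_right_of_isUnit_det _ _ (by rw [hGdet]; exact isUnit_one)]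
  rw [hrank, rank_diagonal] at h
  have hz : 1 < (Finset.univ.filter fun i => D i = 0).card := by
    have h1 := Finset.card_filter_add_card_filter_not (s := (Finset.univ : Finset n)) (fun i => D i = 0)
    rw [Fintype.card_subtype] at h
    rw [Finset.card_univ] at h1
    simp only [ne_eq] at h
    omega
  obtain ⟨a, ha, b, hb, hab⟩ := Finset.one_lt_card.1 hz
  simp only [Finset.mem_filter, Finset.mem_univ, true_and] at ha hb
  set N' : Matrix n n ChartRing := G.map MvPolynomial.C * N * G'.map MvPolynomial.C with hN'
  have hdet : N'.det = N.det := by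
    have h1 : ∀ G : Matrix n n ℂ, G.det = 1 →
        (G.map (MvPolynomial.C : ℂ →+* ChartRing)).det = 1 := by
      intro G h
      have := RingHom.map_det (MvPolynomial.C : ℂ →+* ChartRing) G
      rw [h, map_one] at this
      exact this.symm
    rw [hN', det_mul, det_mul, h1 G hGdet, h1 G' hGdet', one_mul, mul_one]
  have hcc : ∀ G : Matrix n n ℂ,
      (G.map (MvPolynomial.C : ℂ →+* ChartRing)).map MvPolynomial.constantCoeff = G := by
    intro G; ext i j; simp
  have hN0 : N'.map MvPolynomial.constantCoeff = diagonal D := by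
    rw [← hD, hN', Matrix.map_mul, Matrix.map_mul, hcc, hcc]
  have hrow : ∀ i, D i = 0 → ∀ j, N' i j ∈ originIdeal := by
    intro i hi j
    rw [mem_originIdeal_iff]
    have := congrFun (congrFun hN0 i) j
    rw [Matrix.map_apply] at this
    rw [this, diagonal_apply]
    split_ifs <;> simp [hi]
  rw [← hdet, det_apply]
  refine sum_mem fun σ _ => ?_
  rw [Units.smul_def, zsmul_eq_mul]
  refine Ideal.mul_mem_left _ _ ?_
  have hσ : ∏ i, N' (σ i) i = ∏ i, N' i (σ.symm i) := by
    rw [← Equiv.prod_comp σ (fun i => N' i (σ.symm i))]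
    simp
  rw [hσ, ← Finset.mul_prod_erase _ _ (Finset.mem_univ a),
    ← Finset.mul_prod_erase _ _ (Finset.mem_erase.2 ⟨hab.symm, Finset.mem_univ b⟩), ← mul_assoc, sq]
  exact Ideal.mul_mem_right _ _ (Ideal.mul_mem_mul (hrow a ha _) (hrow b hb _))

end EPW
end

open scoped TensorProduct
noncomputable section
namespace EPW

/-! ### Computations with anticommuting elements -/

/-- Six anticommuting elements of square zero, in two groups of three. -/
structure IsGrassmann {Ξ : Type*} [Ring Ξ] (e f : Fin 3 → Ξ) : Prop where
  ee : ∀ i j, e i * e j = -(e j * e i)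
  ff : ∀ i j, f i * f j = -(f j * f i)
  fe : ∀ i j, f i * e j = -(e j * f i)
  e_sq : ∀ i, e i * e i = 0
  f_sq : ∀ i, f i * f i = 0

section Grassmann

variable {R Ξ : Type*} [CommRing R] [Ring Ξ] [Algebra R Ξ] {e f : Fin 3 → Ξ}

/-- The vectors `τ_i`. -/
def stdTau (e f : Fin 3 → Ξ) : Option (Fin 3 × Fin 3) → Ξ
  | none => e 0 * e 1 * e 2
  | some p => e (p.1 + 1) * e (p.1 + 2) * f p.2

/-- The vectors `λ_i`. -/
def stdLam (e f : Fin 3 → Ξ) : Option (Fin 3 × Fin 3) → Ξ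
  | none => f 0 * f 1 * f 2
  | some p => -(e p.1 * f (p.2 + 1) * f (p.2 + 2))

/-- The sign of the permutation `0 ↦ a, 1 ↦ b, 2 ↦ -a-b` of `ℤ/3`, or zero if `a = b`. -/
def leviCivita (a b : Fin 3) : ℤ := if b = a + 1 then 1 else if b = a + 2 then -1 else 0

/-- The cofactor of an entry of a `3 × 3` matrix. -/
def cofEntry (x : Fin 3 × Fin 3 → R) (p : Fin 3 × Fin 3) : R :=
  x (p.1 + 1, p.2 + 1) * x (p.1 + 2, p.2 + 2) - x (p.1 + 1, p.2 + 2) * x (p.1 + 2, p.2 + 1)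

/-- The symmetric matrix whose graph is the space `T_U`, where `U` is the point with
coordinates `x`. -/
def stdQ (x : Fin 3 × Fin 3 → R) : Matrix (Option (Fin 3 × Fin 3)) (Option (Fin 3 × Fin 3)) R
  -- The product u₀u₁u₂ contributes det x, and the correction in `IsGrassmann.graphVec_triple`
  -- subtracts ∑ x_p cof_p = 3 det x.
  | none, none => -2 * ∑ j, x (0, j) * cofEntry x (0, j)
  | none, some p => cofEntry x p
  | some p, none => cofEntry x p
  | some p, some q =>
    -((leviCivita p.1 q.1 * leviCivita p.2 q.2 : ℤ) : R) * x (-(p.1 + q.1), -(p.2 + q.2))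

theorem leviCivita_swap (a b : Fin 3) : leviCivita b a = - leviCivita a b := by
  revert a b; decide

theorem stdQ_isSymm (x : Fin 3 × Fin 3 → R) : (stdQ x).IsSymm := by
  ext i j
  rcases i with _ | p <;> rcases j with _ | q <;> simp only [Matrix.transpose_apply, stdQ]
  rw [leviCivita_swap q.1, leviCivita_swap q.2, add_comm q.1, add_comm q.2, neg_mul_neg]

/-- The vectors `u_i = e_i + ∑ x_{ij} f_j`. -/
def graphVec (e f : Fin 3 → Ξ) (x : Fin 3 × Fin 3 → R) (i : Fin 3) : Ξ :=
  e i + ∑ j, x (i, j) • f j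

theorem IsGrassmann.ff_assoc (h : IsGrassmann e f) (i j : Fin 3) (z : Ξ) :
    f i * (f j * z) = -(f j * (f i * z)) := by rw [← mul_assoc, h.ff, neg_mul, mul_assoc]

theorem IsGrassmann.fe_assoc (h : IsGrassmann e f) (i j : Fin 3) (z : Ξ) :
    f i * (e j * z) = -(e j * (f i * z)) := by rw [← mul_assoc, h.fe, neg_mul, mul_assoc]

theorem IsGrassmann.f_sq_assoc (h : IsGrassmann e f) (i : Fin 3) (z : Ξ) :
    f i * (f i * z) = 0 := by rw [← mul_assoc, h.f_sq, zero_mul]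

theorem fin_three_neg_one : (-1 : Fin 3) = 2 := rfl

theorem fin_three_neg_two : (-2 : Fin 3) = 1 := rfl

theorem IsGrassmann.graphVec_mul_mul (h : IsGrassmann e f) (x : Fin 3 × Fin 3 → R)
    (p : Fin 3 × Fin 3) :
    graphVec e f x (p.1 + 1) * graphVec e f x (p.1 + 2) * f p.2 =
      stdTau e f (some p) + ∑ j, stdQ x (some p) j • stdLam e f j := by
  obtain ⟨a, l⟩ := p
  simp only [Fintype.sum_option, Fintype.sum_prod_type, Fin.sum_univ_three, graphVec, stdTau,
    stdLam, stdQ, cofEntry]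
  fin_cases a <;> fin_cases l <;>
  · simp [leviCivita, mul_add, add_mul, mul_assoc, h.ee 2 0, h.ff 1 0, h.ff 2 0,
      h.ff 2 1, h.ff_assoc 1 0,
      h.fe, h.f_sq, h.f_sq_assoc, smul_smul,
      fin_three_neg_one, fin_three_neg_two]
    module

/-- The subtracted sum removes the terms of u₀u₁u₂ with exactly one factor f, which are the
components along the other vectors τ. What remains is a normalised graph vector over e₀e₁e₂. -/
theorem IsGrassmann.graphVec_triple (h : IsGrassmann e f) (x : Fin 3 × Fin 3 → R) :
    graphVec e f x 0 * graphVec e f x 1 * graphVec e f x 2 - ∑ p : Fin 3 × Fin 3,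
      x p • (graphVec e f x (p.1 + 1) * graphVec e f x (p.1 + 2) * f p.2) =
      stdTau e f none + ∑ j, stdQ x none j • stdLam e f j := by
  simp only [h.graphVec_mul_mul]
  simp only [Fintype.sum_option, Fintype.sum_prod_type, Fin.sum_univ_three, graphVec, stdTau,
    stdLam, stdQ, cofEntry]
  simp [leviCivita, mul_add, add_mul, mul_assoc, h.ee 2 0, h.ff 1 0, h.ff 2 0,
      h.ff 2 1, h.ff_assoc 1 0,
      h.fe, h.f_sq, h.fe_assoc, h.f_sq_assoc, smul_smul,
      fin_three_neg_one, fin_three_neg_two]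
  module

theorem IsGrassmann.graphVec_sq (h : IsGrassmann e f) (x : Fin 3 × Fin 3 → R) (i : Fin 3) :
    graphVec e f x i * graphVec e f x i = 0 := by
  simp only [graphVec, Fin.sum_univ_three]
  simp [mul_add, add_mul, h.ff 1 0, h.ff 2 0, h.ff 2 1, h.fe, h.e_sq, h.f_sq, smul_smul]
  module

theorem IsGrassmann.graphVec_anti (h : IsGrassmann e f) (x : Fin 3 × Fin 3 → R) (i j : Fin 3) :
    graphVec e f x i * graphVec e f x j = -(graphVec e f x j * graphVec e f x i) := by
  simp only [graphVec, Fin.sum_univ_three]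
  simp [mul_add, add_mul, h.ff 1 0, h.ff 2 0, h.ff 2 1, h.fe, h.ee j i, h.f_sq, smul_smul]
  module

/-- T_U is contained in the graph: reduce e_k to u_k minus a combination of the f_l, then reorder by
anticommutativity. The reverse inclusion is `IsGrassmann.stdTau_add_mem`. -/
theorem IsGrassmann.mul_mul_mem (h : IsGrassmann e f) (x : Fin 3 × Fin 3 → R) (i j : Fin 3) {y : Ξ}
    (hy : y ∈ Submodule.span R (Set.range e ∪ Set.range f)) :
    graphVec e f x i * graphVec e f x j * y ∈ Submodule.span R
      (Set.range fun i => stdTau e f i + ∑ j, stdQ x i j • stdLam e f j) := by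
  set N := Submodule.span R
      (Set.range fun i => stdTau e f i + ∑ j, stdQ x i j • stdLam e f j) with hN
  set u := graphVec e f x with hu
  have hf : ∀ i j l, u i * u j * f l ∈ N := by
    have h0 : ∀ a l, u (a + 1) * u (a + 2) * f l ∈ N := by
      intro a l
      rw [hu, h.graphVec_mul_mul x (a, l)]
      exact Submodule.subset_span ⟨some (a, l), rfl⟩
    have h1 : ∀ a l, u (a + 2) * u (a + 1) * f l ∈ N := by
      intro a l
      rw [hu, h.graphVec_anti, neg_mul]
      exact neg_mem (h0 a l)
    intro i j l
    by_cases hij : j = i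
    · rw [hij, hu, h.graphVec_sq, zero_mul]; exact zero_mem _
    · by_cases hij2 : j = i + 1
      · have := h0 (i + 2) l
        rw [add_assoc, add_assoc] at this
        rw [hij2]
        simpa using this
      · have hij3 : j = i + 2 := by revert i j; decide
        have := h1 (i + 1) l
        rw [add_assoc, add_assoc] at this
        rw [hij3]
        simpa using this
  have h012 : u 0 * u 1 * u 2 ∈ N := by
    have := h.graphVec_triple x
    rw [sub_eq_iff_eq_add] at this
    rw [hu, this]
    exact add_mem (Submodule.subset_span ⟨none, rfl⟩)
      (sum_mem fun p _ => Submodule.smul_mem _ _ (hf _ _ _))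
  have hua : ∀ i j, u i * u j = -(u j * u i) := h.graphVec_anti x
  have hus : ∀ i, u i * u i = 0 := h.graphVec_sq x
  have huaa : ∀ i j z, u i * (u j * z) = -(u j * (u i * z)) := by
    intro i j z; rw [← mul_assoc, hua, neg_mul, mul_assoc]
  have huss : ∀ i z, u i * (u i * z) = 0 := by
    intro i z; rw [← mul_assoc, hus, zero_mul]
  rw [mul_assoc] at h012
  have huuu : ∀ i j k, u i * u j * u k ∈ N := by
    intro i j k
    fin_cases i <;> fin_cases j <;> fin_cases k <;>
      simp [mul_assoc, hus, huss, hua 1 0, hua 2 0, hua 2 1, huaa 1 0, h012]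
  induction hy using Submodule.span_induction with
  | mem y hy =>
    rcases hy with ⟨k, rfl⟩ | ⟨l, rfl⟩
    · have : e k = u k - ∑ j, x (k, j) • f j := by simp [hu, graphVec]
      rw [this, mul_sub, Finset.mul_sum]
      refine sub_mem (huuu _ _ _) (sum_mem fun l _ => ?_)
      rw [mul_smul_comm]
      exact Submodule.smul_mem _ _ (hf _ _ _)
    · exact hf _ _ _
  | zero => rw [mul_zero]; exact zero_mem _
  | add y z _ _ hy hz => rw [mul_add]; exact add_mem hy hz
  | smul a y _ hy => rw [mul_smul_comm]; exact Submodule.smul_mem _ _ hy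

end Grassmann
end EPW
end

/-! ### The graph vectors lie in T_U; wedge products of the frame vectors -/

open scoped TensorProduct
noncomputable section
namespace EPW

section Grassmann

variable {R Ξ : Type*} [CommRing R] [Ring Ξ] [Algebra R Ξ] {e f : Fin 3 → Ξ}

theorem IsGrassmann.stdTau_add_mem (h : IsGrassmann e f) (x : Fin 3 × Fin 3 → R)
    {N : Submodule R Ξ} (he : ∀ i j k, graphVec e f x i * graphVec e f x j * e k ∈ N)
    (hf : ∀ i j l, graphVec e f x i * graphVec e f x j * f l ∈ N) (i : Option (Fin 3 × Fin 3)) :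
    stdTau e f i + ∑ j, stdQ x i j • stdLam e f j ∈ N := by
  rcases i with _ | p
  · rw [← h.graphVec_triple]
    refine sub_mem ?_ (sum_mem fun p _ => Submodule.smul_mem _ _ (hf _ _ _))
    have h2 : graphVec e f x 2 = e 2 + ∑ j, x (2, j) • f j := rfl
    rw [h2, mul_add, Finset.mul_sum]
    refine add_mem (he _ _ _) (sum_mem fun l _ => ?_)
    rw [mul_smul_comm]
    exact Submodule.smul_mem _ _ (hf _ _ _)
  · rw [← h.graphVec_mul_mul]
    exact hf _ _ _

section Triple

variable {x : Fin 3 → Ξ}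

theorem mul_four_eq_zero (hx : ∀ i j, x i * x j = -(x j * x i))
    (hs : ∀ i, x i * x i = 0) (i j k l : Fin 3) (z : Ξ) :
    x i * (x j * (x k * (x l * z))) = 0 := by
  have hxa : ∀ i j z, x i * (x j * z) = -(x j * (x i * z)) := by
    intro i j z; rw [← mul_assoc, hx, neg_mul, mul_assoc]
  have hsa : ∀ i z, x i * (x i * z) = 0 := by
    intro i z; rw [← mul_assoc, hs, zero_mul]
  have h3 : ∀ i j k z, x i * (x j * (x k * z)) = 0 ∨
      x i * (x j * (x k * z)) = x 0 * (x 1 * (x 2 * z)) ∨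
      x i * (x j * (x k * z)) = -(x 0 * (x 1 * (x 2 * z))) := by
    intro i j k z
    fin_cases i <;> fin_cases j <;> fin_cases k <;>
      simp [hsa, hxa 1 0, hxa 2 0, hxa 2 1]
  have h4 : ∀ l, x 0 * (x 1 * (x 2 * (x l * z))) = 0 := by
    intro l
    fin_cases l <;> simp [hsa, hxa 1 0, hxa 2 0, hxa 2 1]
  rcases h3 i j k (x l * z) with h | h | h <;> simp [h, h4]

theorem mul_three_left (hx : ∀ i j, x i * x j = -(x j * x i))
    (hs : ∀ i, x i * x i = 0) (a k : Fin 3) (z : Ξ) :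
    x (a + 1) * (x (a + 2) * (x k * z)) = if a = k then x 0 * (x 1 * (x 2 * z)) else 0 := by
  have hxa : ∀ i j z, x i * (x j * z) = -(x j * (x i * z)) := by
    intro i j z; rw [← mul_assoc, hx, neg_mul, mul_assoc]
  have hsa : ∀ i z, x i * (x i * z) = 0 := by
    intro i z; rw [← mul_assoc, hs, zero_mul]
  fin_cases a <;> fin_cases k <;> simp [hsa, hxa 1 0, hxa 2 0, hxa 2 1]

theorem mul_three_right (hx : ∀ i j, x i * x j = -(x j * x i))
    (hs : ∀ i, x i * x i = 0) (a k : Fin 3) (z : Ξ) :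
    x k * (x (a + 1) * (x (a + 2) * z)) = if a = k then x 0 * (x 1 * (x 2 * z)) else 0 := by
  have hxa : ∀ i j z, x i * (x j * z) = -(x j * (x i * z)) := by
    intro i j z; rw [← mul_assoc, hx, neg_mul, mul_assoc]
  have hsa : ∀ i z, x i * (x i * z) = 0 := by
    intro i z; rw [← mul_assoc, hs, zero_mul]
  fin_cases a <;> fin_cases k <;> simp [hsa, hxa 1 0, hxa 2 0, hxa 2 1]

end Triple

theorem IsGrassmann.stdTau_mul_stdTau (h : IsGrassmann e f) (i j : Option (Fin 3 × Fin 3)) :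
    stdTau e f i * stdTau e f j = 0 := by
  have h4 := mul_four_eq_zero h.ee h.e_sq
  have h4' : ∀ i j k l, e i * (e j * (e k * e l)) = 0 := by
    intro i j k l; simpa using h4 i j k l 1
  rcases i with _ | p <;> rcases j with _ | q <;>
    simp only [stdTau, mul_assoc, h.fe_assoc, h.fe, mul_neg, neg_neg, h4, h4', mul_zero, neg_zero]

theorem IsGrassmann.stdLam_mul_stdLam (h : IsGrassmann e f) (i j : Option (Fin 3 × Fin 3)) :
    stdLam e f i * stdLam e f j = 0 := by
  have h4 := mul_four_eq_zero h.ff h.f_sq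
  have h4' : ∀ i j k l, f i * (f j * (f k * f l)) = 0 := by
    intro i j k l; simpa using h4 i j k l 1
  rcases i with _ | p <;> rcases j with _ | q <;>
    simp only [stdLam, mul_assoc, h.fe_assoc, mul_neg, neg_mul, h4', mul_zero,
      neg_zero]

theorem IsGrassmann.stdTau_mul_stdLam (h : IsGrassmann e f) (i j : Option (Fin 3 × Fin 3)) :
    stdTau e f i * stdLam e f j = if i = j then e 0 * e 1 * e 2 * (f 0 * f 1 * f 2) else 0 := by
  have he4 := mul_four_eq_zero h.ee h.e_sq
  have hf4 : ∀ i j k l, f i * (f j * (f k * f l)) = 0 := by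
    intro i j k l; simpa using mul_four_eq_zero h.ff h.f_sq i j k l 1
  have he3 := mul_three_left h.ee h.e_sq
  have hf3 : ∀ a k, f k * (f (a + 1) * f (a + 2)) = if a = k then f 0 * (f 1 * f 2) else 0 := by
    intro a k; simpa using mul_three_right h.ff h.f_sq a k 1
  rcases i with _ | ⟨a, l⟩ <;> rcases j with _ | ⟨k, n⟩
  · simp only [stdTau, stdLam, if_true]
  · simp [stdTau, stdLam, mul_assoc, he4]
  · simp [stdTau, stdLam, mul_assoc, hf4]
  · simp only [stdTau, stdLam, mul_assoc, mul_neg, h.fe_assoc, neg_neg, he3, hf3]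
    rcases eq_or_ne a k with rfl | h1
    · rcases eq_or_ne n l with rfl | h2
      · simp
      · simp [h2, h2.symm]
    · simp [h1]

theorem IsGrassmann.stdLam_mul_stdTau (h : IsGrassmann e f) (i j : Option (Fin 3 × Fin 3)) :
    stdLam e f i * stdTau e f j =
      if i = j then -(e 0 * e 1 * e 2 * (f 0 * f 1 * f 2)) else 0 := by
  have he4 := mul_four_eq_zero h.ee h.e_sq
  have hf4 : ∀ i j k l, f i * (f j * (f k * f l)) = 0 := by
    intro i j k l; simpa using mul_four_eq_zero h.ff h.f_sq i j k l 1
  have he3 := mul_three_right h.ee h.e_sq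
  have hf3 : ∀ a k, f (a + 1) * (f (a + 2) * f k) = if a = k then f 0 * (f 1 * f 2) else 0 := by
    intro a k; simpa using mul_three_left h.ff h.f_sq a k 1
  rcases i with _ | ⟨a, l⟩ <;> rcases j with _ | ⟨k, n⟩
  · simp [stdTau, stdLam, mul_assoc, h.fe_assoc, h.fe]
  · simp [stdTau, stdLam, mul_assoc, h.fe_assoc, hf4]
  · simp [stdTau, stdLam, mul_assoc, h.fe_assoc, h.fe, he4]
  · simp only [stdTau, stdLam, mul_assoc, mul_neg, neg_mul, h.fe_assoc, neg_neg, he3, hf3]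
    rcases eq_or_ne k a with rfl | h1
    · rcases eq_or_ne l n with rfl | h2
      · simp
      · simp [h2]
    · simp [h1, h1.symm]

end Grassmann

end EPW
end

open scoped TensorProduct
noncomputable section
namespace EPW
open ExteriorAlgebra

variable {V : Type*} [AddCommGroup V] [Module ℂ V]

/-! ### Symplectic frames of `⋀³V` -/

theorem isGrassmann_ι (e f : Fin 3 → V) :
    IsGrassmann (fun i => ι ℂ (e i)) (fun i => ι ℂ (f i)) := by
  have h : ∀ x y : V, ι ℂ x * ι ℂ y = -(ι ℂ y * ι ℂ x) := fun x y =>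
    eq_neg_of_add_eq_zero_left (ι_add_mul_swap x y)
  exact ⟨fun _ _ => h _ _, fun _ _ => h _ _, fun _ _ => h _ _, fun _ => ι_sq_zero _,
    fun _ => ι_sq_zero _⟩

/-- The alternating maps that define the volume form. -/
def volFamily (b : Module.Basis (Fin 6) ℂ V) : ∀ i : ℕ, V [⋀^Fin i]→ₗ[ℂ] ℂ
  | 6 => b.det
  | _ => 0

/-- The linear form on the exterior algebra given by the top degree component and the basis `e`. -/
def volForm (e : Module.Basis (Fin 3 ⊕ Fin 3) ℂ V) : ExteriorAlgebra ℂ V →ₗ[ℂ] ℂ :=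
  liftAlternating (volFamily (e.reindex finSumFinEquiv))

theorem volForm_vol (e : Module.Basis (Fin 3 ⊕ Fin 3) ℂ V) :
    volForm e (ι ℂ (e (Sum.inl 0)) * ι ℂ (e (Sum.inl 1)) * ι ℂ (e (Sum.inl 2)) *
      (ι ℂ (e (Sum.inr 0)) * ι ℂ (e (Sum.inr 1)) * ι ℂ (e (Sum.inr 2)))) = 1 := by
  have h1 : ι ℂ (e (Sum.inl 0)) * ι ℂ (e (Sum.inl 1)) * ι ℂ (e (Sum.inl 2)) *
      (ι ℂ (e (Sum.inr 0)) * ι ℂ (e (Sum.inr 1)) * ι ℂ (e (Sum.inr 2))) =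
      ιMulti ℂ 6 (e.reindex finSumFinEquiv) := by
    rw [ιMulti_apply]
    simp only [List.ofFn_succ, List.ofFn_zero, List.prod_cons, List.prod_nil, mul_one, mul_assoc,
      Module.Basis.reindex_apply]
    rfl
  rw [h1, volForm, liftAlternating_apply_ιMulti]
  exact Module.Basis.det_self _

/-- A symplectic basis of `⋀³V` with respect to the wedge product, consisting of the vectors
`tau i` and `lam i`. -/
structure SympFrame (V : Type*) [AddCommGroup V] [Module ℂ V] (κ : Type*) [Fintype κ]
    [DecidableEq κ] where
  tau : κ → ExteriorAlgebra ℂ V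
  lam : κ → ExteriorAlgebra ℂ V
  vol : ExteriorAlgebra ℂ V
  form : ExteriorAlgebra ℂ V →ₗ[ℂ] ℂ
  form_vol : form vol = 1
  tau_mem : ∀ i, tau i ∈ ⋀[ℂ]^3 V
  lam_mem : ∀ i, lam i ∈ ⋀[ℂ]^3 V
  le_span : ⋀[ℂ]^3 V ≤ Submodule.span ℂ (Set.range tau) ⊔ Submodule.span ℂ (Set.range lam)
  tau_mul_tau : ∀ i j, tau i * tau j = 0
  lam_mul_lam : ∀ i j, lam i * lam j = 0
  tau_mul_lam : ∀ i j, tau i * lam j = if i = j then vol else 0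
  lam_mul_tau : ∀ i j, lam i * tau j = if i = j then -vol else 0

theorem sum_basis_mul_repr {κ μ : Type*} [Fintype κ] [DecidableEq κ] [DecidableEq μ]
    (b : Module.Basis μ ℂ (κ → ℂ)) (a c : μ) :
    ∑ i, b a i * b.repr (Pi.single i 1) c = if a = c then 1 else 0 := by
  have h : b a = ∑ i, b a i • (Pi.single i 1 : κ → ℂ) := by
    ext j
    simp [Finset.sum_apply, Pi.single_apply]
  have h2 := congrArg (fun v => b.repr v c) h
  simp only [map_sum, map_smul, Finsupp.coe_finsetSum, Finset.sum_apply, Finsupp.smul_apply,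
    Module.Basis.repr_self, smul_eq_mul] at h2
  rw [← h2, Finsupp.single_apply]

namespace SympFrame

variable {κ : Type*} [Fintype κ] [DecidableEq κ] (F : SympFrame V κ)

/-- The coordinate of `tau i`. -/
def tauCoord (i : κ) : ExteriorAlgebra ℂ V →ₗ[ℂ] ℂ :=
  F.form ∘ₗ (LinearMap.mulRight ℂ (F.lam i))

/-- The coordinate of `lam i`. -/
def lamCoord (i : κ) : ExteriorAlgebra ℂ V →ₗ[ℂ] ℂ :=
  -(F.form ∘ₗ (LinearMap.mulRight ℂ (F.tau i)))

theorem tauCoord_tau (i j : κ) : F.tauCoord i (F.tau j) = if i = j then 1 else 0 := by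
  simp only [tauCoord, LinearMap.comp_apply, LinearMap.mulRight_apply, F.tau_mul_lam, eq_comm]
  split_ifs <;> simp [F.form_vol]

theorem tauCoord_lam (i j : κ) : F.tauCoord i (F.lam j) = 0 := by
  simp [tauCoord, F.lam_mul_lam]

theorem lamCoord_lam (i j : κ) : F.lamCoord i (F.lam j) = if i = j then 1 else 0 := by
  simp only [lamCoord, LinearMap.neg_apply, LinearMap.comp_apply, LinearMap.mulRight_apply,
    F.lam_mul_tau, eq_comm]
  split_ifs <;> simp [F.form_vol]

theorem lamCoord_tau (i j : κ) : F.lamCoord i (F.tau j) = 0 := by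
  simp [lamCoord, F.tau_mul_tau]

theorem tauCoord_sum (i : κ) (p r : κ → ℂ) :
    F.tauCoord i (∑ j, p j • F.tau j + ∑ j, r j • F.lam j) = p i := by
  simp [tauCoord_tau, tauCoord_lam]

theorem lamCoord_sum (i : κ) (p r : κ → ℂ) :
    F.lamCoord i (∑ j, p j • F.tau j + ∑ j, r j • F.lam j) = r i := by
  simp [lamCoord_tau, lamCoord_lam]

theorem eq_sum {a : ExteriorAlgebra ℂ V} (ha : a ∈ ⋀[ℂ]^3 V) :
    a = ∑ i, F.tauCoord i a • F.tau i + ∑ i, F.lamCoord i a • F.lam i := by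
  obtain ⟨y, hy, z, hz, rfl⟩ := Submodule.mem_sup.1 (F.le_span ha)
  obtain ⟨p, rfl⟩ := (Submodule.mem_span_range_iff_exists_fun ℂ).1 hy
  obtain ⟨r, rfl⟩ := (Submodule.mem_span_range_iff_exists_fun ℂ).1 hz
  simp only [tauCoord_sum, lamCoord_sum]

theorem mul_eq (p r p' r' : κ → ℂ) :
    (∑ j, p j • F.tau j + ∑ j, r j • F.lam j) * (∑ j, p' j • F.tau j + ∑ j, r' j • F.lam j) =
      (∑ j, (p j * r' j - r j * p' j)) • F.vol := by
  simp only [add_mul, mul_add, Finset.sum_mul_sum, smul_mul_smul_comm, F.tau_mul_tau,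
    F.lam_mul_lam, F.tau_mul_lam, F.lam_mul_tau, smul_zero, Finset.sum_const_zero, smul_ite,
    Finset.sum_ite_eq, Finset.mem_univ, if_true, zero_add, add_zero, Finset.sum_smul, sub_smul,
    Finset.sum_sub_distrib, smul_neg, Finset.sum_neg_distrib]
  abel

theorem vol_ne_zero : F.vol ≠ 0 := by
  intro h
  have := F.form_vol
  rw [h] at this
  simp at this

theorem linearIndependent_tau : LinearIndependent ℂ F.tau := by
  rw [Fintype.linearIndependent_iff]
  intro c hc i
  have := F.tauCoord_sum i c 0
  simpa [hc] using this.symm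

/-- Exchanging the roles of `tau` and `lam`. -/
def swap : SympFrame V κ where
  tau := F.lam
  lam := F.tau
  vol := -F.vol
  form := -F.form
  form_vol := by simp [F.form_vol]
  tau_mem := F.lam_mem
  lam_mem := F.tau_mem
  le_span := by rw [sup_comm]; exact F.le_span
  tau_mul_tau := F.lam_mul_lam
  lam_mul_lam := F.tau_mul_tau
  tau_mul_lam := F.lam_mul_tau
  lam_mul_tau := by simpa using F.tau_mul_lam

variable {μ : Type*} [Fintype μ] [DecidableEq μ]

/-- The symplectic frame obtained from a change of basis of the span of the vectors `tau i`. -/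
def changeBasis (b : Module.Basis μ ℂ (κ → ℂ)) : SympFrame V μ where
  tau a := ∑ i, b a i • F.tau i
  lam a := ∑ i, b.repr (Pi.single i 1) a • F.lam i
  vol := F.vol
  form := F.form
  form_vol := F.form_vol
  tau_mem a := sum_mem fun i _ => Submodule.smul_mem _ _ (F.tau_mem i)
  lam_mem a := sum_mem fun i _ => Submodule.smul_mem _ _ (F.lam_mem i)
  le_span := by
    refine F.le_span.trans (sup_le_sup ?_ ?_)
    · rw [Submodule.span_le]
      rintro _ ⟨i, rfl⟩
      have : F.tau i = ∑ a, b.repr (Pi.single i 1) a • ∑ j, b a j • F.tau j := by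
        simp only [Finset.smul_sum, smul_smul]
        rw [Finset.sum_comm]
        have h := b.sum_repr (Pi.single i 1)
        have h2 : ∀ j, ∑ a, b.repr (Pi.single i 1) a * b a j = (Pi.single i 1 : κ → ℂ) j := by
          intro j
          have := congrFun h j
          simpa [Finset.sum_apply] using this
        simp only [← Finset.sum_smul, h2, Pi.single_apply, ite_smul, one_smul, zero_smul]
        simp
      rw [this]
      exact sum_mem fun a _ => Submodule.smul_mem _ _ (Submodule.subset_span ⟨a, rfl⟩)
    · rw [Submodule.span_le]
      rintro _ ⟨j, rfl⟩
      have : F.lam j = ∑ a, b a j • ∑ i, b.repr (Pi.single i 1) a • F.lam i := by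
        simp only [Finset.smul_sum, smul_smul]
        rw [Finset.sum_comm]
        have h2 : ∀ i, ∑ a, b a j * b.repr (Pi.single i 1) a = (Pi.single i 1 : κ → ℂ) j := by
          intro i
          have := congrFun (b.sum_repr (Pi.single i 1)) j
          simpa [Finset.sum_apply, mul_comm] using this
        simp only [← Finset.sum_smul, h2, Pi.single_apply, ite_smul, one_smul, zero_smul]
        simp
      rw [this]
      exact sum_mem fun a _ => Submodule.smul_mem _ _ (Submodule.subset_span ⟨a, rfl⟩)
  tau_mul_tau a c := by simp [Finset.sum_mul_sum, F.tau_mul_tau]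
  lam_mul_lam a c := by simp [Finset.sum_mul_sum, F.lam_mul_lam]
  tau_mul_lam a c := by
    simp only [Finset.sum_mul_sum, smul_mul_smul_comm, F.tau_mul_lam, smul_ite, smul_zero,
      Finset.sum_ite_eq, Finset.mem_univ, if_true, ← Finset.sum_smul, sum_basis_mul_repr]
    split_ifs <;> simp
  lam_mul_tau a c := by
    simp only [Finset.sum_mul_sum, smul_mul_smul_comm, F.lam_mul_tau, smul_ite, smul_zero,
      Finset.sum_ite_eq, Finset.mem_univ, if_true, ← Finset.sum_smul, mul_comm _ (b c _),
      sum_basis_mul_repr, eq_comm]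
    split_ifs <;> simp

end SympFrame

/-- Wedging a linear relation with the dual vector isolates each coefficient. -/
theorem linearIndependent_sumElim_of_symplectic {κ : Type*} [Fintype κ] [DecidableEq κ]
    {tau lam : κ → ExteriorAlgebra ℂ V} {vol : ExteriorAlgebra ℂ V}
    {form : ExteriorAlgebra ℂ V →ₗ[ℂ] ℂ} (form_vol : form vol = 1)
    (tau_mul_tau : ∀ i j, tau i * tau j = 0) (lam_mul_lam : ∀ i j, lam i * lam j = 0)
    (tau_mul_lam : ∀ i j, tau i * lam j = if i = j then vol else 0)
    (lam_mul_tau : ∀ i j, lam i * tau j = if i = j then -vol else 0) :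
    LinearIndependent ℂ (Sum.elim tau lam) := by
  rw [Fintype.linearIndependent_iff]
  intro c hc
  simp only [Fintype.sum_sum_type, Sum.elim_inl, Sum.elim_inr] at hc
  rintro (i | i)
  · have := congrArg (fun z => form (z * lam i)) hc
    simpa [add_mul, Finset.sum_mul, tau_mul_lam, lam_mul_lam, form_vol] using this
  · have := congrArg (fun z => form (z * tau i)) hc
    simpa [add_mul, Finset.sum_mul, lam_mul_tau, tau_mul_tau, form_vol] using this

theorem ι_mul_mul_mem (a b c : V) : ι ℂ a * ι ℂ b * ι ℂ c ∈ ⋀[ℂ]^3 V := by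
  rw [exteriorPower, pow_succ, pow_two]
  exact Submodule.mul_mem_mul (Submodule.mul_mem_mul ⟨a, rfl⟩ ⟨b, rfl⟩) ⟨c, rfl⟩

/-- The symplectic frame given by a basis of `V`. -/
def stdFrame (e : Module.Basis (Fin 3 ⊕ Fin 3) ℂ V) : SympFrame V (Option (Fin 3 × Fin 3)) :=
  have h := isGrassmann_ι (e ∘ Sum.inl) (e ∘ Sum.inr)
  have htau : ∀ i, stdTau (fun i => ι ℂ ((e ∘ Sum.inl) i)) (fun i => ι ℂ ((e ∘ Sum.inr) i)) i ∈
      ⋀[ℂ]^3 V := by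
    rintro (_ | p) <;> exact ι_mul_mul_mem _ _ _
  have hlam : ∀ i, stdLam (fun i => ι ℂ ((e ∘ Sum.inl) i)) (fun i => ι ℂ ((e ∘ Sum.inr) i)) i ∈
      ⋀[ℂ]^3 V := by
    rintro (_ | p)
    · exact ι_mul_mul_mem _ _ _
    · exact neg_mem (ι_mul_mul_mem _ _ _)
  { tau := stdTau (fun i => ι ℂ (e (Sum.inl i))) (fun i => ι ℂ (e (Sum.inr i)))
    lam := stdLam (fun i => ι ℂ (e (Sum.inl i))) (fun i => ι ℂ (e (Sum.inr i)))
    vol := _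
    form := volForm e
    form_vol := volForm_vol e
    tau_mem := htau
    lam_mem := hlam
    tau_mul_tau := h.stdTau_mul_stdTau
    lam_mul_lam := h.stdLam_mul_stdLam
    tau_mul_lam := h.stdTau_mul_stdLam
    lam_mul_tau := h.stdLam_mul_stdTau
    le_span := by
      have hli := linearIndependent_sumElim_of_symplectic (volForm_vol e) h.stdTau_mul_stdTau
        h.stdLam_mul_stdLam h.stdTau_mul_stdLam h.stdLam_mul_stdTau
      have : Module.Finite ℂ V := Module.Finite.of_basis e
      have h6 : Module.finrank ℂ V = 6 := by rw [Module.finrank_eq_card_basis e]; rfl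
      -- Twenty independent vectors in a space of dimension 20 span it.
      have h20 : Module.finrank ℂ (⋀[ℂ]^3 V) = 20 := by
        rw [exteriorPower.finrank_eq, h6]; rfl
      have hle : Submodule.span ℂ (Set.range (Sum.elim
          (stdTau (fun i => ι ℂ ((e ∘ Sum.inl) i)) (fun i => ι ℂ ((e ∘ Sum.inr) i)))
          (stdLam (fun i => ι ℂ ((e ∘ Sum.inl) i)) (fun i => ι ℂ ((e ∘ Sum.inr) i))))) ≤
          ⋀[ℂ]^3 V :=
        Submodule.span_le.2 (by rintro _ ⟨i | i, rfl⟩; exacts [htau i, hlam i])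
      have heq := Submodule.eq_of_le_of_finrank_eq hle (by
        rw [finrank_span_eq_card hli, h20]; rfl)
      rw [← Submodule.span_union, ← Set.Sum.elim_range]
      exact heq.ge }

end EPW
end

/-! ### T_U as the graph of a symmetric matrix over the chart -/

open scoped TensorProduct
noncomputable section
namespace EPW
open ExteriorAlgebra

variable {V : Type*} [AddCommGroup V] [Module ℂ V]

theorem IsGrassmann.map {Ξ Ξ' : Type*} [Ring Ξ] [Ring Ξ'] {e f : Fin 3 → Ξ} (h : IsGrassmann e f)
    (φ : Ξ →+* Ξ') : IsGrassmann (fun i => φ (e i)) (fun i => φ (f i)) where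
  ee i j := by rw [← map_mul, h.ee, map_neg, map_mul]
  ff i j := by rw [← map_mul, h.ff, map_neg, map_mul]
  fe i j := by rw [← map_mul, h.fe, map_neg, map_mul]
  e_sq i := by rw [← map_mul, h.e_sq, map_zero]
  f_sq i := by rw [← map_mul, h.f_sq, map_zero]

theorem map_stdTau {Ξ Ξ' : Type*} [Ring Ξ] [Ring Ξ'] (e f : Fin 3 → Ξ) (φ : Ξ →+* Ξ')
    (i : Option (Fin 3 × Fin 3)) :
    stdTau (fun i => φ (e i)) (fun i => φ (f i)) i = φ (stdTau e f i) := by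
  rcases i with _ | p <;> simp [stdTau]

theorem map_stdLam {Ξ Ξ' : Type*} [Ring Ξ] [Ring Ξ'] (e f : Fin 3 → Ξ) (φ : Ξ →+* Ξ')
    (i : Option (Fin 3 × Fin 3)) :
    stdLam (fun i => φ (e i)) (fun i => φ (f i)) i = φ (stdLam e f i) := by
  rcases i with _ | p <;> simp [stdLam]

theorem map_cofEntry {R R' : Type*} [CommRing R] [CommRing R'] (φ : R →+* R')
    (x : Fin 3 × Fin 3 → R) (p : Fin 3 × Fin 3) :
    cofEntry (fun q => φ (x q)) p = φ (cofEntry x p) := by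
  simp [cofEntry]

theorem map_stdQ {R R' : Type*} [CommRing R] [CommRing R'] (φ : R →+* R')
    (x : Fin 3 × Fin 3 → R) (i j : Option (Fin 3 × Fin 3)) :
    stdQ (fun q => φ (x q)) i j = φ (stdQ x i j) := by
  rcases i with _ | p <;> rcases j with _ | q <;> simp [stdQ, map_cofEntry, map_ofNat]

theorem smul_one_tmul {M : Type*} [AddCommGroup M] [Module ℂ M] (r : ChartRing) (m : M) :
    r • ((1 : ChartRing) ⊗ₜ[ℂ] m) = r ⊗ₜ m := by
  rw [TensorProduct.smul_tmul', smul_eq_mul, mul_one]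

/-- The sections `τ_i + ∑ Q_{ij} λ_j` of the trivial bundle with fibre `⋀³V`. -/
def SympFrame.graphSection {κ : Type*} [Fintype κ] [DecidableEq κ] (F : SympFrame V κ)
    (Q : Matrix κ κ ChartRing) (i : κ) : ChartRing ⊗[ℂ] ExteriorAlgebra ℂ V :=
  1 ⊗ₜ F.tau i + ∑ j, Q i j • (1 ⊗ₜ F.lam j)

theorem tautTangent_eq (e : Module.Basis (Fin 3 ⊕ Fin 3) ℂ V) :
    tautTangent e = Submodule.span ChartRing
      (Set.range ((stdFrame e).graphSection (stdQ MvPolynomial.X))) := by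
  set φ : ExteriorAlgebra ℂ V →+* ChartRing ⊗[ℂ] ExteriorAlgebra ℂ V :=
    (Algebra.TensorProduct.includeRight : _ →ₐ[ℂ] _).toRingHom with hφ
  set e' : Fin 3 → ChartRing ⊗[ℂ] ExteriorAlgebra ℂ V := fun i => φ (ι ℂ (e (Sum.inl i))) with he'
  set f' : Fin 3 → ChartRing ⊗[ℂ] ExteriorAlgebra ℂ V := fun i => φ (ι ℂ (e (Sum.inr i))) with hf'
  have h : IsGrassmann e' f' := (isGrassmann_ι (e ∘ Sum.inl) (e ∘ Sum.inr)).map φ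
  have hu : tautVector e = graphVec e' f' (MvPolynomial.X : _ → ChartRing) := by
    funext i
    simp only [tautVector, graphVec]
    congr 1
    exact Finset.sum_congr rfl fun j _ => (smul_one_tmul _ _).symm
  have hs : (stdFrame e).graphSection (stdQ MvPolynomial.X) = fun i => stdTau e' f' i +
      ∑ j, stdQ (MvPolynomial.X : _ → ChartRing) i j • stdLam e' f' j := by
    funext i
    simp only [he', hf', map_stdTau _ _ φ, map_stdLam _ _ φ]
    rfl
  have hV : ∀ v : V, (1 : ChartRing) ⊗ₜ[ℂ] ι ℂ v ∈
      Submodule.span ChartRing (Set.range e' ∪ Set.range f') := by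
    intro v
    induction e.mem_span v using Submodule.span_induction with
    | mem v hv =>
      obtain ⟨i | i, rfl⟩ := hv
      exacts [Submodule.subset_span (Or.inl ⟨i, rfl⟩), Submodule.subset_span (Or.inr ⟨i, rfl⟩)]
    | zero => simp
    | add v w _ _ hv hw => rw [map_add, TensorProduct.tmul_add]; exact Submodule.add_mem _ hv hw
    | smul c v _ hv =>
      rw [map_smul, TensorProduct.tmul_smul]
      exact Submodule.smul_of_tower_mem _ _ hv
  apply le_antisymm
  · rw [tautTangent, Submodule.span_le]
    rintro _ ⟨i, j, v, rfl⟩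
    rw [hu, hs]
    exact h.mul_mul_mem _ i j (hV v)
  · rw [Submodule.span_le, hs]
    rintro _ ⟨i, rfl⟩
    have hN : ∀ i j (v : V), graphVec e' f' (MvPolynomial.X : _ → ChartRing) i *
        graphVec e' f' (MvPolynomial.X : _ → ChartRing) j * (1 ⊗ₜ ι ℂ v) ∈ tautTangent e :=
      fun i j v => Submodule.subset_span ⟨i, j, v, by rw [hu]⟩
    exact h.stdTau_add_mem _ (fun i j k => hN i j _) (fun i j k => hN i j _) i

/-- The point of the Grassmannian with coordinates `x`. -/
def graphSubspace (e : Module.Basis (Fin 3 ⊕ Fin 3) ℂ V) (x : Fin 3 × Fin 3 → ℂ) : Submodule ℂ V :=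
  Submodule.span ℂ (Set.range fun i => e (Sum.inl i) + ∑ j, x (i, j) • e (Sum.inr j))

theorem tangentSubspace_graphSubspace (e : Module.Basis (Fin 3 ⊕ Fin 3) ℂ V)
    (x : Fin 3 × Fin 3 → ℂ) : tangentSubspace (graphSubspace e x) = Submodule.span ℂ
      (Set.range fun i => (stdFrame e).tau i + ∑ j, stdQ x i j • (stdFrame e).lam j) := by
  have h := isGrassmann_ι (e ∘ Sum.inl) (e ∘ Sum.inr)
  have hu : ∀ i, ι ℂ (e (Sum.inl i) + ∑ j, x (i, j) • e (Sum.inr j)) =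
      graphVec (fun i => ι ℂ ((e ∘ Sum.inl) i)) (fun i => ι ℂ ((e ∘ Sum.inr) i)) x i := by
    intro i; simp [graphVec]
  have hV : ∀ v : V, ι ℂ v ∈ Submodule.span ℂ (Set.range (fun i => ι ℂ ((e ∘ Sum.inl) i)) ∪
      Set.range (fun i => ι ℂ ((e ∘ Sum.inr) i))) := by
    intro v
    induction e.mem_span v using Submodule.span_induction with
    | mem v hv =>
      obtain ⟨i | i, rfl⟩ := hv
      exacts [Submodule.subset_span (Or.inl ⟨i, rfl⟩), Submodule.subset_span (Or.inr ⟨i, rfl⟩)]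
    | zero => simp
    | add v w _ _ hv hw => rw [map_add]; exact Submodule.add_mem _ hv hw
    | smul c v _ hv => rw [map_smul]; exact Submodule.smul_mem _ _ hv
  apply le_antisymm
  · rw [tangentSubspace, Submodule.span_le]
    rintro _ ⟨u, hu1, u', hu2, v, rfl⟩
    obtain ⟨c, rfl⟩ := (Submodule.mem_span_range_iff_exists_fun ℂ).1 hu1
    obtain ⟨c', rfl⟩ := (Submodule.mem_span_range_iff_exists_fun ℂ).1 hu2
    simp only [map_sum, map_smul, hu, Finset.sum_mul, Finset.mul_sum,
      smul_mul_assoc, mul_smul_comm, Finset.smul_sum, smul_smul]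
    exact sum_mem fun i _ => sum_mem fun j _ =>
      Submodule.smul_mem _ _ (h.mul_mul_mem x j i (hV v))
  · rw [Submodule.span_le]
    rintro _ ⟨i, rfl⟩
    have hN : ∀ i j (v : V),
        graphVec (fun i => ι ℂ ((e ∘ Sum.inl) i)) (fun i => ι ℂ ((e ∘ Sum.inr) i)) x i *
        graphVec (fun i => ι ℂ ((e ∘ Sum.inl) i)) (fun i => ι ℂ ((e ∘ Sum.inr) i)) x j * ι ℂ v ∈
        tangentSubspace (graphSubspace e x) :=
      fun i j v => Submodule.subset_span ⟨_, Submodule.subset_span ⟨i, rfl⟩,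
        _, Submodule.subset_span ⟨j, rfl⟩, v, by rw [hu, hu]⟩
    exact h.stdTau_add_mem _ (fun i j k => hN i j _) (fun i j k => hN i j _) i

theorem stdQ_zero {R : Type*} [CommRing R] : stdQ (0 : Fin 3 × Fin 3 → R) = 0 := by
  ext i j
  rcases i with _ | p <;> rcases j with _ | q <;> simp [stdQ, cofEntry]

theorem IsCentredAt.tangentSubspace_eq {e : Module.Basis (Fin 3 ⊕ Fin 3) ℂ V} {U : Submodule ℂ V}
    (h : IsCentredAt e U) :
    tangentSubspace U = Submodule.span ℂ (Set.range (stdFrame e).tau) := by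
  have h0 : U = graphSubspace e 0 := by simpa [graphSubspace] using h.symm
  rw [h0, tangentSubspace_graphSubspace]
  simp [stdQ_zero]

end EPW
end

/-! ### Symplectic frames adapted to a Lagrangian subspace -/

open scoped TensorProduct
noncomputable section
namespace EPW
open ExteriorAlgebra Module

variable {V : Type*} [AddCommGroup V] [Module ℂ V]

/-- The Lagrangian subspace `A` is spanned by the vectors `τ_i`, for `i : κ`, and
`λ_j + ∑ P_{jl} τ_l`, for `j : ρ`. -/
structure SympFrame.IsAdapted {κ ρ : Type*} [Fintype κ] [Fintype ρ] [DecidableEq κ] [DecidableEq ρ]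
    (F : SympFrame V (κ ⊕ ρ)) (P : Matrix ρ ρ ℂ) (A : Submodule ℂ (ExteriorAlgebra ℂ V)) :
    Prop where
  isSymm : P.IsSymm
  eq_span : A = Submodule.span ℂ (Set.range (F.tau ∘ Sum.inl)) ⊔ Submodule.span ℂ
    (Set.range fun j => F.lam (Sum.inr j) + ∑ l, P j l • F.tau (Sum.inr l))

theorem IsLagrangian.finiteDimensional {A : Submodule ℂ (ExteriorAlgebra ℂ V)}
    (hA : IsLagrangian A) : FiniteDimensional ℂ A :=
  FiniteDimensional.of_finrank_pos (by rw [hA.finrank_eq]; norm_num)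

/-- Choose a basis of the span of the τ that begins with A ∩ span τ. Since A is isotropic, the
coordinates along the λ dual to these first vectors vanish on A. The other λ-coordinates map A onto
ℂᵐ, with kernel A ∩ span τ, and preimages of the standard basis, corrected by the first τ, give the
matrix P. -/
theorem SympFrame.exists_isAdapted {κ : Type*} [Fintype κ] [DecidableEq κ] (F : SympFrame V κ)
    {A : Submodule ℂ (ExteriorAlgebra ℂ V)} (hA : IsLagrangian A) {k m : ℕ}
    (hk : finrank ℂ (A ⊓ Submodule.span ℂ (Set.range F.tau) : Submodule ℂ _) = k)
    (hm : k + m = 10) (hκ : Fintype.card κ = 10) :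
    ∃ (b : Basis (Fin k ⊕ Fin m) ℂ (κ → ℂ)) (P : Matrix (Fin m) (Fin m) ℂ),
      (F.changeBasis b).IsAdapted P A := by
  classical
  haveI := hA.finiteDimensional
  set T : (κ → ℂ) →ₗ[ℂ] ExteriorAlgebra ℂ V := Fintype.linearCombination ℂ F.tau with hT
  have hTapply : ∀ c, T c = ∑ i, c i • F.tau i := fun c => Fintype.linearCombination_apply _ _ _
  have hTinj : Function.Injective T := F.linearIndependent_tau.fintypeLinearCombination_injective
  have hTrange : LinearMap.range T = Submodule.span ℂ (Set.range F.tau) :=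
    Fintype.range_linearCombination _ _
  set W : Submodule ℂ (κ → ℂ) := A.comap T with hW
  have hWk : finrank ℂ W = k := by
    rw [← hk, ← hTrange, inf_comm, ← Submodule.map_comap_eq]
    exact (Submodule.equivMapOfInjective T hTinj W).finrank_eq
  obtain ⟨C, hC⟩ := Submodule.exists_isCompl W
  have hCm : finrank ℂ C = m := by
    have := Submodule.finrank_add_eq_of_isCompl hC
    rw [hWk, Module.finrank_fintype_fun_eq_card, hκ] at this
    omega
  set b : Basis (Fin k ⊕ Fin m) ℂ (κ → ℂ) :=
    ((finBasisOfFinrankEq ℂ W hWk).prod (finBasisOfFinrankEq ℂ C hCm)).map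
      (Submodule.prodEquivOfIsCompl W C hC) with hb
  have hbl : ∀ i, b (Sum.inl i) ∈ W := by
    intro i
    simp [hb]
  have hbr : ∀ i, b (Sum.inr i) ∈ C := by
    intro i
    simp [hb]
  set F' := F.changeBasis b with hF'
  have htau : ∀ a, F'.tau a = T (b a) := fun a => (hTapply _).symm
  have htl : ∀ i, F'.tau (Sum.inl i) ∈ A := fun i => by rw [htau]; exact hbl i
  have hlam0 : ∀ a ∈ A, ∀ i, F'.lamCoord (Sum.inl i) a = 0 := by
    intro a ha i
    simp [SympFrame.lamCoord, hA.wedge_eq_zero a ha _ (htl i)]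
  -- a vector of `A` without `λ`-coordinates is a combination of the first `τ`
  have hker : ∀ a ∈ A, (∀ i, F'.lamCoord (Sum.inr i) a = 0) →
      (∀ i, F'.tauCoord (Sum.inr i) a = 0) := by
    intro a ha h0 i
    have h1 := F'.eq_sum (hA.le_exteriorPower ha)
    simp only [Fintype.sum_sum_type, hlam0 a ha, h0, zero_smul, Finset.sum_const_zero, add_zero,
      htau, ← map_smul, ← map_sum] at h1
    have h2 : (∑ i, F'.tauCoord (Sum.inl i) a • b (Sum.inl i) +
        ∑ i, F'.tauCoord (Sum.inr i) a • b (Sum.inr i)) ∈ W := by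
      change T _ ∈ A
      rw [← h1]; exact ha
    have h3 : ∑ i, F'.tauCoord (Sum.inr i) a • b (Sum.inr i) ∈ W :=
      (Submodule.add_mem_iff_right _
        (sum_mem fun i _ => Submodule.smul_mem _ _ (hbl i))).1 h2
    have h4 : ∑ i, F'.tauCoord (Sum.inr i) a • b (Sum.inr i) = 0 :=
      (Submodule.disjoint_def.1 hC.disjoint) _ h3
        (sum_mem fun i _ => Submodule.smul_mem _ _ (hbr i))
    have hli : LinearIndependent ℂ (b ∘ Sum.inr) :=
      b.linearIndependent.comp _ Sum.inr_injective
    exact (Fintype.linearIndependent_iff.1 hli) _ h4 i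
  set r : A →ₗ[ℂ] (Fin m → ℂ) :=
    (LinearMap.pi fun i => F'.lamCoord (Sum.inr i)) ∘ₗ A.subtype with hr
  -- The kernel of r injects into ℂᵏ by the first τ-coordinates, and dim A = 10 = k + m.
  have hrsurj : Function.Surjective r := by
    rw [← LinearMap.range_eq_top]
    apply Submodule.eq_top_of_finrank_eq
    have h1 := LinearMap.finrank_range_add_finrank_ker r
    rw [hA.finrank_eq] at h1
    have h2 : finrank ℂ (LinearMap.ker r) ≤ k := by
      set s : (LinearMap.ker r) →ₗ[ℂ] (Fin k → ℂ) :=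
        (LinearMap.pi fun i => F'.tauCoord (Sum.inl i)) ∘ₗ A.subtype ∘ₗ (LinearMap.ker r).subtype
      have hs : Function.Injective s := by
        rw [injective_iff_map_eq_zero]
        rintro ⟨⟨a, ha⟩, har⟩ h0
        have hr0 : ∀ i, F'.lamCoord (Sum.inr i) a = 0 := fun i => congrFun har i
        have ht0 : ∀ i, F'.tauCoord (Sum.inl i) a = 0 := fun i => congrFun h0 i
        have := F'.eq_sum (hA.le_exteriorPower ha)
        simp only [Fintype.sum_sum_type, hlam0 a ha, hr0, hker a ha hr0, ht0, zero_smul,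
          Finset.sum_const_zero, add_zero] at this
        simpa using this
      simpa using LinearMap.finrank_le_finrank_of_injective hs
    have h3 := Submodule.finrank_le (LinearMap.range r)
    rw [Module.finrank_fintype_fun_eq_card, Fintype.card_fin] at h3 ⊢
    omega
  choose a ha using fun j : Fin m => hrsurj (Pi.single j 1)
  have halam : ∀ j i, F'.lamCoord (Sum.inr i) (a j : ExteriorAlgebra ℂ V) = if i = j then 1 else 0 := by
    intro j i
    rw [← Pi.single_apply, ← ha j]
    rfl
  set P : Matrix (Fin m) (Fin m) ℂ :=
    Matrix.of fun j l => F'.tauCoord (Sum.inr l) (a j : ExteriorAlgebra ℂ V) with hP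
  have haeq : ∀ j, (a j : ExteriorAlgebra ℂ V) = ∑ i, F'.tauCoord (Sum.inl i)
      (a j : ExteriorAlgebra ℂ V) • F'.tau (Sum.inl i) + (F'.lam (Sum.inr j) +
        ∑ l, P j l • F'.tau (Sum.inr l)) := by
    intro j
    have h1 := F'.eq_sum (hA.le_exteriorPower (a j).2)
    simp only [Fintype.sum_sum_type, hlam0 _ (a j).2, halam, ite_smul, one_smul, zero_smul,
      Finset.sum_const_zero, zero_add, Finset.sum_ite_eq', Finset.mem_univ, if_true] at h1
    rw [add_comm (F'.lam (Sum.inr j)), ← add_assoc]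
    exact h1
  have hmem : ∀ j, F'.lam (Sum.inr j) + ∑ l, P j l • F'.tau (Sum.inr l) ∈ A := by
    intro j
    have h1 := (a j).2
    rw [haeq j] at h1
    exact (Submodule.add_mem_iff_right _ (sum_mem fun i _ => Submodule.smul_mem _ _ (htl i))).1 h1
  refine ⟨b, P, ?_, ?_⟩
  -- Symmetry of P is the vanishing of the wedge product of two of the vectors λ_i + ∑ P_{il} τ_l.
  · ext i j
    rw [Matrix.transpose_apply]
    have h0 := hA.wedge_eq_zero _ (hmem i) _ (hmem j)
    have h1 := F'.mul_eq (Sum.elim 0 (P i)) (Sum.elim 0 (Pi.single i 1))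
      (Sum.elim 0 (P j)) (Sum.elim 0 (Pi.single j 1))
    simp only [Fintype.sum_sum_type, Sum.elim_inl, Sum.elim_inr, Pi.zero_apply, zero_smul,
      Finset.sum_const_zero, zero_add, Pi.single_apply, ite_smul, one_smul,
      Finset.sum_ite_eq', Finset.mem_univ, if_true, mul_ite, ite_mul, mul_one, one_mul, mul_zero,
      zero_mul, Finset.sum_sub_distrib] at h1
    rw [add_comm, add_comm (∑ l, P j l • _), h0] at h1
    have h2 := (smul_eq_zero.1 h1.symm).resolve_right F'.vol_ne_zero
    exact (sub_eq_zero.1 h2).symm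
  · apply le_antisymm
    · intro z hz
      set y := z - ∑ j, F'.lamCoord (Sum.inr j) z • (a j : ExteriorAlgebra ℂ V) with hy
      have hyA : y ∈ A := sub_mem hz (sum_mem fun j _ => Submodule.smul_mem _ _ (a j).2)
      have hy0 : ∀ i, F'.lamCoord (Sum.inr i) y = 0 := by
        intro i
        simp [hy, halam]
      have h1 := F'.eq_sum (hA.le_exteriorPower hyA)
      simp only [Fintype.sum_sum_type, hlam0 y hyA, hy0, hker y hyA hy0, zero_smul,
        Finset.sum_const_zero, add_zero] at h1
      have h2 : z = y + ∑ j, F'.lamCoord (Sum.inr j) z • (a j : ExteriorAlgebra ℂ V) := by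
        rw [hy, sub_add_cancel]
      have htm : ∀ c : Fin k → ℂ, ∑ i, c i • F'.tau (Sum.inl i) ∈
          Submodule.span ℂ (Set.range (F'.tau ∘ Sum.inl)) := fun c =>
        sum_mem fun i _ => Submodule.smul_mem _ _ (Submodule.subset_span ⟨i, rfl⟩)
      rw [h2]
      refine add_mem (Submodule.mem_sup_left (by rw [h1]; exact htm _))
        (sum_mem fun j _ => Submodule.smul_mem _ _ ?_)
      rw [haeq j]
      exact add_mem (Submodule.mem_sup_left (htm _))
        (Submodule.mem_sup_right (Submodule.subset_span ⟨j, rfl⟩))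
    · refine sup_le (Submodule.span_le.2 ?_) (Submodule.span_le.2 ?_)
      · rintro _ ⟨i, rfl⟩; exact htl i
      · rintro _ ⟨j, rfl⟩; exact hmem j

end EPW
end

/-! ### The degeneracy ideal in an adapted frame -/

open scoped TensorProduct
noncomputable section
namespace EPW
open ExteriorAlgebra Module

variable {V : Type*} [AddCommGroup V] [Module ℂ V]

theorem extendForm_one_tmul (φ : ExteriorAlgebra ℂ V →ₗ[ℂ] ℂ) (z : ExteriorAlgebra ℂ V) :
    extendForm φ (1 ⊗ₜ z) = MvPolynomial.C (φ z) := by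
  simp [extendForm, MvPolynomial.smul_eq_C_mul]

/-- A matrix of constants as a matrix of functions on the chart. -/
def constMatrix {m n : Type*} (W : Matrix m n ℂ) : Matrix m n ChartRing :=
  Matrix.of fun i j => MvPolynomial.C (W i j)

theorem constMatrix_apply {m n : Type*} (W : Matrix m n ℂ) (i : m) (j : n) :
    constMatrix W i j = MvPolynomial.C (W i j) := rfl

section ChangeBasis

variable {κ μ : Type*} [Fintype κ] [DecidableEq κ] [Fintype μ] [DecidableEq μ]

/-- The matrix of a quadratic form in another basis. -/
def conjMatrix (b : Basis μ ℂ (κ → ℂ)) (Q : Matrix κ κ ChartRing) : Matrix μ μ ChartRing :=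
  Matrix.of fun a c => ∑ i, ∑ j, MvPolynomial.C (b a i * b c j) * Q i j

theorem conjMatrix_isSymm (b : Basis μ ℂ (κ → ℂ)) {Q : Matrix κ κ ChartRing} (hQ : Q.IsSymm) :
    (conjMatrix b Q).IsSymm := by
  refine Matrix.ext fun a c => ?_
  simp only [Matrix.transpose_apply, conjMatrix, Matrix.of_apply]
  rw [Finset.sum_comm]
  refine Finset.sum_congr rfl fun i _ => Finset.sum_congr rfl fun j _ => ?_
  rw [mul_comm (b c j), hQ.apply]

theorem sum_repr_mul_basis (b : Basis μ ℂ (κ → ℂ)) (i j : κ) :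
    ∑ a, b.repr (Pi.single i 1) a * b a j = if i = j then 1 else 0 := by
  have := congrFun (b.sum_repr (Pi.single i 1)) j
  simpa [Finset.sum_apply, Pi.single_apply, eq_comm] using this

theorem SympFrame.lam_eq_sum_changeBasis (F : SympFrame V κ) (b : Basis μ ℂ (κ → ℂ)) (j : κ) :
    F.lam j = ∑ a, b a j • (F.changeBasis b).lam a := by
  simp only [changeBasis, Finset.smul_sum, smul_smul]
  rw [Finset.sum_comm]
  simp only [← Finset.sum_smul, mul_comm (b _ j), sum_repr_mul_basis, ite_smul, one_smul, zero_smul]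
  simp

theorem SympFrame.graphSection_changeBasis (F : SympFrame V κ) (b : Basis μ ℂ (κ → ℂ))
    (Q : Matrix κ κ ChartRing) (a : μ) :
    (F.changeBasis b).graphSection (conjMatrix b Q) a = ∑ i, b a i • F.graphSection Q i := by
  have h1 : ∀ i, F.graphSection Q i = 1 ⊗ₜ F.tau i +
      ∑ c, (∑ j, b c j • Q i j) • ((1 : ChartRing) ⊗ₜ[ℂ] (F.changeBasis b).lam c) := by
    intro i
    rw [graphSection]
    congr 1
    simp only [Finset.sum_smul]
    rw [Finset.sum_comm]
    refine Finset.sum_congr rfl fun j _ => ?_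
    rw [F.lam_eq_sum_changeBasis b j, TensorProduct.tmul_sum, Finset.smul_sum]
    refine Finset.sum_congr rfl fun c _ => ?_
    rw [TensorProduct.tmul_smul, smul_comm, smul_assoc]
  simp only [h1, smul_add, Finset.sum_add_distrib, Finset.smul_sum]
  rw [graphSection]
  congr 1
  · simp only [changeBasis, TensorProduct.tmul_sum, TensorProduct.tmul_smul]
  · rw [Finset.sum_comm]
    refine Finset.sum_congr rfl fun c _ => ?_
    rw [conjMatrix, Matrix.of_apply, Finset.sum_smul]
    refine Finset.sum_congr rfl fun i _ => ?_
    rw [← smul_assoc, Finset.smul_sum]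
    congr 1
    refine Finset.sum_congr rfl fun j _ => ?_
    rw [smul_smul, MvPolynomial.smul_eq_C_mul]

theorem SympFrame.span_graphSection_changeBasis (F : SympFrame V κ) (b : Basis μ ℂ (κ → ℂ))
    (Q : Matrix κ κ ChartRing) :
    Submodule.span ChartRing (Set.range ((F.changeBasis b).graphSection (conjMatrix b Q))) =
      Submodule.span ChartRing (Set.range (F.graphSection Q)) := by
  apply le_antisymm
  · rw [Submodule.span_le]
    rintro _ ⟨a, rfl⟩
    rw [F.graphSection_changeBasis]
    exact sum_mem fun i _ => Submodule.smul_of_tower_mem _ _ (Submodule.subset_span ⟨i, rfl⟩)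
  · rw [Submodule.span_le]
    rintro _ ⟨i, rfl⟩
    have : F.graphSection Q i = ∑ a, b.repr (Pi.single i 1) a •
        (F.changeBasis b).graphSection (conjMatrix b Q) a := by
      simp only [F.graphSection_changeBasis, Finset.smul_sum, smul_smul]
      rw [Finset.sum_comm]
      simp only [← Finset.sum_smul, sum_repr_mul_basis, ite_smul, one_smul, zero_smul]
      simp
    rw [this]
    exact sum_mem fun a _ => Submodule.smul_of_tower_mem _ _ (Submodule.subset_span ⟨a, rfl⟩)

theorem SympFrame.span_tau_changeBasis (F : SympFrame V κ) (b : Basis μ ℂ (κ → ℂ)) :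
    Submodule.span ℂ (Set.range (F.changeBasis b).tau) = Submodule.span ℂ (Set.range F.tau) := by
  apply le_antisymm
  · rw [Submodule.span_le]
    rintro _ ⟨a, rfl⟩
    exact sum_mem fun i _ => Submodule.smul_mem _ _ (Submodule.subset_span ⟨i, rfl⟩)
  · rw [Submodule.span_le]
    rintro _ ⟨i, rfl⟩
    have : F.tau i = ∑ a, b.repr (Pi.single i 1) a • (F.changeBasis b).tau a := by
      simp only [changeBasis, Finset.smul_sum, smul_smul]
      rw [Finset.sum_comm]
      simp only [← Finset.sum_smul, sum_repr_mul_basis, ite_smul, one_smul, zero_smul]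
      simp
    rw [this]
    exact sum_mem fun a _ => Submodule.smul_mem _ _ (Submodule.subset_span ⟨a, rfl⟩)

end ChangeBasis

section Adapted

variable {κ ρ : Type*} [Fintype κ] [Fintype ρ] [DecidableEq κ] [DecidableEq ρ]
  {F : SympFrame V (κ ⊕ ρ)} {P : Matrix ρ ρ ℂ} {A : Submodule ℂ (ExteriorAlgebra ℂ V)}

/-- The matrix of the map `T_U → ⋀³V / A` in an adapted frame. -/
def adaptedMatrix (Q : Matrix (κ ⊕ ρ) (κ ⊕ ρ) ChartRing) (P : Matrix ρ ρ ℂ) :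
    Matrix (κ ⊕ ρ) (κ ⊕ ρ) ChartRing :=
  Matrix.fromBlocks Q.toBlocks₁₁ (-(Q.toBlocks₁₂ * constMatrix P)) Q.toBlocks₂₁
    (1 - Q.toBlocks₂₂ * constMatrix P)

/-- The first λ and the last τ represent a basis of ⋀³V/A, where τ_i = 0 for i in κ and λ_j = -∑
P_{jl} τ_l for j in ρ. Substituting these relations into the graph vectors produces `adaptedMatrix`.
-/
theorem SympFrame.IsAdapted.extendForm_graphSection (h : F.IsAdapted P A)
    (Q : Matrix (κ ⊕ ρ) (κ ⊕ ρ) ChartRing) {φ : ExteriorAlgebra ℂ V →ₗ[ℂ] ℂ}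
    (hφ : ∀ a ∈ A, φ a = 0) (a : κ ⊕ ρ) :
    extendForm φ (F.graphSection Q a) = ∑ c, adaptedMatrix Q P a c * MvPolynomial.C
      (Sum.elim (fun i => φ (F.lam (Sum.inl i))) (fun j => φ (F.tau (Sum.inr j))) c) := by
  have h1 : ∀ i, φ (F.tau (Sum.inl i)) = 0 := fun i => hφ _ (by
    rw [h.eq_span]; exact Submodule.mem_sup_left (Submodule.subset_span ⟨i, rfl⟩))
  have h2 : ∀ j, φ (F.lam (Sum.inr j)) = -∑ l, P j l * φ (F.tau (Sum.inr l)) := fun j => by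
    have := hφ (F.lam (Sum.inr j) + ∑ l, P j l • F.tau (Sum.inr l)) (by
      rw [h.eq_span]; exact Submodule.mem_sup_right (Submodule.subset_span ⟨j, rfl⟩))
    simp only [map_add, map_sum, map_smul, smul_eq_mul] at this
    exact eq_neg_of_add_eq_zero_left this
  have h3 : ∀ B : ρ → ChartRing,
      ∑ j, B j * ∑ l, MvPolynomial.C (P j l) * MvPolynomial.C (φ (F.tau (Sum.inr l))) =
      ∑ l, (∑ j, B j * MvPolynomial.C (P j l)) * MvPolynomial.C (φ (F.tau (Sum.inr l))) := by
    intro B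
    simp only [Finset.mul_sum, Finset.sum_mul, mul_assoc]
    rw [Finset.sum_comm]
  rcases a with i | j
  · simp [SympFrame.graphSection, extendForm_one_tmul, Fintype.sum_sum_type, h1, h2, adaptedMatrix,
      Matrix.toBlocks₁₁, Matrix.toBlocks₁₂, Matrix.mul_apply, h3, constMatrix_apply]
  · simp [SympFrame.graphSection, extendForm_one_tmul, Fintype.sum_sum_type, h2, adaptedMatrix,
      Matrix.toBlocks₂₁, Matrix.toBlocks₂₂, Matrix.mul_apply, h3, constMatrix_apply, sub_mul, Matrix.one_apply, ite_mul,
      Finset.sum_sub_distrib]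
    ring

theorem SympFrame.IsAdapted.exists_form (h : F.IsAdapted P A) (w : κ ⊕ ρ → ℂ) :
    ∃ φ : ExteriorAlgebra ℂ V →ₗ[ℂ] ℂ, (∀ a ∈ A, φ a = 0) ∧
      w = Sum.elim (fun i => φ (F.lam (Sum.inl i))) (fun j => φ (F.tau (Sum.inr j))) := by
  refine ⟨∑ i, w (Sum.inl i) • F.lamCoord (Sum.inl i) + ∑ l, w (Sum.inr l) •
    (F.tauCoord (Sum.inr l) - ∑ j, P j l • F.lamCoord (Sum.inr j)), ?_, ?_⟩
  · intro a ha
    rw [← LinearMap.mem_ker]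
    refine (?_ : A ≤ _) ha
    rw [h.eq_span]
    refine sup_le (Submodule.span_le.2 ?_) (Submodule.span_le.2 ?_)
    · rintro _ ⟨i, rfl⟩
      simp [F.lamCoord_tau, F.tauCoord_tau]
    · rintro _ ⟨j, rfl⟩
      simp [F.lamCoord_tau, F.tauCoord_tau, F.lamCoord_lam, F.tauCoord_lam]
  · funext c
    rcases c with i | j <;> simp [F.lamCoord_tau, F.tauCoord_tau, F.lamCoord_lam, F.tauCoord_lam]

/-- U collects the coefficients of the chosen sections, hence has polynomial entries. W collects the
values of the forms on the basis of ⋀³V/A, hence is constant; by `SympFrame.IsAdapted.exists_form`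
every W occurs. -/
theorem SympFrame.IsAdapted.degeneracyIdeal_eq (h : F.IsAdapted P A)
    {Q : Matrix (κ ⊕ ρ) (κ ⊕ ρ) ChartRing} {e : Basis (Fin 3 ⊕ Fin 3) ℂ V}
    (hQ : tautTangent e = Submodule.span ChartRing (Set.range (F.graphSection Q))) (k : ℕ) :
    degeneracyIdeal A k e = Ideal.span {d | ∃ (U : Matrix (Fin (11 - k)) (κ ⊕ ρ) ChartRing)
      (W : Matrix (κ ⊕ ρ) (Fin (11 - k)) ℂ),
      d = (U * adaptedMatrix Q P * constMatrix W).det} := by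
  rw [degeneracyIdeal]
  congr 1
  ext d
  constructor
  · rintro ⟨t, φ, ht, hφ, rfl⟩
    rw [hQ] at ht
    choose U hU using fun i => (Submodule.mem_span_range_iff_exists_fun ChartRing).1 (ht i)
    refine ⟨Matrix.of U, Matrix.of fun c j => Sum.elim (fun i => φ j (F.lam (Sum.inl i)))
      (fun l => φ j (F.tau (Sum.inr l))) c, ?_⟩
    congr 1
    refine Matrix.ext fun i j => ?_
    rw [Matrix.mul_assoc, Matrix.mul_apply, Matrix.of_apply, ← hU i, map_sum]
    refine Finset.sum_congr rfl fun a _ => ?_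
    rw [map_smul, h.extendForm_graphSection Q (hφ j), smul_eq_mul, Matrix.mul_apply]
    rfl
  · rintro ⟨U, W, rfl⟩
    choose φ hφ hw using fun j => h.exists_form (fun c => W c j)
    refine ⟨fun i => ∑ a, U i a • F.graphSection Q a, φ, fun i => ?_, hφ, ?_⟩
    · rw [hQ]
      exact sum_mem fun a _ => Submodule.smul_mem _ _ (Submodule.subset_span ⟨a, rfl⟩)
    · congr 1
      refine Matrix.ext fun i j => ?_
      rw [Matrix.mul_assoc, Matrix.mul_apply, Matrix.of_apply, map_sum]
      refine Finset.sum_congr rfl fun a _ => ?_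
      rw [map_smul, h.extendForm_graphSection Q (hφ j), smul_eq_mul, Matrix.mul_apply, ← hw j]
      rfl

end Adapted

end EPW
end

/-! ### Local equations from the Schur complement -/

open scoped TensorProduct
noncomputable section
namespace EPW
open ExteriorAlgebra Module IsLocalRing

variable {V : Type*} [AddCommGroup V] [Module ℂ V]

theorem mul_mul_mul_entry_mem_sq {R κ ρ : Type*} [CommRing R] [Fintype ρ] {I : Ideal R}
    {B : Matrix κ ρ R} {C : Matrix ρ κ R} (hB : ∀ i j, B i j ∈ I) (hC : ∀ i j, C i j ∈ I)
    (G : Matrix ρ ρ R) (i j : κ) : (B * G * C) i j ∈ I ^ 2 := by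
  rw [Matrix.mul_apply, sq]
  refine Ideal.sum_mem _ fun l _ => Ideal.mul_mem_mul ?_ (hC l j)
  rw [Matrix.mul_apply]
  exact Ideal.sum_mem _ fun l _ => Ideal.mul_mem_right _ _ (hB i l)

theorem algebraMap_mem_maximalIdeal {f : ChartRing} (hf : f ∈ originIdeal) :
    algebraMap ChartRing ChartLocalRing f ∈ maximalIdeal ChartLocalRing := by
  rw [← Localization.AtPrime.map_eq_maximalIdeal]
  exact Ideal.mem_map_of_mem _ hf

theorem isUnit_algebraMap_of_constantCoeff {f : ChartRing}
    (hf : MvPolynomial.constantCoeff f ≠ 0) :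
    IsUnit (algebraMap ChartRing ChartLocalRing f) :=
  IsLocalization.map_units ChartLocalRing
    (⟨f, fun h => hf ((mem_originIdeal_iff f).1 h)⟩ : originIdeal.primeCompl)

section Adapted

variable {κ ρ : Type*} [Fintype κ] [Fintype ρ] [DecidableEq κ] [DecidableEq ρ]
  {F : SympFrame V (κ ⊕ ρ)} {P : Matrix ρ ρ ℂ} {A : Submodule ℂ (ExteriorAlgebra ℂ V)}

theorem SympFrame.IsAdapted.det_submatrix_mem (h : F.IsAdapted P A)
    {Q : Matrix (κ ⊕ ρ) (κ ⊕ ρ) ChartRing} {e : Basis (Fin 3 ⊕ Fin 3) ℂ V}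
    (hQ : tautTangent e = Submodule.span ChartRing (Set.range (F.graphSection Q))) {k d : ℕ}
    (hk : 11 - k = d + Fintype.card ρ) (f g : Fin d → κ) :
    ((adaptedMatrix Q P).submatrix (Sum.map f id) (Sum.map g id)).det ∈ degeneracyIdeal A k e := by
  have E : Fin (11 - k) ≃ Fin d ⊕ ρ := Fintype.equivOfCardEq (by simp [hk])
  rw [h.degeneracyIdeal_eq hQ, ← Matrix.det_submatrix_equiv_self E]
  refine Ideal.subset_span ⟨(1 : Matrix (κ ⊕ ρ) (κ ⊕ ρ) ChartRing).submatrix (Sum.map f id ∘ E) id,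
    (1 : Matrix (κ ⊕ ρ) (κ ⊕ ρ) ℂ).submatrix id (Sum.map g id ∘ E), ?_⟩
  congr 1
  have h1 : constMatrix ((1 : Matrix (κ ⊕ ρ) (κ ⊕ ρ) ℂ).submatrix id (Sum.map g id ∘ E)) =
      (1 : Matrix (κ ⊕ ρ) (κ ⊕ ρ) ChartRing).submatrix id (Sum.map g id ∘ E) := by
    refine Matrix.ext fun i j => ?_
    rw [constMatrix_apply, Matrix.submatrix_apply, Matrix.submatrix_apply, Matrix.one_apply,
      Matrix.one_apply]
    split_ifs <;> simp
  rw [h1]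
  refine Matrix.ext fun i j => ?_
  simp [Matrix.mul_apply, Matrix.one_apply]

/-- The block 1 - Q₂₂P is the identity at the origin, so it is invertible in the local ring, and S
is its Schur complement. S differs from Q₁₁ by a product with two factors from Q, hence by an
element of the square of the maximal ideal. Minors of S of size d correspond to minors of size d +
|ρ| of the whole matrix. -/
theorem SympFrame.IsAdapted.exists_local_equations (h : F.IsAdapted P A)
    {Q : Matrix (κ ⊕ ρ) (κ ⊕ ρ) ChartRing} {e : Basis (Fin 3 ⊕ Fin 3) ℂ V}
    (hQ : tautTangent e = Submodule.span ChartRing (Set.range (F.graphSection Q)))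
    (hsymm : Q.IsSymm) (hQ0 : ∀ i j, Q i j ∈ originIdeal) (hcard : Fintype.card κ + Fintype.card ρ = 10) :
    ∃ S : Matrix κ κ ChartLocalRing, S.IsSymm ∧
      (∀ i j, S i j - algebraMap ChartRing ChartLocalRing (Q (Sum.inl i) (Sum.inl j)) ∈
        maximalIdeal ChartLocalRing ^ 2) ∧
      (degeneracyIdeal A (Fintype.card κ) e).map (algebraMap ChartRing ChartLocalRing) =
        Ideal.span (Set.range fun p : κ × κ => S p.1 p.2) ∧
      ∀ k d : ℕ, 11 - k = d + Fintype.card ρ → ∀ f g : Fin d → κ,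
        (S.submatrix f g).det ∈
          (degeneracyIdeal A k e).map (algebraMap ChartRing ChartLocalRing) := by
  set α := algebraMap ChartRing ChartLocalRing with hα
  set A' := Q.toBlocks₁₁.map α
  set B' := Q.toBlocks₁₂.map α with hB'
  set E' := Q.toBlocks₂₂.map α with hE'
  set P' := (constMatrix P).map α with hP'
  have hC' : Q.toBlocks₂₁.map α = B'.transpose := by
    refine Matrix.ext fun i j => ?_
    simp only [hB', Matrix.map_apply, Matrix.transpose_apply, Matrix.toBlocks₂₁, Matrix.toBlocks₁₂,
      Matrix.of_apply]
    rw [hsymm.apply]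
  have hM : (adaptedMatrix Q P).map α = Matrix.fromBlocks A' (-(B' * P')) B'.transpose
      (1 - E' * P') := by
    rw [adaptedMatrix, Matrix.fromBlocks_map, hC']
    congr 1
    · refine Matrix.ext fun i j => ?_
      simp [hB', hP', Matrix.mul_apply]
    · refine Matrix.ext fun i j => ?_
      simp [hE', hP', Matrix.mul_apply, Matrix.one_apply, apply_ite α]
  have hD : IsUnit (1 - E' * P').det := by
    have h1 : (1 - E' * P') = (1 - Q.toBlocks₂₂ * constMatrix P).map α := by
      refine Matrix.ext fun i j => ?_
      simp [hE', hP', Matrix.mul_apply, Matrix.one_apply, apply_ite α]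
    rw [h1]
    have h2 := RingHom.map_det α (1 - Q.toBlocks₂₂ * constMatrix P)
    rw [RingHom.mapMatrix_apply] at h2
    rw [← h2]
    apply isUnit_algebraMap_of_constantCoeff
    rw [RingHom.map_det]
    have h3 : (MvPolynomial.constantCoeff : ChartRing →+* ℂ).mapMatrix
        (1 - Q.toBlocks₂₂ * constMatrix P) = 1 := by
      refine Matrix.ext fun i j => ?_
      have h4 : ∀ i j, MvPolynomial.constantCoeff (Q.toBlocks₂₂ i j) = 0 := fun i j =>
        (mem_originIdeal_iff _).1 (hQ0 _ _)
      simp [Matrix.mul_apply, Matrix.one_apply, apply_ite, h4]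
    rw [h3]
    simp
  letI := Matrix.invertibleOfIsUnitDet _ hD
  set S := A' - -(B' * P') * ⅟(1 - E' * P') * B'.transpose with hS
  have hQα : ∀ i j, α (Q i j) ∈ maximalIdeal ChartLocalRing := fun i j =>
    algebraMap_mem_maximalIdeal (hQ0 i j)
  have hminor : ∀ k d : ℕ, 11 - k = d + Fintype.card ρ → ∀ f g : Fin d → κ,
        (S.submatrix f g).det ∈ (degeneracyIdeal A k e).map α := by
    intro k d hk f g
    have h1 := Ideal.mem_map_of_mem α (h.det_submatrix_mem hQ hk f g)
    rw [RingHom.map_det, RingHom.mapMatrix_apply, ← Matrix.submatrix_map, hM,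
      det_submatrix_schur] at h1
    exact (Ideal.unit_mul_mem_iff_mem _ hD).1 h1
  refine ⟨S, ?_, ?_, ?_, hminor⟩
  · refine isSymm_schur ?_ ?_ ?_
    · refine Matrix.ext fun i j => ?_
      exact congrArg α (hsymm.apply _ _)
    · refine Matrix.ext fun i j => ?_
      exact congrArg α (hsymm.apply _ _)
    · refine Matrix.ext fun i j => ?_
      change α (MvPolynomial.C (P j i)) = α (MvPolynomial.C (P i j))
      rw [h.isSymm.apply]
  · intro i j
    have h1 := mul_mul_mul_entry_mem_sq (B := B') (C := B'.transpose) (fun i j => hQα _ _)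
      (fun i j => hQα _ _) (P' * ⅟(1 - E' * P')) i j
    have h2 : S i j - α (Q (Sum.inl i) (Sum.inl j)) =
        (B' * (P' * ⅟(1 - E' * P')) * B'.transpose) i j := by
      rw [hS, Matrix.sub_apply, Matrix.neg_mul, Matrix.neg_mul, Matrix.neg_apply, Matrix.mul_assoc B']
      change α (Q (Sum.inl i) (Sum.inl j)) - _ - _ = _
      ring
    rw [h2]
    exact h1
  · apply le_antisymm
    · rw [h.degeneracyIdeal_eq hQ, Ideal.map_span, Ideal.span_le]
      rintro _ ⟨_, ⟨U, W, rfl⟩, rfl⟩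
      rw [SetLike.mem_coe, RingHom.map_det, RingHom.mapMatrix_apply, Matrix.map_mul, Matrix.map_mul,
        hM]
      exact det_mul_fromBlocks_mul_mem (I := Ideal.span (Set.range fun p : κ × κ => S p.1 p.2))
        (by simp; omega) _ _ _ _
        (fun i j => Ideal.subset_span ⟨(i, j), rfl⟩) _ _
    · rw [Ideal.span_le]
      rintro _ ⟨⟨i, j⟩, rfl⟩
      have := hminor (Fintype.card κ) 1 (by omega) (fun _ => i) (fun _ => j)
      simpa using this

end Adapted

end EPW
end

/-! ### Linear part of the equations, and decomposable vectors of T_U -/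

open scoped TensorProduct
noncomputable section
namespace EPW
open ExteriorAlgebra Module IsLocalRing

variable {V : Type*} [AddCommGroup V] [Module ℂ V]

/-- The `3 × 3` matrix given by the coordinates of an element of `T_U` modulo `⋀³U`. -/
def tauMatrix : (Option (Fin 3 × Fin 3) → ℂ) →ₗ[ℂ] Mat3 where
  toFun c := Matrix.of fun a l => c (some (a, l))
  map_add' _ _ := rfl
  map_smul' _ _ := rfl

theorem tauMatrix_apply (c : Option (Fin 3 × Fin 3) → ℂ) (a l : Fin 3) :
    tauMatrix c a l = c (some (a, l)) := rfl

theorem sum_stdQ_some {R : Type*} [CommRing R] (u v : Fin 3 → Fin 3 → R)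
    (x : Fin 3 × Fin 3 → R) :
    ∑ p : Fin 3 × Fin 3, ∑ q : Fin 3 × Fin 3, u p.1 p.2 * v q.1 q.2 * stdQ x (some p) (some q) =
      -∑ p : Fin 3 × Fin 3,
        (u (p.1 + 1) (p.2 + 1) * v (p.1 + 2) (p.2 + 2) + u (p.1 + 2) (p.2 + 2) * v (p.1 + 1) (p.2 + 1)
        - u (p.1 + 1) (p.2 + 2) * v (p.1 + 2) (p.2 + 1) - u (p.1 + 2) (p.2 + 1) *
          v (p.1 + 1) (p.2 + 2)) * x p := by
  simp only [Fintype.sum_prod_type, Fin.sum_univ_three, stdQ]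
  simp [leviCivita, fin_three_neg_one, fin_three_neg_two]
  ring

theorem cofEntry_X_mem (p : Fin 3 × Fin 3) :
    cofEntry (MvPolynomial.X : _ → ChartRing) p ∈ originIdeal ^ 2 := by
  rw [cofEntry, sq]
  exact sub_mem (Ideal.mul_mem_mul (X_mem_originIdeal _) (X_mem_originIdeal _))
    (Ideal.mul_mem_mul (X_mem_originIdeal _) (X_mem_originIdeal _))

/-- The linear part of the quadratic form defining `T_U` is given by the mixed cofactors. -/
theorem sum_stdQ_add_mem_sq (c c' : Option (Fin 3 × Fin 3) → ℂ) :
    ∑ i, ∑ j, MvPolynomial.C (c i * c' j) * stdQ (MvPolynomial.X : _ → ChartRing) i j +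
      ∑ p : Fin 3 × Fin 3, MvPolynomial.C (mixedCof (tauMatrix c) (tauMatrix c') p.1 p.2) *
        MvPolynomial.X p ∈ originIdeal ^ 2 := by
  have h0 : ∀ p, stdQ (MvPolynomial.X : _ → ChartRing) none (some p) ∈ originIdeal ^ 2 :=
    cofEntry_X_mem
  have h1 : ∀ p, stdQ (MvPolynomial.X : _ → ChartRing) (some p) none ∈ originIdeal ^ 2 :=
    cofEntry_X_mem
  have h2 : stdQ (MvPolynomial.X : _ → ChartRing) none none ∈ originIdeal ^ 2 :=
    Ideal.mul_mem_left _ _ (Ideal.sum_mem _ fun j _ => Ideal.mul_mem_left _ _ (cofEntry_X_mem _))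
  have h3 := sum_stdQ_some (fun a l => (MvPolynomial.C (c (some (a, l))) : ChartRing))
    (fun a l => MvPolynomial.C (c' (some (a, l)))) MvPolynomial.X
  have h4 : ∑ p : Fin 3 × Fin 3, MvPolynomial.C (mixedCof (tauMatrix c) (tauMatrix c') p.1 p.2) *
        (MvPolynomial.X p : ChartRing) = -∑ p : Fin 3 × Fin 3, ∑ q : Fin 3 × Fin 3,
        MvPolynomial.C (c (some p) * c' (some q)) *
          stdQ (MvPolynomial.X : _ → ChartRing) (some p) (some q) := by
    simp only [map_mul]
    rw [h3, neg_neg]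
    refine Finset.sum_congr rfl fun p _ => ?_
    simp only [mixedCof_apply, tauMatrix_apply, map_add, map_sub, map_mul]
  rw [h4]
  simp only [Fintype.sum_option, Finset.sum_add_distrib]
  rw [add_assoc, add_assoc, add_assoc, add_neg_cancel, add_zero]
  refine add_mem (Ideal.mul_mem_left _ _ h2) (add_mem ?_ ?_)
  · exact Ideal.sum_mem _ fun p _ => Ideal.mul_mem_left _ _ (h1 p)
  · exact Ideal.sum_mem _ fun p _ => Ideal.mul_mem_left _ _ (h0 p)

theorem stdQ_X_mem (i j : Option (Fin 3 × Fin 3)) :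
    stdQ (MvPolynomial.X : _ → ChartRing) i j ∈ originIdeal := by
  rw [mem_originIdeal_iff, ← map_stdQ]
  have : (fun q : Fin 3 × Fin 3 => MvPolynomial.constantCoeff (MvPolynomial.X q : ChartRing)) = 0 := by
    funext q; simp
  rw [this, stdQ_zero]
  rfl

theorem exists_eq_vecMulVec_of_adjugate_eq_zero {M : Mat3} (hM : M.adjugate = 0) :
    ∃ y z : Fin 3 → ℂ, M = Matrix.vecMulVec y z := by
  by_cases h0 : M = 0
  · exact ⟨0, 0, by rw [h0]; simp⟩
  obtain ⟨i, j, hij⟩ : ∃ i j, M i j ≠ 0 := by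
    by_contra! h
    exact h0 (Matrix.ext h)
  have h1 : ∀ b m : Fin 3, M (b + 1) (m + 1) * M (b + 2) (m + 2) =
      M (b + 1) (m + 2) * M (b + 2) (m + 1) := by
    intro b m
    have := congrFun (congrFun ((mixedCof_self_eq_zero_iff M).2 hM) b) m
    rw [mixedCof_apply, Matrix.zero_apply] at this
    linear_combination this / 2
  have h3 : ∀ a b : Fin 3, a = b ∨ a = b + 1 ∨ a = b + 2 := by decide
  have e1 : ∀ i : Fin 3, i + 2 + 1 = i := by decide
  have e2 : ∀ i : Fin 3, i + 2 + 2 = i + 1 := by decide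
  have e3 : ∀ i : Fin 3, i + 1 + 2 = i := by decide
  have e4 : ∀ i : Fin 3, i + 1 + 1 = i + 2 := by decide
  have h2 : ∀ a l, M a l * M i j = M a j * M i l := by
    intro a l
    have r1 := h1 (i + 2) (j + 2)
    have r2 := h1 (i + 2) (j + 1)
    have r3 := h1 (i + 1) (j + 2)
    have r4 := h1 (i + 1) (j + 1)
    simp only [e1, e2, e3, e4] at r1 r2 r3 r4
    rcases h3 a i with rfl | rfl | rfl <;> rcases h3 l j with rfl | rfl | rfl
    · ring
    · ring
    · ring
    · ring
    · linear_combination r1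
    · linear_combination -r2
    · ring
    · linear_combination -r3
    · linear_combination r4
  refine ⟨fun a => M a j / M i j, fun l => M i l, Matrix.ext fun a l => ?_⟩
  rw [Matrix.vecMulVec_apply, div_mul_eq_mul_div, eq_div_iff hij, h2]

theorem ι_anti (x y : V) : ι ℂ x * ι ℂ y = -(ι ℂ y * ι ℂ x) :=
  eq_neg_of_add_eq_zero_left (ι_add_mul_swap x y)

/-- When the matrix is y zᵀ, the vector is a multiple of e₀e₁e₂ plus β ∧ f, with β a bivector in the
3-dimensional space U. Such a β is decomposable, and if it is nonzero then e₀e₁e₂ is β ∧ e_a up to a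
scalar, so the two terms combine. -/
theorem exists_decomposable_of_adjugate_eq_zero (e : Basis (Fin 3 ⊕ Fin 3) ℂ V)
    {c : Option (Fin 3 × Fin 3) → ℂ} (hc : (tauMatrix c).adjugate = 0) :
    ∃ v₁ v₂ v₃ : V, ∑ i, c i • (stdFrame e).tau i = ι ℂ v₁ * ι ℂ v₂ * ι ℂ v₃ := by
  obtain ⟨y, z, hyz⟩ := exists_eq_vecMulVec_of_adjugate_eq_zero hc
  have hc2 : ∀ p : Fin 3 × Fin 3, c (some p) = y p.1 * z p.2 := fun p => by
    rw [← Matrix.vecMulVec_apply, ← hyz]; rfl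
  set E : Fin 3 → V := fun i => e (Sum.inl i) with hE
  set f : V := ∑ l, z l • e (Sum.inr l) with hf
  have hsum : ∑ i, c i • (stdFrame e).tau i = c none • (ι ℂ (E 0) * ι ℂ (E 1) * ι ℂ (E 2)) +
      (∑ a, y a • (ι ℂ (E (a + 1)) * ι ℂ (E (a + 2)))) * ι ℂ f := by
    rw [Fintype.sum_option, Fintype.sum_prod_type, Finset.sum_mul]
    congr 1
    refine Finset.sum_congr rfl fun a _ => ?_
    rw [hf, map_sum, Finset.mul_sum]
    refine Finset.sum_congr rfl fun l _ => ?_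
    rw [hc2, map_smul, smul_mul_smul_comm]
    rfl
  rw [hsum]
  by_cases hy : ∀ a, y a = 0
  · exact ⟨c none • E 0, E 1, E 2, by simp [hy]⟩
  push Not at hy
  obtain ⟨a, ha⟩ := hy
  have hcyc : ι ℂ (E 0) * ι ℂ (E 1) * ι ℂ (E 2) =
      ι ℂ (E (a + 1)) * ι ℂ (E (a + 2)) * ι ℂ (E a) := by
    have h1 : ι ℂ (E 1) * ι ℂ (E 2) * ι ℂ (E 0) = ι ℂ (E 0) * ι ℂ (E 1) * ι ℂ (E 2) := by
      rw [mul_assoc, ι_anti (E 2), mul_neg, ← mul_assoc, ι_anti (E 1), neg_mul, neg_neg]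
    have h2 : ι ℂ (E 2) * ι ℂ (E 0) * ι ℂ (E 1) = ι ℂ (E 0) * ι ℂ (E 1) * ι ℂ (E 2) := by
      rw [ι_anti (E 2), neg_mul, mul_assoc, ι_anti (E 2), mul_neg, neg_neg, ← mul_assoc]
    fin_cases a
    · exact h1.symm
    · exact h2.symm
    · rfl
  have hs : ∑ a, y a • (ι ℂ (E (a + 1)) * ι ℂ (E (a + 2))) =
      y a • (ι ℂ (E (a + 1)) * ι ℂ (E (a + 2))) + y (a + 1) • (ι ℂ (E (a + 2)) * ι ℂ (E a)) +
        y (a + 2) • (ι ℂ (E a) * ι ℂ (E (a + 1))) := by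
    rw [Fin.sum_univ_three]
    fin_cases a
    · rfl
    · change _ = y 1 • (ι ℂ (E 2) * ι ℂ (E 0)) + y 2 • (ι ℂ (E 0) * ι ℂ (E 1)) +
        y 0 • (ι ℂ (E 1) * ι ℂ (E 2))
      rw [add_assoc, add_comm]
      rfl
    · change _ = y 2 • (ι ℂ (E 0) * ι ℂ (E 1)) + y 0 • (ι ℂ (E 1) * ι ℂ (E 2)) +
        y 1 • (ι ℂ (E 2) * ι ℂ (E 0))
      rw [add_comm, ← add_assoc]
      rfl
  rw [hcyc, hs]
  -- The first two vectors factor β using y_a ≠ 0. Since β ∧ e_a = y_a e₀e₁e₂, the term along e₀e₁e₂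
  -- is absorbed by adding (c/y_a) e_a to f.
  refine ⟨E (a + 1) - (y (a + 1) / y a) • E a, y a • E (a + 2) - y (a + 2) • E a,
    (c none / y a) • E a + f, ?_⟩
  have h12 : ι ℂ (E (a + 1) - (y (a + 1) / y a) • E a) * ι ℂ (y a • E (a + 2) - y (a + 2) • E a) =
      y a • (ι ℂ (E (a + 1)) * ι ℂ (E (a + 2))) + y (a + 1) • (ι ℂ (E (a + 2)) * ι ℂ (E a)) +
        y (a + 2) • (ι ℂ (E a) * ι ℂ (E (a + 1))) := by
    simp only [map_sub, map_smul, sub_mul, mul_sub, smul_mul_assoc,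
      mul_smul_comm, ι_sq_zero, smul_zero, sub_zero, smul_sub, smul_smul, ι_anti (E (a + 1)) (E a),
      ι_anti (E (a + 2)) (E a), smul_neg]
    rw [mul_div_cancel₀ _ ha]
    abel
  rw [h12, map_add, mul_add, map_smul, mul_smul_comm]
  congr 1
  simp only [add_mul, smul_mul_assoc, mul_assoc, ι_sq_zero, mul_zero, smul_zero, add_zero]
  rw [← mul_assoc (ι ℂ (E a)), ι_anti (E a) (E (a + 1)), neg_mul, mul_assoc, ι_sq_zero]
  simp only [mul_zero, neg_zero, smul_zero, add_zero, smul_smul]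
  rw [div_mul_cancel₀ _ ha]

/-- A combination with vanishing minors is a decomposable vector of A, hence zero. This includes the
zero matrix, so the projection of A ∩ T_U to matrices is injective as well. -/
theorem NoDecomposable.noRankOne {A : Submodule ℂ (ExteriorAlgebra ℂ V)} (hA : NoDecomposable A)
    (e : Basis (Fin 3 ⊕ Fin 3) ℂ V) {κ ρ : Type*} [Fintype κ] [Fintype ρ] [DecidableEq κ]
    [DecidableEq ρ] {b : Basis (κ ⊕ ρ) ℂ (Option (Fin 3 × Fin 3) → ℂ)} {P : Matrix ρ ρ ℂ}
    (h : ((stdFrame e).changeBasis b).IsAdapted P A) :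
    NoRankOne fun i => tauMatrix (b (Sum.inl i)) := by
  intro c hc
  simp only [← map_smul, ← map_sum] at hc
  obtain ⟨v₁, v₂, v₃, hv⟩ := exists_decomposable_of_adjugate_eq_zero e hc
  set w := ∑ i, c i • b (Sum.inl i) with hw
  have hmem : ∑ i, w i • (stdFrame e).tau i ∈ A := by
    have : ∑ i, w i • (stdFrame e).tau i =
        ∑ i, c i • ((stdFrame e).changeBasis b).tau (Sum.inl i) := by
      simp only [SympFrame.changeBasis, Finset.smul_sum, smul_smul]
      rw [Finset.sum_comm]
      simp [hw, Finset.sum_apply, Finset.sum_smul]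
    rw [this, h.eq_span]
    exact Submodule.mem_sup_left
      (sum_mem fun i _ => Submodule.smul_mem _ _ (Submodule.subset_span ⟨i, rfl⟩))
  have h0 : ∑ i, w i • (stdFrame e).tau i = 0 := by
    rw [hv] at hmem ⊢
    exact hA _ _ _ hmem
  have hw0 : w = 0 := by
    funext i
    exact Fintype.linearIndependent_iff.1 (stdFrame e).linearIndependent_tau w h0 i
  have hli : LinearIndependent ℂ (b ∘ Sum.inl) := b.linearIndependent.comp _ Sum.inl_injective
  funext i
  exact Fintype.linearIndependent_iff.1 hli c (by rw [← hw0, hw]; rfl) i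

end EPW
end

/-! ### Symmetric local equations at a point of corank k -/

open scoped TensorProduct
noncomputable section
namespace EPW
open ExteriorAlgebra Module IsLocalRing

variable {V : Type*} [AddCommGroup V] [Module ℂ V]

/-- A prime that contains the diagonal entries contains the square of every entry, so the maximal
ideal is minimal over the diagonal, and Krull's height theorem applies. -/
theorem ringKrullDim_le_of_sq_eq_mul {R κ : Type*} [CommRing R] [IsLocalRing R] [IsNoetherianRing R]
    [Fintype κ] {S : Matrix κ κ R}
    (hm : maximalIdeal R = Ideal.span (Set.range fun p : κ × κ => S p.1 p.2))
    (hS : ∀ i j, S i j * S i j = S i i * S j j) : ringKrullDim R ≤ Fintype.card κ := by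
  have hmin : maximalIdeal R ∈ (Ideal.span (Set.range fun i => S i i)).minimalPrimes := by
    refine ⟨⟨inferInstance, ?_⟩, ?_⟩
    · rw [hm, Ideal.span_le]
      rintro _ ⟨i, rfl⟩
      exact Ideal.subset_span ⟨(i, i), rfl⟩
    · rintro p ⟨hp, hle⟩ -
      rw [hm, Ideal.span_le]
      rintro _ ⟨⟨i, j⟩, rfl⟩
      have h1 : S i j * S i j ∈ p := by
        rw [hS]
        exact Ideal.mul_mem_right _ _ (hle (Ideal.subset_span ⟨i, rfl⟩))
      exact (hp.mem_or_mem h1).elim id id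
  have hle := Ideal.height_le_card_of_mem_minimalPrimes_span (Set.finite_range _) hmin
  rw [← maximalIdeal_height_eq_ringKrullDim]
  have h2 : (Set.range fun i => S i i).ncard ≤ Fintype.card κ := by
    rw [← Set.image_univ]
    refine (Set.ncard_image_le Set.finite_univ).trans ?_
    rw [Set.ncard_univ, Nat.card_eq_fintype_card]
  have h3 : (maximalIdeal R).height ≤ (Fintype.card κ : ℕ∞) := hle.trans (by exact_mod_cast h2)
  exact_mod_cast h3

/-- Minus the entries of a `3 × 3` matrix. -/
def negEntries : Mat3 ≃ₗ[ℂ] (Fin 3 × Fin 3 → ℂ) :=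
  (LinearEquiv.curry ℂ ℂ (Fin 3) (Fin 3)).symm.trans (LinearEquiv.neg ℂ)

theorem negEntries_apply (M : Mat3) (p : Fin 3 × Fin 3) : negEntries M p = -M p.1 p.2 := rfl

theorem negEntries_smul {R : Type*} [CommRing R] [Algebra ℂ R] (M : Mat3) (p : Fin 3 × Fin 3)
    (z : R) : negEntries M p • z = -(M p.1 p.2 • z) := by
  rw [negEntries_apply, neg_smul]

theorem card_upper_fin {k : ℕ} (hk : k ≤ 3) : Fintype.card (Upper (Fin k)) = k * (k + 1) / 2 := by
  interval_cases k <;> rfl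

theorem isRegularLocalRing_quotient_maximalIdeal (R : Type*) [CommRing R] [IsLocalRing R] :
    IsRegularLocalRing (R ⧸ maximalIdeal R) ∧ ringKrullDim (R ⧸ maximalIdeal R) = 0 := by
  letI := Ideal.Quotient.field (maximalIdeal R)
  exact ⟨inferInstance, ringKrullDim_eq_zero_of_field _⟩

/-- All local information at a point of corank k: the equations S, their linear parts as mixed
cofactors of matrices without rank one combinations, the minors of S that lie in the ideals of the
larger loci, and the vanishing to second order of the ideals for smaller corank. -/
theorem IsLagrangian.exists_local_equations {A : Submodule ℂ (ExteriorAlgebra ℂ V)}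
    (hA : IsLagrangian A) (hA' : NoDecomposable A) {e : Basis (Fin 3 ⊕ Fin 3) ℂ V}
    {U : Submodule ℂ V} (he : IsCentredAt e U) {k : ℕ}
    (hk : finrank ℂ (A ⊓ tangentSubspace U : Submodule ℂ _) = k) :
    ∃ (B : Fin k → Mat3) (S : Matrix (Fin k) (Fin k) ChartLocalRing), NoRankOne B ∧
      S.IsSymm ∧
      (∀ i j, S i j - ∑ p : Fin 3 × Fin 3, negEntries (mixedCof (B i) (B j)) p •
        algebraMap ChartRing ChartLocalRing (MvPolynomial.X p) ∈
        maximalIdeal ChartLocalRing ^ 2) ∧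
      (degeneracyIdeal A k e).map (algebraMap ChartRing ChartLocalRing) =
        Ideal.span (Set.range fun p : Fin k × Fin k => S p.1 p.2) ∧
      (∀ k' d : ℕ, 11 - k' = d + (10 - k) → ∀ f g : Fin d → Fin k,
        (S.submatrix f g).det ∈
          (degeneracyIdeal A k' e).map (algebraMap ChartRing ChartLocalRing)) ∧
      (∀ k', k' < k → degeneracyIdeal A k' e ≤ originIdeal ^ 2) := by
  haveI := hA.finiteDimensional
  have hk10 : k ≤ 10 := by
    rw [← hk, ← hA.finrank_eq]
    exact Submodule.finrank_mono inf_le_left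
  rw [he.tangentSubspace_eq] at hk
  obtain ⟨b, P, h⟩ := (stdFrame e).exists_isAdapted hA hk (m := 10 - k) (by omega) (by decide)
  set Q := conjMatrix b (stdQ (MvPolynomial.X : _ → ChartRing)) with hQdef
  have hQ : tautTangent e = Submodule.span ChartRing
      (Set.range (((stdFrame e).changeBasis b).graphSection Q)) := by
    rw [tautTangent_eq, SympFrame.span_graphSection_changeBasis]
  have hQ0 : ∀ i j, Q i j ∈ originIdeal := by
    intro i j
    rw [hQdef, conjMatrix, Matrix.of_apply]
    exact Ideal.sum_mem _ fun s _ => Ideal.sum_mem _ fun t _ => Ideal.mul_mem_left _ _ (stdQ_X_mem s t)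
  obtain ⟨S, hS, hS2, hI, hd⟩ := h.exists_local_equations hQ
    (conjMatrix_isSymm b (stdQ_isSymm _)) hQ0 (by simp; omega)
  simp only [Fintype.card_fin] at hI hd
  refine ⟨fun i => tauMatrix (b (Sum.inl i)), S, hA'.noRankOne e h, hS, fun i j => ?_, hI, hd, ?_⟩
  · have h1 := Ideal.mem_map_of_mem (algebraMap ChartRing ChartLocalRing)
      (sum_stdQ_add_mem_sq (b (Sum.inl i)) (b (Sum.inl j)))
    rw [Ideal.map_pow, Localization.AtPrime.map_eq_maximalIdeal] at h1
    have h2 := add_mem (hS2 i j) h1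
    convert h2 using 1
    rw [map_add, ← add_assoc]
    change _ = S i j - algebraMap ChartRing ChartLocalRing (Q (Sum.inl i) (Sum.inl j)) +
      algebraMap ChartRing ChartLocalRing (Q (Sum.inl i) (Sum.inl j)) + _
    rw [sub_add_cancel, sub_eq_add_neg, ← Finset.sum_neg_distrib, map_sum]
    congr 1
    refine Finset.sum_congr rfl fun p _ => ?_
    have h3 := negEntries_smul (mixedCof (tauMatrix (b (Sum.inl i))) (tauMatrix (b (Sum.inl j)))) p
      (algebraMap ChartRing ChartLocalRing (MvPolynomial.X p))
    rw [Algebra.smul_def (mixedCof _ _ p.1 p.2)] at h3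
    rw [map_mul, neg_eq_iff_eq_neg]
    exact h3
  · intro k' hk'
    rw [h.degeneracyIdeal_eq hQ, Ideal.span_le]
    rintro _ ⟨U', W, rfl⟩
    -- At the origin the matrix has rank 10 - k, while k' < k gives minors of size 11 - k' ≥ (10 -
    -- k) + 2.
    apply det_mem_sq_of_rank
    have hM : (adaptedMatrix Q P).map MvPolynomial.constantCoeff =
        Matrix.fromBlocks 0 0 0 1 := by
      have h4 : ∀ i j, MvPolynomial.constantCoeff (Q i j) = 0 := fun i j =>
        (mem_originIdeal_iff _).1 (hQ0 _ _)
      refine Matrix.ext fun i j => ?_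
      rcases i with i | i <;> rcases j with j | j <;>
        simp [adaptedMatrix, Matrix.toBlocks₁₁, Matrix.toBlocks₁₂, Matrix.toBlocks₂₁,
          Matrix.toBlocks₂₂, h4, Matrix.mul_apply, Matrix.one_apply, apply_ite]
    have hrk : (Matrix.fromBlocks 0 0 0 1 : Matrix (Fin k ⊕ Fin (10 - k)) (Fin k ⊕ Fin (10 - k)) ℂ).rank
        ≤ 10 - k := by
      have h5 : (Matrix.fromBlocks 0 0 0 1 : Matrix (Fin k ⊕ Fin (10 - k)) (Fin k ⊕ Fin (10 - k)) ℂ) =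
          Matrix.fromRows (0 : Matrix (Fin k) (Fin (10 - k)) ℂ) 1 *
            Matrix.fromCols (0 : Matrix (Fin (10 - k)) (Fin k) ℂ) 1 := by
        rw [Matrix.fromRows_mul_fromCols]
        simp
      rw [h5]
      refine (Matrix.rank_mul_le_right _ _).trans ((Matrix.rank_le_card_height _).trans (by simp))
    rw [Matrix.map_mul, Matrix.map_mul, hM, Fintype.card_fin]
    have h6 := (Matrix.rank_mul_le_left (U'.map MvPolynomial.constantCoeff *
      Matrix.fromBlocks 0 0 0 1) ((constMatrix W).map MvPolynomial.constantCoeff)).trans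
      (Matrix.rank_mul_le_right _ _)
    omega

end EPW
end

/-! ### The local rings at points of each corank -/

open scoped TensorProduct
noncomputable section
namespace EPW
open ExteriorAlgebra Module IsLocalRing

variable {V : Type*} [AddCommGroup V] [Module ℂ V] {A : Submodule ℂ (ExteriorAlgebra ℂ V)}
  {e : Basis (Fin 3 ⊕ Fin 3) ℂ V} {U : Submodule ℂ V}

theorem IsLagrangian.finrank_inf_tangentSubspace_le (hA : IsLagrangian A) (hA' : NoDecomposable A)
    (he : IsCentredAt e U) : finrank ℂ (A ⊓ tangentSubspace U : Submodule ℂ _) ≤ 4 := by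
  obtain ⟨B, S, hB, -⟩ := hA.exists_local_equations hA' he rfl
  simpa using hB.card_le

theorem span_range_upper {R κ : Type*} [CommRing R] [LinearOrder κ] {S : Matrix κ κ R}
    (hS : S.IsSymm) : Ideal.span (Set.range fun p : κ × κ => S p.1 p.2) =
      Ideal.span (Set.range fun p : Upper κ => S p.1.1 p.1.2) := by
  apply le_antisymm
  · rw [Ideal.span_le]
    rintro _ ⟨⟨i, j⟩, rfl⟩
    rcases le_total i j with h | h
    · exact Ideal.subset_span ⟨⟨(i, j), h⟩, rfl⟩
    · refine Ideal.subset_span ⟨⟨(j, i), h⟩, ?_⟩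
      exact hS.apply i j
  · rw [Ideal.span_le]
    rintro _ ⟨p, rfl⟩
    exact Ideal.subset_span ⟨p.1, rfl⟩

theorem isRegularLocalRing_quotient_congr {R : Type*} [CommRing R] {I J : Ideal R} (h : I = J)
    {d : WithBot ℕ∞} (hI : IsRegularLocalRing (R ⧸ I) ∧ ringKrullDim (R ⧸ I) = d) :
    IsRegularLocalRing (R ⧸ J) ∧ ringKrullDim (R ⧸ J) = d := by
  subst h
  exact hI

theorem IsLagrangian.isRegularLocalRing_localRingAt (hA : IsLagrangian A) (hA' : NoDecomposable A)
    (he : IsCentredAt e U) {k : ℕ} (hk3 : k ≤ 3)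
    (hk : finrank ℂ (A ⊓ tangentSubspace U : Submodule ℂ _) = k) :
    IsRegularLocalRing (LocalRingAt A k e) ∧
      ringKrullDim (LocalRingAt A k e) = (9 - k * (k + 1) / 2 : ℕ) := by
  obtain ⟨B, S, hB, hS, hlin, hI, -⟩ := hA.exists_local_equations hA' he hk
  have hc : LinearIndependent ℂ fun p : Upper (Fin k) =>
      negEntries (mixedCof (B p.1.1) (B p.1.2)) :=
    (hB.linearIndependent_mixedCof (by simpa using hk3)).map' negEntries.toLinearMap
      negEntries.ker
  have h := isRegularLocalRing_quotient_span maximalIdeal_chartLocalRing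
    (by rw [ringKrullDim_chartLocalRing]; rfl) hc
    (f := fun p : Upper (Fin k) => S p.1.1 p.1.2) (fun p => hlin p.1.1 p.1.2)
  rw [card_upper_fin hk3] at h
  exact isRegularLocalRing_quotient_congr (hI.trans (span_range_upper hS)).symm h

/-- The linear parts of the entries of S span the cotangent space of the Grassmannian, so by
Nakayama the entries generate the maximal ideal. -/
theorem IsLagrangian.map_degeneracyIdeal_four (hA : IsLagrangian A) (hA' : NoDecomposable A)
    (he : IsCentredAt e U) (hk : finrank ℂ (A ⊓ tangentSubspace U : Submodule ℂ _) = 4) :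
    (degeneracyIdeal A 4 e).map (algebraMap ChartRing ChartLocalRing) =
      maximalIdeal ChartLocalRing := by
  obtain ⟨B, S, hB, hS, hlin, hI, -⟩ := hA.exists_local_equations hA' he hk
  have hc : Submodule.span ℂ (Set.range fun p : Upper (Fin 4) =>
      negEntries (mixedCof (B p.1.1) (B p.1.2))) = ⊤ := by
    have h := congrArg (Submodule.map negEntries.toLinearMap) hB.span_mixedCof
    rw [Submodule.map_span, ← Set.range_comp, Submodule.map_top, LinearEquiv.range] at h
    exact h
  rw [hI]
  apply le_antisymm
  · rw [Ideal.span_le]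
    rintro _ ⟨⟨i, j⟩, rfl⟩
    have h1 := Ideal.pow_le_self two_ne_zero (hlin i j)
    refine (Submodule.sub_mem_iff_left _ ?_).1 h1
    refine Ideal.sum_mem _ fun p _ => ?_
    exact Submodule.smul_of_tower_mem _ _ (algebraMap_mem_maximalIdeal (X_mem_originIdeal p))
  · rw [span_range_upper hS]
    exact maximalIdeal_le_span_of_linearPart maximalIdeal_chartLocalRing hc
      (fun p => hlin p.1.1 p.1.2)

theorem IsLagrangian.isRegularLocalRing_localRingAt_four (hA : IsLagrangian A)
    (hA' : NoDecomposable A) (he : IsCentredAt e U)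
    (hk : finrank ℂ (A ⊓ tangentSubspace U : Submodule ℂ _) = 4) :
    IsRegularLocalRing (LocalRingAt A 4 e) ∧ ringKrullDim (LocalRingAt A 4 e) = 0 := by
  exact isRegularLocalRing_quotient_congr (hA.map_degeneracyIdeal_four hA' he hk).symm
    (isRegularLocalRing_quotient_maximalIdeal _)

theorem IsLagrangian.not_isRegularLocalRing_localRingAt_three (hA : IsLagrangian A)
    (hA' : NoDecomposable A) (he : IsCentredAt e U)
    (hk : finrank ℂ (A ⊓ tangentSubspace U : Submodule ℂ _) = 4) :
    ¬ IsRegularLocalRing (LocalRingAt A 3 e) := by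
  have hm := hA.map_degeneracyIdeal_four hA' he hk
  obtain ⟨B, S, hB, hS, hlin, hI, hd, hsq⟩ := hA.exists_local_equations hA' he hk
  refine not_isRegularLocalRing_quotient ?_ ?_
  · rw [← Localization.AtPrime.map_eq_maximalIdeal, ← Ideal.map_pow]
    exact Ideal.map_mono (hsq 3 (by norm_num))
  · intro h0
    have h1 : ∀ i j, S i j * S i j = S i i * S j j := by
      intro i j
      -- If the ideal of Z^{≥3} were zero, all 2 × 2 minors of the 4 × 4 matrix S would vanish (8 =
      -- 2 + 6). As the entries of S generate the maximal ideal, the dimension 9 would be at most 4.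
      have h2 := hd 3 2 (by norm_num) ![i, j] ![i, j]
      rw [h0, Ideal.mem_bot, Matrix.det_fin_two] at h2
      simp only [Matrix.submatrix_apply, Matrix.cons_val_zero, Matrix.cons_val_one] at h2
      rw [sub_eq_zero.1 h2, hS.apply j i]
    have h2 := ringKrullDim_le_of_sq_eq_mul (hm.symm.trans hI) h1
    rw [ringKrullDim_chartLocalRing, Fintype.card_fin] at h2
    norm_num at h2

end EPW
end

open scoped TensorProduct
noncomputable section
namespace EPW
open ExteriorAlgebra Module IsLocalRing

variable {V : Type*} [AddCommGroup V] [Module ℂ V] {A : Submodule ℂ (ExteriorAlgebra ℂ V)}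

/-! ### Moving the centre of a chart -/

/-- The basis giving the same chart as `e`, but centred at the point with coordinates `x`. -/
def shiftBasis (e : Basis (Fin 3 ⊕ Fin 3) ℂ V) (x : Fin 3 × Fin 3 → ℂ) :
    Basis (Fin 3 ⊕ Fin 3) ℂ V :=
  basisOfTopLeSpanOfCardEqFinrank
    (Sum.elim (fun i => e (Sum.inl i) + ∑ j, x (i, j) • e (Sum.inr j)) (fun j => e (Sum.inr j)))
    (by
      rw [← e.span_eq, Submodule.span_le]
      have hr : ∀ j, e (Sum.inr j) ∈ Submodule.span ℂ (Set.range (Sum.elim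
          (fun i => e (Sum.inl i) + ∑ j, x (i, j) • e (Sum.inr j)) (fun j => e (Sum.inr j)))) :=
        fun j => Submodule.subset_span ⟨Sum.inr j, rfl⟩
      rintro _ ⟨i | j, rfl⟩
      · have h1 : e (Sum.inl i) + ∑ j, x (i, j) • e (Sum.inr j) ∈
            Submodule.span ℂ (Set.range (Sum.elim
              (fun i => e (Sum.inl i) + ∑ j, x (i, j) • e (Sum.inr j)) (fun j => e (Sum.inr j)))) :=
          Submodule.subset_span ⟨Sum.inl i, rfl⟩
        exact (Submodule.add_mem_iff_left _
          (sum_mem fun j _ => Submodule.smul_mem _ _ (hr j))).1 h1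
      · exact hr j)
    (finrank_eq_card_basis e).symm

theorem shiftBasis_inl (e : Basis (Fin 3 ⊕ Fin 3) ℂ V) (x : Fin 3 × Fin 3 → ℂ) (i : Fin 3) :
    shiftBasis e x (Sum.inl i) = e (Sum.inl i) + ∑ j, x (i, j) • e (Sum.inr j) := by
  simp [shiftBasis]

theorem shiftBasis_inr (e : Basis (Fin 3 ⊕ Fin 3) ℂ V) (x : Fin 3 × Fin 3 → ℂ) (j : Fin 3) :
    shiftBasis e x (Sum.inr j) = e (Sum.inr j) := by
  simp [shiftBasis]

theorem shiftBasis_neg (e : Basis (Fin 3 ⊕ Fin 3) ℂ V) (x : Fin 3 × Fin 3 → ℂ) :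
    shiftBasis (shiftBasis e x) (-x) = e := by
  apply Basis.eq_of_apply_eq
  rintro (i | j)
  · simp [shiftBasis_inl, shiftBasis_inr]
  · simp [shiftBasis_inr]

theorem isCentredAt_shiftBasis (e : Basis (Fin 3 ⊕ Fin 3) ℂ V) (x : Fin 3 × Fin 3 → ℂ) :
    IsCentredAt (shiftBasis e x) (graphSubspace e x) := by
  simp only [IsCentredAt, graphSubspace, shiftBasis_inl]

theorem finrank_graphSubspace (e : Basis (Fin 3 ⊕ Fin 3) ℂ V) (x : Fin 3 × Fin 3 → ℂ) :
    finrank ℂ (graphSubspace e x) = 3 := by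
  rw [← isCentredAt_shiftBasis e x]
  exact finrank_span_eq_card ((shiftBasis e x).linearIndependent.comp _ Sum.inl_injective)

/-- Some three vectors of the basis e span a complement of U; a permutation makes them the vectors
`inr`. Thus finitely many charts cover the Grassmannian. -/
theorem exists_eq_graphSubspace (e : Basis (Fin 3 ⊕ Fin 3) ℂ V) {U : Submodule ℂ V}
    (hU : finrank ℂ U = 3) :
    ∃ (σ : Equiv.Perm (Fin 3 ⊕ Fin 3)) (x : Fin 3 × Fin 3 → ℂ),
      U = graphSubspace (e.reindex σ) x := by
  classical
  haveI : FiniteDimensional ℂ V := Module.Finite.of_basis e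
  obtain ⟨s, hs, hcard⟩ := exists_basis_subfamily_quotient e U
  rw [hU] at hcard
  have hs3 : s.card = 3 := by simpa using hcard
  obtain ⟨σ, hσ⟩ : ∃ σ : Equiv.Perm (Fin 3 ⊕ Fin 3), ∀ a, a ∈ s ↔ ∃ j, σ a = Sum.inr j := by
    have E1 : {a // a ∈ s} ≃ {a : Fin 3 ⊕ Fin 3 // ∃ j, a = Sum.inr j} :=
      Fintype.equivOfCardEq (by rw [Fintype.card_coe, hs3]; decide)
    refine ⟨E1.extendSubtype, fun a => ⟨fun ha => ?_, fun ha => ?_⟩⟩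
    · exact E1.extendSubtype_mem a ha
    · by_contra hn
      exact E1.extendSubtype_not_mem a hn ha
  have htop : ∀ i, ∃ c : Fin 3 → ℂ, (e.reindex σ) (Sum.inl i) +
      ∑ j, c j • (e.reindex σ) (Sum.inr j) ∈ U := by
    intro i
    have h1 : (e.reindex σ) (Sum.inl i) ∈ U ⊔ Submodule.span ℂ (e '' s) := by rw [hs]; trivial
    obtain ⟨u, hu, w, hw, huw⟩ := Submodule.mem_sup.1 h1
    have h2 : e '' s ⊆ Set.range fun j => (e.reindex σ) (Sum.inr j) := by
      rintro _ ⟨a, ha, rfl⟩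
      obtain ⟨j, hj⟩ := (hσ a).1 ha
      exact ⟨j, by simp [← hj]⟩
    obtain ⟨c, rfl⟩ := (Submodule.mem_span_range_iff_exists_fun ℂ).1 (Submodule.span_mono h2 hw)
    refine ⟨-c, ?_⟩
    rw [← huw]
    simpa using hu
  choose c hc using htop
  refine ⟨σ, fun p => c p.1 p.2, (Submodule.eq_of_le_of_finrank_eq ?_ ?_).symm⟩
  · rw [graphSubspace, Submodule.span_le]
    rintro _ ⟨i, rfl⟩
    exact hc i
  · rw [finrank_graphSubspace, hU]

theorem exists_isCentredAt (e : Basis (Fin 3 ⊕ Fin 3) ℂ V) {U : Submodule ℂ V}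
    (hU : finrank ℂ U = 3) : ∃ e', IsCentredAt e' U := by
  obtain ⟨σ, x, rfl⟩ := exists_eq_graphSubspace e hU
  exact ⟨_, isCentredAt_shiftBasis _ _⟩

/-- The translation of the chart by `x`. -/
def chartTranslation (x : Fin 3 × Fin 3 → ℂ) : ChartRing →ₐ[ℂ] ChartRing :=
  MvPolynomial.aeval fun p => MvPolynomial.X p + MvPolynomial.C (x p)

theorem chartTranslation_X (x : Fin 3 × Fin 3 → ℂ) (p : Fin 3 × Fin 3) :
    chartTranslation x (MvPolynomial.X p) = MvPolynomial.X p + MvPolynomial.C (x p) := by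
  simp [chartTranslation]

theorem chartTranslation_neg (x : Fin 3 × Fin 3 → ℂ) (f : ChartRing) :
    chartTranslation (-x) (chartTranslation x f) = f := by
  have : (chartTranslation (-x)).comp (chartTranslation x) = AlgHom.id ℂ ChartRing := by
    ext p
    simp [chartTranslation]
  exact DFunLike.congr_fun this f

theorem constantCoeff_chartTranslation (x : Fin 3 × Fin 3 → ℂ) (f : ChartRing) :
    MvPolynomial.constantCoeff (chartTranslation x f) = MvPolynomial.eval x f := by
  induction f using MvPolynomial.induction_on with
  | C a => simp [chartTranslation]
  | add f g hf hg => simp [hf, hg]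
  | mul_X f p hf => simp [hf, chartTranslation_X]

/-- Substituting X + x for X carries the tautological vectors of e to those of the shifted basis,
and therefore sections to sections and minors to minors. -/
theorem chartTranslation_mem_degeneracyIdeal {e : Basis (Fin 3 ⊕ Fin 3) ℂ V}
    (x : Fin 3 × Fin 3 → ℂ) {k : ℕ} {f : ChartRing} (hf : f ∈ degeneracyIdeal A k e) :
    chartTranslation x f ∈ degeneracyIdeal A k (shiftBasis e x) := by
  set T : ChartRing ⊗[ℂ] ExteriorAlgebra ℂ V →ₐ[ℂ] ChartRing ⊗[ℂ] ExteriorAlgebra ℂ V :=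
    Algebra.TensorProduct.map (chartTranslation x) (AlgHom.id ℂ _) with hT
  have hTsmul : ∀ (r : ChartRing) z, T (r • z) = chartTranslation x r • T z := by
    intro r z
    induction z using TensorProduct.induction_on with
    | zero => simp
    | add y z hy hz => simp only [smul_add, map_add, hy, hz]
    | tmul s a => simp [hT, TensorProduct.smul_tmul']
  have hTv : ∀ i, T (tautVector e i) = tautVector (shiftBasis e x) i := by
    intro i
    simp only [tautVector, shiftBasis_inl, shiftBasis_inr, map_add, map_sum, hT,
      Algebra.TensorProduct.map_tmul, map_one, AlgHom.id_apply, chartTranslation_X,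
      TensorProduct.add_tmul, TensorProduct.tmul_add, TensorProduct.tmul_sum,
      Finset.sum_add_distrib]
    rw [add_assoc, add_comm (∑ j, MvPolynomial.X (i, j) ⊗ₜ[ℂ] (ι ℂ) (e (Sum.inr j)))]
    congr 2
    refine Finset.sum_congr rfl fun j _ => ?_
    rw [map_smul, TensorProduct.tmul_smul, TensorProduct.smul_tmul', MvPolynomial.smul_eq_C_mul,
      mul_one]
  have hTt : ∀ z ∈ tautTangent e, T z ∈ tautTangent (shiftBasis e x) := by
    intro z hz
    induction hz using Submodule.span_induction with
    | mem z hz =>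
      obtain ⟨i, j, v, rfl⟩ := hz
      refine Submodule.subset_span ⟨i, j, v, ?_⟩
      rw [map_mul, map_mul, hTv, hTv]
      simp [hT]
    | zero => rw [map_zero]; exact zero_mem _
    | add y z _ _ hy hz => rw [map_add]; exact add_mem hy hz
    | smul r z _ hz => rw [hTsmul]; exact Submodule.smul_mem _ _ hz
  have hTφ : ∀ (φ : ExteriorAlgebra ℂ V →ₗ[ℂ] ℂ) z,
      extendForm φ (T z) = chartTranslation x (extendForm φ z) := by
    intro φ z
    induction z using TensorProduct.induction_on with
    | zero => simp
    | add y z hy hz => simp only [map_add, hy, hz]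
    | tmul r a => simp [hT, extendForm]
  have hle : degeneracyIdeal A k e ≤
      (degeneracyIdeal A k (shiftBasis e x)).comap (chartTranslation x) := by
    rw [degeneracyIdeal, Ideal.span_le]
    rintro _ ⟨t, φ, ht, hφ, rfl⟩
    refine Ideal.subset_span ⟨fun i => T (t i), φ, fun i => hTt _ (ht i), hφ, ?_⟩
    rw [AlgHom.map_det]
    congr 1
    refine Matrix.ext fun i j => ?_
    exact (hTφ _ _).symm
  exact hle hf

theorem eq_originIdeal_of_le {q I : Ideal ChartRing} [hq : q.IsPrime]
    (hI : I.map (algebraMap ChartRing ChartLocalRing) = maximalIdeal ChartLocalRing)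
    (hIq : I ≤ q) (hqo : q ≤ originIdeal) : originIdeal ≤ q := by
  have hdisj : Disjoint (originIdeal.primeCompl : Set ChartRing) (q : Set ChartRing) := by
    rw [Set.disjoint_left]
    exact fun f hf hf' => hf (hqo hf')
  rw [← IsLocalization.comap_map_of_isPrime_disjoint originIdeal.primeCompl ChartLocalRing hq hdisj]
  rw [← Ideal.map_le_iff_le_comap, Localization.AtPrime.map_eq_maximalIdeal, ← hI]
  exact Ideal.map_mono hIq

/-- After translation to the origin, the ideal of Z^{≥4} generates the maximal ideal of the local
ring, so no smaller prime contains it: the point is an isolated component. -/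
theorem IsLagrangian.ker_eval_mem_minimalPrimes (hA : IsLagrangian A) (hA' : NoDecomposable A)
    (e : Basis (Fin 3 ⊕ Fin 3) ℂ V) {x : Fin 3 × Fin 3 → ℂ}
    (hx : finrank ℂ (A ⊓ tangentSubspace (graphSubspace e x) : Submodule ℂ _) = 4) :
    RingHom.ker (MvPolynomial.eval x : ChartRing →+* ℂ) ∈ (degeneracyIdeal A 4 e).minimalPrimes := by
  have hmap := hA.map_degeneracyIdeal_four hA' (isCentredAt_shiftBasis e x) hx
  have hle : degeneracyIdeal A 4 (shiftBasis e x) ≤ originIdeal := by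
    rw [← IsLocalization.AtPrime.comap_maximalIdeal ChartLocalRing originIdeal, ← hmap]
    exact Ideal.le_comap_map
  have hker : ∀ f : ChartRing, f ∈ RingHom.ker (MvPolynomial.eval x : ChartRing →+* ℂ) ↔
      chartTranslation x f ∈ originIdeal := by
    intro f
    rw [RingHom.mem_ker, mem_originIdeal_iff, constantCoeff_chartTranslation]
  refine ⟨⟨RingHom.ker_isPrime _, fun f hf => ?_⟩, ?_⟩
  · exact (hker f).2 (hle (chartTranslation_mem_degeneracyIdeal x hf))
  · rintro q ⟨hq, hIq⟩ hqx f hf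
    haveI : (q.comap (chartTranslation (-x))).IsPrime := Ideal.IsPrime.comap _
    have h1 := eq_originIdeal_of_le (q := q.comap (chartTranslation (-x))) hmap
      (fun g hg => hIq (by
        have := chartTranslation_mem_degeneracyIdeal (-x) hg
        rwa [shiftBasis_neg] at this))
      (fun g hg => by
        have := (hker _).1 (hqx hg)
        have h2 := chartTranslation_neg (-x) g
        rw [neg_neg] at h2
        rwa [h2] at this)
    have h2 := h1 ((hker f).1 hf)
    rw [Ideal.mem_comap, chartTranslation_neg] at h2
    exact h2

/-- Each of the finitely many charts contains only finitely many such points, since their ideals are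
distinct minimal primes over one ideal of a Noetherian ring. -/
theorem IsLagrangian.finite_locusGE_four (hA : IsLagrangian A) (hA' : NoDecomposable A)
    (e : Basis (Fin 3 ⊕ Fin 3) ℂ V) : (locusGE A 4).Finite := by
  have hfin : ∀ σ : Equiv.Perm (Fin 3 ⊕ Fin 3), {x : Fin 3 × Fin 3 → ℂ | finrank ℂ
      (A ⊓ tangentSubspace (graphSubspace (e.reindex σ) x) : Submodule ℂ _) = 4}.Finite := by
    intro σ
    refine Set.Finite.of_finite_image (f := fun x => RingHom.ker (MvPolynomial.eval x :
      ChartRing →+* ℂ)) ((Ideal.finite_minimalPrimes_of_isNoetherianRing ChartRing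
        (degeneracyIdeal A 4 (e.reindex σ))).subset ?_) ?_
    · rintro _ ⟨x, hx, rfl⟩
      exact hA.ker_eval_mem_minimalPrimes hA' _ hx
    · intro x _ y _ hxy
      funext p
      have h1 : (MvPolynomial.X p - MvPolynomial.C (x p) : ChartRing) ∈
          RingHom.ker (MvPolynomial.eval y : ChartRing →+* ℂ) := by
        rw [← show _ = RingHom.ker (MvPolynomial.eval y : ChartRing →+* ℂ) from hxy,
          RingHom.mem_ker]
        simp
      rw [RingHom.mem_ker] at h1
      simp only [map_sub, MvPolynomial.eval_X, MvPolynomial.eval_C] at h1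
      exact (sub_eq_zero.1 h1).symm
  refine (Set.finite_iUnion fun σ => (hfin σ).image (graphSubspace (e.reindex σ))).subset ?_
  rintro U ⟨hU3, hU4⟩
  obtain ⟨e', he'⟩ := exists_isCentredAt e hU3
  have h4 := le_antisymm (hA.finrank_inf_tangentSubspace_le hA' he') hU4
  obtain ⟨σ, x, rfl⟩ := exists_eq_graphSubspace e hU3
  exact Set.mem_iUnion.2 ⟨σ, x, h4, rfl⟩

end EPW
end

open scoped TensorProduct
noncomputable section
namespace EPW
open ExteriorAlgebra Module

variable {V : Type*} [AddCommGroup V] [Module ℂ V]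

/-! ### Affine curves in the Lagrangian Grassmannian -/

theorem isLagrangian_span {ι : Type*} [Fintype ι] (hι : Fintype.card ι = 10)
    {a : ι → ExteriorAlgebra ℂ V} (hmem : ∀ i, a i ∈ ⋀[ℂ]^3 V) (hli : LinearIndependent ℂ a)
    (hmul : ∀ i j, a i * a j = 0) : IsLagrangian (Submodule.span ℂ (Set.range a)) where
  le_exteriorPower := by
    rw [Submodule.span_le]
    rintro _ ⟨i, rfl⟩
    exact hmem i
  finrank_eq := by rw [finrank_span_eq_card hli, hι]
  wedge_eq_zero := by
    intro x hx y hy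
    obtain ⟨c, rfl⟩ := (Submodule.mem_span_range_iff_exists_fun ℂ).1 hx
    obtain ⟨d, rfl⟩ := (Submodule.mem_span_range_iff_exists_fun ℂ).1 hy
    simp [Finset.sum_mul_sum, hmul]

theorem IsLagrangian.linearIndependent {A : Submodule ℂ (ExteriorAlgebra ℂ V)}
    (hA : IsLagrangian A) {ι : Type*} [Fintype ι] (hι : Fintype.card ι = 10)
    {a : ι → ExteriorAlgebra ℂ V} (ha : Submodule.span ℂ (Set.range a) = A) :
    LinearIndependent ℂ a := by
  rw [linearIndependent_iff_card_eq_finrank_span, Set.finrank, ha, hA.finrank_eq, hι]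

theorem finite_setOf_notMem_zariskiBasicOpen {ι : Type*} [Fintype ι] (hι : Fintype.card ι = 10)
    {γ : ℂ → LagrangianGrassmannian V} {a b : ι → ExteriorAlgebra ℂ V}
    (hγ : ∀ t, (γ t).1 = Submodule.span ℂ (Set.range fun i => a i + t • b i))
    (P : MvPolynomial (Fin 10 × (ExteriorAlgebra ℂ V →ₗ[ℂ] ℂ)) ℂ) {t₀ : ℂ}
    (h : γ t₀ ∈ zariskiBasicOpen P) : {t | γ t ∉ zariskiBasicOpen P}.Finite := by
  classical
  obtain ⟨c, hc, hP⟩ := h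
  have hmem : ∀ i, c i ∈ Submodule.span ℂ (Set.range fun i => a i + t₀ • b i) := by
    intro i
    rw [← hγ, ← hc]
    exact Submodule.subset_span ⟨i, rfl⟩
  choose g hg using fun i => (Submodule.mem_span_range_iff_exists_fun ℂ).1 (hmem i)
  have hmem' : ∀ i, a i + t₀ • b i ∈ Submodule.span ℂ (Set.range c) := by
    intro i
    rw [hc, hγ]
    exact Submodule.subset_span ⟨i, rfl⟩
  choose f hf using fun i => (Submodule.mem_span_range_iff_exists_fun ℂ).1 (hmem' i)
  have hli := (γ t₀).2.linearIndependent hι (hγ t₀).symm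
  have hfg : ∀ i j, ∑ k, f i k * g k j = if i = j then 1 else 0 := by
    intro i j
    have h1 : ∑ l, (∑ k, f i k * g k l) • (a l + t₀ • b l) =
        ∑ l, (if i = l then (1 : ℂ) else 0) • (a l + t₀ • b l) := by
      simp only [ite_smul, one_smul, zero_smul, Finset.sum_ite_eq, Finset.mem_univ, if_true]
      conv_rhs => rw [← hf i]
      simp only [← hg, Finset.smul_sum, Finset.sum_smul, smul_smul]
      rw [Finset.sum_comm]
    have h2 := Fintype.linearIndependent_iff.1 hli
      (fun l => (∑ k, f i k * g k l) - if i = l then (1 : ℂ) else 0)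
      (by simp only [sub_smul, Finset.sum_sub_distrib, h1, sub_self]) j
    exact sub_eq_zero.1 h2
  -- the same combinations form a basis of each member of the family
  have hspan : ∀ t, Submodule.span ℂ (Set.range fun i => ∑ l, g i l • (a l + t • b l)) =
      (γ t).1 := by
    intro t
    rw [hγ]
    apply le_antisymm
    · rw [Submodule.span_le]
      rintro _ ⟨i, rfl⟩
      exact sum_mem fun l _ => Submodule.smul_mem _ _ (Submodule.subset_span ⟨l, rfl⟩)
    · rw [Submodule.span_le]
      rintro _ ⟨i, rfl⟩
      have h1 : a i + t • b i = ∑ k, f i k • ∑ l, g k l • (a l + t • b l) := by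
        simp only [Finset.smul_sum, smul_smul]
        rw [Finset.sum_comm]
        simp only [← Finset.sum_smul, hfg, ite_smul, one_smul, zero_smul, Finset.sum_ite_eq,
          Finset.mem_univ, if_true]
      change a i + t • b i ∈ _
      rw [h1]
      exact sum_mem fun k _ => Submodule.smul_mem _ _ (Submodule.subset_span ⟨k, rfl⟩)
  -- The change of basis g taken at t₀ is used for all t, so P becomes a polynomial in t alone. It
  -- is nonzero at t₀, hence has finitely many roots.
  set p : Polynomial ℂ := MvPolynomial.aeval (fun q : Fin 10 × (ExteriorAlgebra ℂ V →ₗ[ℂ] ℂ) =>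
    Polynomial.C (q.2 (∑ l, g q.1 l • a l)) +
      Polynomial.X * Polynomial.C (q.2 (∑ l, g q.1 l • b l))) P with hp
  have hpt : ∀ t, p.eval t = MvPolynomial.eval (fun q : Fin 10 × (ExteriorAlgebra ℂ V →ₗ[ℂ] ℂ) =>
      q.2 (∑ l, g q.1 l • (a l + t • b l))) P := by
    intro t
    rw [← Polynomial.coe_aeval_eq_eval, hp]
    change (Polynomial.aeval t) (MvPolynomial.aeval _ P) = _
    rw [← AlgHom.comp_apply, MvPolynomial.comp_aeval]
    change MvPolynomial.aeval _ P = MvPolynomial.aeval _ P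
    congr 2
    funext q
    simp only [map_add, map_mul, Polynomial.aeval_C, Polynomial.aeval_X, Algebra.algebraMap_self,
      RingHom.id_apply, smul_add, Finset.sum_add_distrib, map_sum, map_smul, smul_eq_mul,
      Finset.mul_sum]
    congr 1
    exact Finset.sum_congr rfl fun l _ => by ring
  have hp0 : p ≠ 0 := by
    intro h0
    apply hP
    have h1 := hpt t₀
    rw [h0, Polynomial.eval_zero] at h1
    simp only [hg] at h1
    exact h1.symm
  refine (p.rootSet_finite ℂ).subset fun t ht => ?_
  rw [Polynomial.mem_rootSet]
  refine ⟨hp0, ?_⟩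
  by_contra hne
  refine ht ⟨_, hspan t, ?_⟩
  rw [← hpt]
  simpa using hne

theorem finite_setOf_notMem_of_isOpen {ι : Type*} [Fintype ι] (hι : Fintype.card ι = 10)
    {γ : ℂ → LagrangianGrassmannian V} {a b : ι → ExteriorAlgebra ℂ V}
    (hγ : ∀ t, (γ t).1 = Submodule.span ℂ (Set.range fun i => a i + t • b i))
    {W : Set (LagrangianGrassmannian V)} (hW : IsOpen W) {t₀ : ℂ} (h : γ t₀ ∈ W) :
    {t | γ t ∉ W}.Finite := by
  induction hW generalizing t₀ with
  | basic s hs =>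
    obtain ⟨P, rfl⟩ := hs
    exact finite_setOf_notMem_zariskiBasicOpen hι hγ P h
  | univ => simp
  | inter s t _ _ hs ht =>
    refine ((hs h.1).union (ht h.2)).subset fun t ht => ?_
    by_contra hcon
    simp only [Set.mem_union, Set.mem_setOf_eq, not_or, not_not] at hcon
    exact ht hcon
  | sUnion S _ hS =>
    obtain ⟨s, hs, hts⟩ := h
    exact (hS s hs hts).subset fun t ht hts' => ht ⟨s, hs, hts'⟩

theorem mem_closure_of_affine_curve {ι : Type*} [Fintype ι] (hι : Fintype.card ι = 10)
    {γ : ℂ → LagrangianGrassmannian V} {a b : ι → ExteriorAlgebra ℂ V}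
    (hγ : ∀ t, (γ t).1 = Submodule.span ℂ (Set.range fun i => a i + t • b i))
    {S : Set (LagrangianGrassmannian V)} (hS : {t | γ t ∉ S}.Finite) (t₀ : ℂ) : γ t₀ ∈ closure S := by
  rw [mem_closure_iff]
  intro W hW h0
  obtain ⟨t, ht⟩ := ((finite_setOf_notMem_of_isOpen hι hγ hW h0).union hS).infinite_compl.nonempty
  simp only [Set.mem_compl_iff, Set.mem_union, Set.mem_setOf_eq, not_or, not_not] at ht
  exact ⟨γ t, ht⟩

end EPW
end

/-! ### Lagrangian subspaces as graphs of symmetric matrices -/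

open scoped TensorProduct
noncomputable section
namespace EPW
open ExteriorAlgebra Module

variable {V : Type*} [AddCommGroup V] [Module ℂ V]

namespace SympFrame

variable {κ : Type*} [Fintype κ] [DecidableEq κ] (F : SympFrame V κ)

/-- The vectors `τ_i + ∑ q_{ij} λ_j`. -/
def graphFamily (q : Matrix κ κ ℂ) (i : κ) : ExteriorAlgebra ℂ V :=
  F.tau i + ∑ j, q i j • F.lam j

theorem graphFamily_mem (q : Matrix κ κ ℂ) (i : κ) : F.graphFamily q i ∈ ⋀[ℂ]^3 V :=
  add_mem (F.tau_mem i) (sum_mem fun j _ => Submodule.smul_mem _ _ (F.lam_mem j))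

theorem sum_smul_graphFamily (q : Matrix κ κ ℂ) (c : κ → ℂ) :
    ∑ i, c i • F.graphFamily q i = ∑ i, c i • F.tau i + ∑ j, (∑ i, c i * q i j) • F.lam j := by
  simp only [graphFamily, smul_add, Finset.sum_add_distrib, Finset.smul_sum, smul_smul,
    Finset.sum_smul]
  rw [Finset.sum_comm (γ := κ)]

theorem linearIndependent_graphFamily (q : Matrix κ κ ℂ) :
    LinearIndependent ℂ (F.graphFamily q) := by
  rw [Fintype.linearIndependent_iff]
  intro c hc i
  rw [sum_smul_graphFamily] at hc
  have := F.tauCoord_sum i c (fun j => ∑ i, c i * q i j)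
  rw [hc, map_zero] at this
  exact this.symm

theorem graphFamily_mul (q : Matrix κ κ ℂ) (i j : κ) :
    F.graphFamily q i * F.graphFamily q j = (q j i - q i j) • F.vol := by
  have h := F.mul_eq (Pi.single i 1) (q i) (Pi.single j 1) (q j)
  simpa [Pi.single_apply, graphFamily, Finset.sum_sub_distrib] using h

theorem isLagrangian_span_graphFamily (hκ : Fintype.card κ = 10) {q : Matrix κ κ ℂ}
    (hq : q.IsSymm) : IsLagrangian (Submodule.span ℂ (Set.range (F.graphFamily q))) :=
  isLagrangian_span hκ (F.graphFamily_mem q) (F.linearIndependent_graphFamily q) fun i j => by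
    rw [graphFamily_mul, hq.apply, sub_self, zero_smul]

theorem exists_eq_span_graphFamily (hκ : Fintype.card κ = 10)
    {A : Submodule ℂ (ExteriorAlgebra ℂ V)} (hA : IsLagrangian A)
    (h : A ⊓ Submodule.span ℂ (Set.range F.lam) = ⊥) :
    ∃ q : Matrix κ κ ℂ, q.IsSymm ∧ A = Submodule.span ℂ (Set.range (F.graphFamily q)) := by
  haveI := hA.finiteDimensional
  set T : A →ₗ[ℂ] (κ → ℂ) := (LinearMap.pi fun i => F.tauCoord i) ∘ₗ A.subtype with hT
  have hTinj : Function.Injective T := by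
    rw [injective_iff_map_eq_zero]
    rintro ⟨z, hz⟩ h0
    have h1 := F.eq_sum (hA.le_exteriorPower hz)
    have h2 : ∀ i, F.tauCoord i z = 0 := fun i => congrFun h0 i
    simp only [h2, zero_smul, Finset.sum_const_zero, zero_add] at h1
    have h3 : z ∈ A ⊓ Submodule.span ℂ (Set.range F.lam) := by
      refine ⟨hz, ?_⟩
      rw [h1]
      exact sum_mem fun i _ => Submodule.smul_mem _ _ (Submodule.subset_span ⟨i, rfl⟩)
    rw [h, Submodule.mem_bot] at h3
    exact Subtype.ext h3
  have hTsurj : Function.Surjective T :=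
    (LinearMap.injective_iff_surjective_of_finrank_eq_finrank (by
      rw [hA.finrank_eq, Module.finrank_fintype_fun_eq_card, hκ])).1 hTinj
  choose a ha using fun i : κ => hTsurj (Pi.single i 1)
  set q : Matrix κ κ ℂ := Matrix.of fun i j => F.lamCoord j (a i : ExteriorAlgebra ℂ V) with hq
  have hag : ∀ i, (a i : ExteriorAlgebra ℂ V) = F.graphFamily q i := by
    intro i
    have h1 := F.eq_sum (hA.le_exteriorPower (a i).2)
    have h2 : ∀ j, F.tauCoord j (a i : ExteriorAlgebra ℂ V) = (Pi.single i 1 : κ → ℂ) j :=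
      fun j => congrFun (ha i) j
    simp only [h2, Pi.single_apply, ite_smul, one_smul, zero_smul, Finset.sum_ite_eq',
      Finset.mem_univ, if_true] at h1
    exact h1
  refine ⟨q, ?_, ?_⟩
  · refine Matrix.ext fun i j => ?_
    have h1 := hA.wedge_eq_zero _ (a i).2 _ (a j).2
    rw [hag, hag, graphFamily_mul] at h1
    exact sub_eq_zero.1 ((smul_eq_zero.1 h1).resolve_right F.vol_ne_zero)
  · symm
    apply Submodule.eq_of_le_of_finrank_eq
    · rw [Submodule.span_le]
      rintro _ ⟨i, rfl⟩
      rw [← hag]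
      exact (a i).2
    · rw [finrank_span_eq_card (F.linearIndependent_graphFamily q), hκ, hA.finrank_eq]

theorem finrank_inf_span_graphFamily_le (q q' : Matrix κ κ ℂ) :
    finrank ℂ (Submodule.span ℂ (Set.range (F.graphFamily q)) ⊓
      Submodule.span ℂ (Set.range (F.graphFamily q')) : Submodule ℂ (ExteriorAlgebra ℂ V)) ≤
      finrank ℂ (LinearMap.ker (q - q').vecMulLinear) := by
  set W := (Submodule.span ℂ (Set.range (F.graphFamily q)) ⊓
      Submodule.span ℂ (Set.range (F.graphFamily q')) : Submodule ℂ (ExteriorAlgebra ℂ V)) with hW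
  have hz : ∀ z ∈ W, ∃ c : κ → ℂ, z = ∑ i, c i • F.graphFamily q i ∧
      Matrix.vecMul c (q - q') = 0 := by
    rintro z ⟨h1, h2⟩
    obtain ⟨c, rfl⟩ := (Submodule.mem_span_range_iff_exists_fun ℂ).1 h1
    obtain ⟨c', hc'⟩ := (Submodule.mem_span_range_iff_exists_fun ℂ).1 h2
    have hcc : c' = c := by
      funext i
      have := congrArg (F.tauCoord i) hc'
      rwa [sum_smul_graphFamily, sum_smul_graphFamily, tauCoord_sum, tauCoord_sum] at this
    refine ⟨c, rfl, ?_⟩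
    funext j
    have := congrArg (F.lamCoord j) hc'
    rw [sum_smul_graphFamily, sum_smul_graphFamily, lamCoord_sum, lamCoord_sum, hcc] at this
    rw [Matrix.vecMul_sub, Pi.sub_apply, Pi.zero_apply, sub_eq_zero]
    exact this.symm
  set T : W →ₗ[ℂ] (κ → ℂ) := (LinearMap.pi fun i => F.tauCoord i) ∘ₗ W.subtype with hT
  have hTapply : ∀ (c : κ → ℂ) (h : ∑ i, c i • F.graphFamily q i ∈ W),
      T ⟨_, h⟩ = c := by
    intro c h
    funext i
    change F.tauCoord i (∑ i, c i • F.graphFamily q i) = c i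
    rw [sum_smul_graphFamily, tauCoord_sum]
  have hmem : ∀ z : W, T z ∈ LinearMap.ker (q - q').vecMulLinear := by
    rintro ⟨z, hzW⟩
    obtain ⟨c, rfl, hc⟩ := hz z hzW
    rw [hTapply]
    exact hc
  refine LinearMap.finrank_le_finrank_of_injective (f := T.codRestrict _ hmem) ?_
  rw [injective_iff_map_eq_zero]
  rintro ⟨z, hzW⟩ h0
  replace h0 := congrArg Subtype.val h0
  change T ⟨z, hzW⟩ = 0 at h0
  obtain ⟨c, rfl, hc⟩ := hz z hzW
  rw [hTapply] at h0
  simp [h0]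

end SympFrame

/-! ### Density -/

/-- Transversal Lagrangians are graphs of symmetric matrices, so A is joined to a point of O by a
line, all but finitely many points of which lie in O. -/
theorem SympFrame.mem_closure_of_transversal {κ : Type*} [Fintype κ] [DecidableEq κ]
    (F : SympFrame V κ) (hκ : Fintype.card κ = 10) {O : Set (LagrangianGrassmannian V)}
    (hO : IsOpen O) {q₁ : Matrix κ κ ℂ} (hq₁ : q₁.IsSymm)
    (h₁ : ⟨_, F.isLagrangian_span_graphFamily hκ hq₁⟩ ∈ O) {A : LagrangianGrassmannian V}
    (hA : A.1 ⊓ Submodule.span ℂ (Set.range F.lam) = ⊥) : A ∈ closure O := by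
  obtain ⟨q, hq, hAq⟩ := F.exists_eq_span_graphFamily hκ A.2 hA
  have hs : ∀ t : ℂ, (q + t • (q₁ - q)).IsSymm := fun t => by
    rw [Matrix.IsSymm, Matrix.transpose_add, Matrix.transpose_smul, Matrix.transpose_sub, hq.eq,
      hq₁.eq]
  set γ : ℂ → LagrangianGrassmannian V := fun t =>
    ⟨_, F.isLagrangian_span_graphFamily hκ (hs t)⟩ with hγ
  have hγs : ∀ t, (γ t).1 = Submodule.span ℂ (Set.range fun i =>
      F.graphFamily q i + t • ∑ j, (q₁ - q) i j • F.lam j) := by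
    intro t
    have : F.graphFamily (q + t • (q₁ - q)) = fun i =>
        F.graphFamily q i + t • ∑ j, (q₁ - q) i j • F.lam j := by
      funext i
      simp only [SympFrame.graphFamily, Matrix.add_apply, Matrix.smul_apply, add_smul,
        Finset.sum_add_distrib, Finset.smul_sum, smul_assoc, add_assoc]
    rw [← this]
  have h0 : γ 0 = A := by
    apply Subtype.ext
    simp only [hγ, zero_smul, add_zero]
    exact hAq.symm
  have h1 : γ 1 ∈ O := by
    have h2 : γ 1 = ⟨_, F.isLagrangian_span_graphFamily hκ hq₁⟩ := by
      apply Subtype.ext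
      simp only [hγ, one_smul, add_sub_cancel]
    rw [h2]
    exact h₁
  rw [← h0]
  exact mem_closure_of_affine_curve hκ hγs (finite_setOf_notMem_of_isOpen hκ hγs hO h1) 0

/-- In a frame adapted to A and the span of the λ, deform each common vector τ_i to τ_i + t λ_i. For
t ≠ 0 the result is transversal. The frame is swapped, so its τ span the original λ. -/
theorem SympFrame.mem_closure_transversal {κ : Type*} [Fintype κ] [DecidableEq κ]
    (F : SympFrame V κ) (hκ : Fintype.card κ = 10) (A : LagrangianGrassmannian V) :
    A ∈ closure {B : LagrangianGrassmannian V |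
      B.1 ⊓ Submodule.span ℂ (Set.range F.lam) = ⊥} := by
  haveI := A.2.finiteDimensional
  obtain ⟨k, hk⟩ : ∃ k, finrank ℂ (A.1 ⊓ Submodule.span ℂ (Set.range F.swap.tau) :
    Submodule ℂ _) = k := ⟨_, rfl⟩
  have hk10 : k ≤ 10 := by
    rw [← hk, ← A.2.finrank_eq]
    exact Submodule.finrank_mono inf_le_left
  have hm : k + (10 - k) = 10 := by omega
  obtain ⟨b, P, h⟩ := F.swap.exists_isAdapted A.2 hk hm hκ
  set F' := F.swap.changeBasis b with hF'
  set a : Fin k ⊕ Fin (10 - k) → ExteriorAlgebra ℂ V := Sum.elim (fun i => F'.tau (Sum.inl i))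
    (fun j => F'.lam (Sum.inr j) + ∑ l, P j l • F'.tau (Sum.inr l)) with ha
  set d : Fin k ⊕ Fin (10 - k) → ExteriorAlgebra ℂ V :=
    Sum.elim (fun i => F'.lam (Sum.inl i)) 0 with hd
  have hι : Fintype.card (Fin k ⊕ Fin (10 - k)) = 10 := by simp; omega
  have hmem : ∀ t : ℂ, ∀ i, a i + t • d i ∈ ⋀[ℂ]^3 V := by
    rintro t (i | j)
    · exact add_mem (F'.tau_mem _) (Submodule.smul_mem _ _ (F'.lam_mem _))
    · simp only [ha, hd, Sum.elim_inr, Pi.zero_apply, smul_zero, add_zero]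
      exact add_mem (F'.lam_mem _) (sum_mem fun l _ => Submodule.smul_mem _ _ (F'.tau_mem _))
  have hsum : ∀ (t : ℂ) (c : Fin k ⊕ Fin (10 - k) → ℂ), ∑ i, c i • (a i + t • d i) =
      ∑ i, Sum.elim (fun i => c (Sum.inl i)) (fun l => ∑ j, c (Sum.inr j) * P j l) i • F'.tau i +
      ∑ i, Sum.elim (fun i => t * c (Sum.inl i)) (fun j => c (Sum.inr j)) i • F'.lam i := by
    intro t c
    simp only [Fintype.sum_sum_type, ha, hd, Sum.elim_inl, Sum.elim_inr, Pi.zero_apply, smul_zero,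
      add_zero, smul_add, Finset.sum_add_distrib, Finset.smul_sum, smul_smul, Finset.sum_smul,
      Finset.sum_const_zero]
    rw [Finset.sum_comm (γ := Fin (10 - k))]
    simp only [mul_comm t]
    abel
  have hli : ∀ t : ℂ, LinearIndependent ℂ fun i => a i + t • d i := by
    intro t
    rw [Fintype.linearIndependent_iff]
    intro c hc
    rw [hsum] at hc
    rintro (i | j)
    · have := F'.tauCoord_sum (Sum.inl i) (Sum.elim (fun i => c (Sum.inl i))
        (fun l => ∑ j, c (Sum.inr j) * P j l)) (Sum.elim (fun i => t * c (Sum.inl i))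
        (fun j => c (Sum.inr j)))
      rw [hc, map_zero] at this
      exact this.symm
    · have := F'.lamCoord_sum (Sum.inr j) (Sum.elim (fun i => c (Sum.inl i))
        (fun l => ∑ j, c (Sum.inr j) * P j l)) (Sum.elim (fun i => t * c (Sum.inl i))
        (fun j => c (Sum.inr j)))
      rw [hc, map_zero] at this
      exact this.symm
  have hmul : ∀ t : ℂ, ∀ i j, (a i + t • d i) * (a j + t • d j) = 0 := by
    intro t i j
    have hs : ∀ i, a i + t • d i = ∑ l, (Pi.single i 1 : _ → ℂ) l • (a l + t • d l) := by
      intro i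
      simp only [Pi.single_apply, ite_smul, one_smul, zero_smul, Finset.sum_ite_eq',
        Finset.mem_univ, if_true]
    rw [hs i, hs j, hsum, hsum, F'.mul_eq]
    rcases i with i | i <;> rcases j with j | j <;>
      simp [Fintype.sum_sum_type, Pi.single_apply, Finset.sum_sub_distrib]
    · rw [h.isSymm.apply, sub_self]
      simp
  set γ : ℂ → LagrangianGrassmannian V := fun t =>
    ⟨_, isLagrangian_span hι (hmem t) (hli t) (hmul t)⟩ with hγ
  have h0 : γ 0 = A := by
    apply Subtype.ext
    simp only [hγ, zero_smul, add_zero]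
    rw [h.eq_span, ← Submodule.span_union, ha]
    congr 1
    exact Set.Sum.elim_range _ _
  rw [← h0]
  refine mem_closure_of_affine_curve hι (fun t => rfl) ?_ 0
  refine (Set.finite_singleton (0 : ℂ)).subset fun t ht => ?_
  by_contra ht0
  apply ht
  rw [Set.mem_setOf_eq, eq_bot_iff]
  rintro z ⟨hz1, hz2⟩
  have hz3 : z ∈ Submodule.span ℂ (Set.range F'.tau) := by
    rw [hF', SympFrame.span_tau_changeBasis]
    exact hz2
  obtain ⟨c, rfl⟩ := (Submodule.mem_span_range_iff_exists_fun ℂ).1 hz1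
  obtain ⟨p, hp⟩ := (Submodule.mem_span_range_iff_exists_fun ℂ).1 hz3
  rw [hsum] at hp
  have h2 : ∀ i, Sum.elim (fun i => t * c (Sum.inl i)) (fun j => c (Sum.inr j)) i = 0 := by
    intro i
    have h3 := congrArg (F'.lamCoord i) hp
    rw [F'.lamCoord_sum] at h3
    rw [← h3]
    simp [F'.lamCoord_tau]
  have hc : c = 0 := by
    funext i
    rcases i with i | i
    · exact (mul_eq_zero.1 (h2 (Sum.inl i))).resolve_left ht0
    · exact h2 (Sum.inr i)
  simp [hc]

theorem SympFrame.dense_of_isOpen {κ : Type*} [Fintype κ] [DecidableEq κ]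
    (F : SympFrame V κ) (hκ : Fintype.card κ = 10) {O : Set (LagrangianGrassmannian V)}
    (hO : IsOpen O) {q₁ : Matrix κ κ ℂ} (hq₁ : q₁.IsSymm)
    (h₁ : ⟨_, F.isLagrangian_span_graphFamily hκ hq₁⟩ ∈ O) : Dense O := by
  intro A
  have h := closure_mono (fun B hB => F.mem_closure_of_transversal hκ hO hq₁ h₁ hB)
    (F.mem_closure_transversal hκ A)
  rwa [closure_closure] at h

end EPW
end

open scoped TensorProduct
noncomputable section
namespace EPW
open Module

/-! ### A hypersurface containing the translates of the symmetric matrices of corank four -/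

/-- The symmetric matrix whose first block is `P` and whose kernel contains the columns of the
matrix with blocks `-Y` and `1`. -/
def corankForm {R : Type*} [CommRing R] {m n : Type*} [Fintype m] (P : Matrix m m R)
    (Y : Matrix m n R) : Matrix (m ⊕ n) (m ⊕ n) R :=
  Matrix.fromBlocks P (P * Y) (Y.transpose * P) (Y.transpose * (P * Y))

theorem map_corankForm {R R' : Type*} [CommRing R] [CommRing R'] (f : R →+* R') {m n : Type*}
    [Fintype m] (P : Matrix m m R) (Y : Matrix m n R) (i j : m ⊕ n) :
    f (corankForm P Y i j) = corankForm (P.map f) (Y.map f) i j := by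
  rcases i with i | i <;> rcases j with j | j <;>
    simp [corankForm, Matrix.mul_apply]

/-- The rank is at most 6, so six suitable rows span all rows; the coefficients of the other four
are the columns of Y, and symmetry determines the remaining blocks. -/
theorem exists_eq_corankForm {κ : Type*} [Fintype κ] [DecidableEq κ] (hκ : Fintype.card κ = 10)
    {N : Matrix κ κ ℂ} (hN : N.IsSymm) (hker : 4 ≤ finrank ℂ (LinearMap.ker N.vecMulLinear)) :
    ∃ (E : κ ≃ Fin 6 ⊕ Fin 4) (P : Matrix (Fin 6) (Fin 6) ℂ) (Y : Matrix (Fin 6) (Fin 4) ℂ),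
      P.IsSymm ∧ ∀ i j, N i j = corankForm P Y (E i) (E j) := by
  obtain ⟨s, hs, hcard⟩ := exists_basis_subfamily_quotient (Pi.basisFun ℂ κ)
    (LinearMap.ker N.vecMulLinear)
  -- The corank may exceed 4; the index set is enlarged to exactly six elements.
  obtain ⟨s', hss', hs'⟩ := Finset.exists_superset_card_eq (s := s) (n := 6) (by omega) (by omega)
  have hs'c : Fintype.card {a // a ∉ s'} = 4 := by
    rw [Fintype.card_subtype_compl, hκ, Fintype.card_coe, hs']
  have hs'6 : Fintype.card {a // a ∈ s'} = 6 := by rw [Fintype.card_coe, hs']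
  set E : κ ≃ Fin 6 ⊕ Fin 4 := (Equiv.sumCompl (· ∈ s')).symm.trans
    (Equiv.sumCongr (Fintype.equivFinOfCardEq hs'6)
      (Fintype.equivFinOfCardEq hs'c)) with hE
  have hEs : ∀ a ∈ s', ∃ j, a = E.symm (Sum.inl j) := by
    intro a ha
    refine ⟨Fintype.equivFinOfCardEq hs'6 ⟨a, ha⟩, ?_⟩
    rw [Equiv.eq_symm_apply, hE]
    simp [Equiv.sumCompl_symm_apply_of_pos ha]
  set N' := N.submatrix E.symm E.symm with hN'
  have hrow : ∀ l : Fin 4, ∃ c : Fin 6 → ℂ, ∀ a, N' (Sum.inr l) a = ∑ j, c j * N' (Sum.inl j) a := by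
    intro l
    have h1 : (Pi.single (E.symm (Sum.inr l)) 1 : κ → ℂ) ∈ LinearMap.ker N.vecMulLinear ⊔
        Submodule.span ℂ (Pi.basisFun ℂ κ '' s) := by rw [hs]; trivial
    obtain ⟨w, hw, z, hz, hwz⟩ := Submodule.mem_sup.1 h1
    have h2 : Pi.basisFun ℂ κ '' s ⊆
        Set.range fun j : Fin 6 => (Pi.single (E.symm (Sum.inl j)) 1 : κ → ℂ) := by
      rintro _ ⟨a, ha, rfl⟩
      obtain ⟨j, hj⟩ := hEs a (hss' ha)
      exact ⟨j, by rw [Pi.basisFun_apply, hj]⟩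
    obtain ⟨c, rfl⟩ := (Submodule.mem_span_range_iff_exists_fun ℂ).1 (Submodule.span_mono h2 hz)
    refine ⟨c, fun a => ?_⟩
    have h3 := congrArg (fun v => N.vecMulLinear v (E.symm a)) hwz
    have h4 : N.vecMulLinear w = 0 := hw
    simp only [map_add, map_sum, map_smul, h4, zero_add] at h3
    simpa [hN'] using h3.symm
  choose c hc using hrow
  have hN's : ∀ a b, N' a b = N' b a := fun a b => hN.apply _ _
  set P : Matrix (Fin 6) (Fin 6) ℂ := Matrix.of fun i j => N' (Sum.inl i) (Sum.inl j) with hP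
  set Y : Matrix (Fin 6) (Fin 4) ℂ := Matrix.of fun j l => c l j with hY
  have h12 : ∀ i l, N' (Sum.inl i) (Sum.inr l) = (P * Y) i l := by
    intro i l
    rw [hN's, hc, Matrix.mul_apply]
    refine Finset.sum_congr rfl fun j _ => ?_
    rw [mul_comm, hN's]
    rfl
  have hN'eq : ∀ a b, N' a b = corankForm P Y a b := by
    rintro (i | l) (j | m)
    · rfl
    · exact h12 i m
    · rw [hc]
      simp [corankForm, Matrix.mul_apply, hP, hY]
    · rw [hc]
      simp only [h12]
      simp [corankForm, Matrix.mul_apply, hY]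
  refine ⟨E, P, Y, Matrix.ext fun i j => hN's _ _, fun i j => ?_⟩
  rw [← hN'eq, hN']
  simp

/-- The parameters of a translate of a symmetric matrix of corank four. -/
abbrev CorankParam : Type := (Fin 3 × Fin 3) ⊕ (Sym2 (Fin 6) ⊕ (Fin 6 × Fin 4))

theorem card_corankParam : Fintype.card CorankParam = 54 := by
  simp only [CorankParam, Fintype.card_sum, Fintype.card_prod, Fintype.card_fin, Sym2.card]
  rfl

/-- The entries of the universal translate of a symmetric matrix of corank four. -/
def corankEntry {κ : Type*} (Q : Matrix κ κ ChartRing) (E : κ ≃ Fin 6 ⊕ Fin 4) (z : Sym2 κ) :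
    MvPolynomial CorankParam ℂ :=
  MvPolynomial.rename Sum.inl (Q z.out.1 z.out.2) +
    corankForm (Matrix.of fun i j => MvPolynomial.X (Sum.inr (Sum.inl s(i, j))))
      (Matrix.of fun i j => MvPolynomial.X (Sum.inr (Sum.inr (i, j)))) (E z.out.1) (E z.out.2)

/-- There are 55 entries in a polynomial ring of transcendence degree 9 + 21 + 24 = 54, so they are
algebraically dependent. -/
theorem exists_aeval_corankEntry_eq_zero {κ : Type*} [Fintype κ] (hκ : Fintype.card κ = 10)
    (Q : Matrix κ κ ChartRing) (E : κ ≃ Fin 6 ⊕ Fin 4) :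
    ∃ G : MvPolynomial (Sym2 κ) ℂ, G ≠ 0 ∧ MvPolynomial.aeval (corankEntry Q E) G = 0 := by
  by_contra! hcon
  have hinj : AlgebraicIndependent ℂ (corankEntry Q E) := by
    rw [AlgebraicIndependent, injective_iff_map_eq_zero]
    intro G hG
    by_contra hne
    exact hcon G hne hG
  have h := hinj.lift_cardinalMk_le_trdeg
  rw [MvPolynomial.trdeg_of_isDomain] at h
  simp only [Cardinal.mk_fintype, card_corankParam, Sym2.card, hκ, Cardinal.lift_natCast] at h
  norm_num [Nat.choose] at h

theorem exists_polynomial_of_corank {κ : Type*} [Fintype κ] [DecidableEq κ]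
    (hκ : Fintype.card κ = 10) {Q : Matrix κ κ ChartRing} (hQ : Q.IsSymm) :
    ∃ G : MvPolynomial (Sym2 κ) ℂ, G ≠ 0 ∧ ∀ (q : Matrix κ κ ℂ) (x : Fin 3 × Fin 3 → ℂ), q.IsSymm →
      4 ≤ finrank ℂ (LinearMap.ker (q - Q.map (MvPolynomial.eval x)).vecMulLinear) →
      MvPolynomial.eval (fun z => q z.out.1 z.out.2) G = 0 := by
  choose G hG0 hG using fun E => exists_aeval_corankEntry_eq_zero hκ Q E
  -- Which six rows span depends on the matrix; the product over all indexings E covers every case.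
  refine ⟨∏ E, G E, Finset.prod_ne_zero_iff.2 fun E _ => hG0 E, fun q x hq h => ?_⟩
  have hQx : (Q.map (MvPolynomial.eval x)).IsSymm :=
    Matrix.ext fun i j => congrArg (MvPolynomial.eval x) (hQ.apply i j)
  obtain ⟨E, P, Y, hP, hN⟩ := exists_eq_corankForm hκ
    (by rw [Matrix.IsSymm, Matrix.transpose_sub, hq.eq, hQx.eq]) h
  rw [map_prod]
  refine Finset.prod_eq_zero (Finset.mem_univ E) ?_
  set v : CorankParam → ℂ := Sum.elim x (Sum.elim (fun z => P z.out.1 z.out.2) (fun p => Y p.1 p.2))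
    with hv
  have hPv : ∀ i j, P (s(i, j) : Sym2 (Fin 6)).out.1 (s(i, j) : Sym2 (Fin 6)).out.2 = P i j := by
    intro i j
    have h1 : s((s(i, j) : Sym2 (Fin 6)).out.1, (s(i, j) : Sym2 (Fin 6)).out.2) = s(i, j) :=
      Quot.out_eq _
    rcases Sym2.eq_iff.1 h1 with ⟨h2, h3⟩ | ⟨h2, h3⟩
    · rw [h2, h3]
    · rw [h2, h3, hP.apply]
  have hentry : ∀ z, MvPolynomial.eval v (corankEntry Q E z) = q z.out.1 z.out.2 := by
    intro z
    rw [corankEntry, map_add, map_corankForm, MvPolynomial.eval_rename]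
    have h1 : (Matrix.of fun i j : Fin 6 =>
        (MvPolynomial.X (Sum.inr (Sum.inl s(i, j))) : MvPolynomial CorankParam ℂ)).map
        (MvPolynomial.eval v) = P := by
      refine Matrix.ext fun i j => ?_
      simp [hv, hPv]
    have h2 : (Matrix.of fun (i : Fin 6) (j : Fin 4) =>
        (MvPolynomial.X (Sum.inr (Sum.inr (i, j))) : MvPolynomial CorankParam ℂ)).map
        (MvPolynomial.eval v) = Y := by
      refine Matrix.ext fun i j => ?_
      simp [hv]
    rw [h1, h2, ← hN, Matrix.sub_apply, Matrix.map_apply]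
    have h3 : v ∘ Sum.inl = x := rfl
    rw [h3]
    ring
  have h1 := congrArg (MvPolynomial.eval v) (hG E)
  rw [map_zero] at h1
  rw [← h1]
  change MvPolynomial.eval _ (G E) = MvPolynomial.aeval v (MvPolynomial.aeval (corankEntry Q E) (G E))
  rw [← AlgHom.comp_apply, MvPolynomial.comp_aeval]
  change _ = MvPolynomial.eval _ (G E)
  congr 2
  funext z
  exact (hentry z).symm

/-- The homogenisation of a polynomial, up to a power of the new variable. -/
theorem exists_homogenization {σ : Type*} (G : MvPolynomial σ ℂ) :
    ∃ (d : ℕ) (H : MvPolynomial (Option σ) ℂ), ∀ (s : ℂ) (y : σ → ℂ),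
      MvPolynomial.eval (fun o => o.elim s fun z => s * y z) H = s ^ d * MvPolynomial.eval y G := by
  induction G using MvPolynomial.induction_on with
  | C a => exact ⟨0, MvPolynomial.C a, fun s y => by simp⟩
  | add G G' h h' =>
    obtain ⟨d, H, hH⟩ := h
    obtain ⟨d', H', hH'⟩ := h'
    refine ⟨d + d', MvPolynomial.X none ^ d' * H + MvPolynomial.X none ^ d * H', fun s y => ?_⟩
    simp only [map_add, map_mul, map_pow, MvPolynomial.eval_X, hH, hH', Option.elim_none]
    ring
  | mul_X G z h =>
    obtain ⟨d, H, hH⟩ := h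
    refine ⟨d + 1, H * MvPolynomial.X (some z), fun s y => ?_⟩
    simp only [map_mul, MvPolynomial.eval_X, hH, Option.elim_some]
    ring

end EPW
end

/-! ### The dense open set where Z^{≥4} is empty -/

open scoped TensorProduct
noncomputable section
namespace EPW
open ExteriorAlgebra Module

variable {V : Type*} [AddCommGroup V] [Module ℂ V]

namespace SympFrame

variable {κ : Type*} [Fintype κ] [DecidableEq κ] (F : SympFrame V κ)

theorem tauCoord_graphFamily (q : Matrix κ κ ℂ) (i j : κ) :
    F.tauCoord j (F.graphFamily q i) = if i = j then 1 else 0 := by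
  simp [graphFamily, tauCoord_tau, tauCoord_lam, eq_comm]

theorem lamCoord_graphFamily (q : Matrix κ κ ℂ) (i j : κ) :
    F.lamCoord j (F.graphFamily q i) = q i j := by
  simp [graphFamily, lamCoord_tau, lamCoord_lam]

theorem exists_polynomial_on_graphs (θ : Fin 10 ≃ κ) (G : MvPolynomial (Sym2 κ) ℂ) :
    ∃ (P : MvPolynomial (Fin 10 × (ExteriorAlgebra ℂ V →ₗ[ℂ] ℂ)) ℂ) (d : ℕ),
      (∀ a : Fin 10 → ExteriorAlgebra ℂ V, MvPolynomial.eval (fun r => r.2 (a r.1)) P ≠ 0 →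
        (Matrix.of fun i j => F.tauCoord j (a (θ.symm i))).det ≠ 0) ∧
      ∀ (a : Fin 10 → ExteriorAlgebra ℂ V) (q : Matrix κ κ ℂ),
        (Matrix.of fun i j => F.lamCoord j (a (θ.symm i))) =
          (Matrix.of fun i j => F.tauCoord j (a (θ.symm i))) * q →
        MvPolynomial.eval (fun r => r.2 (a r.1)) P =
          (Matrix.of fun i j => F.tauCoord j (a (θ.symm i))).det ^ d *
            MvPolynomial.eval (fun z => q z.out.1 z.out.2) G := by
  obtain ⟨d, H, hH⟩ := exists_homogenization G
  set TX : Matrix κ κ (MvPolynomial (Fin 10 × (ExteriorAlgebra ℂ V →ₗ[ℂ] ℂ)) ℂ) :=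
    Matrix.of fun i j => MvPolynomial.X (θ.symm i, F.tauCoord j) with hTX
  set LX : Matrix κ κ (MvPolynomial (Fin 10 × (ExteriorAlgebra ℂ V →ₗ[ℂ] ℂ)) ℂ) :=
    Matrix.of fun i j => MvPolynomial.X (θ.symm i, F.lamCoord j) with hLX
  have hT : ∀ a : Fin 10 → ExteriorAlgebra ℂ V,
      (MvPolynomial.eval fun r : Fin 10 × (ExteriorAlgebra ℂ V →ₗ[ℂ] ℂ) => r.2 (a r.1)).mapMatrix
        TX = Matrix.of fun i j => F.tauCoord j (a (θ.symm i)) := by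
    intro a
    refine Matrix.ext fun i j => ?_
    simp [hTX]
  have hL : ∀ a : Fin 10 → ExteriorAlgebra ℂ V,
      (MvPolynomial.eval fun r : Fin 10 × (ExteriorAlgebra ℂ V →ₗ[ℂ] ℂ) => r.2 (a r.1)).mapMatrix
        LX = Matrix.of fun i j => F.lamCoord j (a (θ.symm i)) := by
    intro a
    refine Matrix.ext fun i j => ?_
    simp [hLX]
  -- A basis a with coordinate matrices T and L spans the graph of q = T⁻¹L, and adj(T) L = det(T)
  -- q; homogenising G clears the denominators. The extra factor det T restricts to the subspaces
  -- for which T is invertible.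
  refine ⟨TX.det * MvPolynomial.aeval (fun o : Option (Sym2 κ) =>
    o.elim TX.det fun z => (TX.adjugate * LX) z.out.1 z.out.2) H, d + 1, fun a ha => ?_,
    fun a q haq => ?_⟩
  · rw [map_mul, RingHom.map_det, hT] at ha
    exact left_ne_zero_of_mul ha
  · set ev := MvPolynomial.eval fun r : Fin 10 × (ExteriorAlgebra ℂ V →ₗ[ℂ] ℂ) => r.2 (a r.1)
      with hev
    set s := (Matrix.of fun i j => F.tauCoord j (a (θ.symm i))).det with hs
    have hentry : ∀ i j, ev ((TX.adjugate * LX) i j) = s * q i j := by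
      intro i j
      have h1 : ev.mapMatrix (TX.adjugate * LX) = s • q := by
        rw [map_mul, RingHom.map_adjugate, hT, hL, haq, ← Matrix.mul_assoc, Matrix.adjugate_mul,
          Matrix.smul_mul, Matrix.one_mul]
      exact congrFun (congrFun h1 i) j
    have h2 : ev (MvPolynomial.aeval (fun o : Option (Sym2 κ) =>
        o.elim TX.det fun z => (TX.adjugate * LX) z.out.1 z.out.2) H) =
        MvPolynomial.eval (fun o => o.elim s fun z => s * q z.out.1 z.out.2) H := by
      change MvPolynomial.aeval _ (MvPolynomial.aeval _ H) = _
      rw [← AlgHom.comp_apply, MvPolynomial.comp_aeval]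
      change MvPolynomial.eval _ H = _
      congr 2
      funext o
      rcases o with _ | z
      · change ev TX.det = s
        rw [RingHom.map_det, hT]
      · exact hentry _ _
    rw [map_mul, h2, hH, RingHom.map_det, hT]
    ring

end SympFrame

/-- On this open set A is the graph of a symmetric q with G(q) ≠ 0. If A met some T_U of the chart
in dimension at least 4, then q - Q(x) would have corank at least 4 and G(q) would vanish. -/
theorem exists_isOpen_dense_of_chart (e : Basis (Fin 3 ⊕ Fin 3) ℂ V) :
    ∃ O : Set (LagrangianGrassmannian V), IsOpen O ∧ Dense O ∧ ∀ A ∈ O, ∀ x,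
      finrank ℂ (A.1 ⊓ tangentSubspace (graphSubspace e x) : Submodule ℂ _) < 4 := by
  have hκ : Fintype.card (Option (Fin 3 × Fin 3)) = 10 := by decide
  set F := stdFrame e with hF
  set θ : Fin 10 ≃ Option (Fin 3 × Fin 3) := (Fintype.equivFinOfCardEq hκ).symm
  obtain ⟨G, hG0, hG⟩ := exists_polynomial_of_corank hκ
    (stdQ_isSymm (MvPolynomial.X : Fin 3 × Fin 3 → ChartRing))
  obtain ⟨P, d, hP1, hP2⟩ := F.exists_polynomial_on_graphs θ G
  have hO : IsOpen (zariskiBasicOpen P) := TopologicalSpace.isOpen_generateFrom_of_mem ⟨P, rfl⟩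
  refine ⟨zariskiBasicOpen P, hO, ?_, ?_⟩
  -- Density needs only one graph in the open set, given by a point where G does not vanish.
  · obtain ⟨y, hy⟩ : ∃ y, MvPolynomial.eval y G ≠ 0 := by
      by_contra! h
      exact hG0 (MvPolynomial.funext fun y => by rw [h y, map_zero])
    set q : Matrix (Option (Fin 3 × Fin 3)) (Option (Fin 3 × Fin 3)) ℂ :=
      Matrix.of fun i j => y s(i, j) with hq
    have hqs : q.IsSymm := Matrix.ext fun i j => by
      simp only [hq, Matrix.transpose_apply, Matrix.of_apply, Sym2.eq_swap]
    have hqy : (fun z : Sym2 (Option (Fin 3 × Fin 3)) => q z.out.1 z.out.2) = y := by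
      funext z
      exact congrArg y (Quot.out_eq z)
    refine F.dense_of_isOpen hκ hO hqs ⟨fun i => F.graphFamily q (θ i), ?_, ?_⟩
    · congr 1
      exact θ.surjective.range_comp (F.graphFamily q)
    · have hT : (Matrix.of fun i j => F.tauCoord j (F.graphFamily q (θ (θ.symm i)))) = 1 := by
        refine Matrix.ext fun i j => ?_
        simp only [Matrix.of_apply, Equiv.apply_symm_apply, F.tauCoord_graphFamily,
          Matrix.one_apply]
      have hL : (Matrix.of fun i j => F.lamCoord j (F.graphFamily q (θ (θ.symm i)))) = q := by
        refine Matrix.ext fun i j => ?_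
        simp only [Matrix.of_apply, Equiv.apply_symm_apply, F.lamCoord_graphFamily]
      have h1 := hP2 (fun i => F.graphFamily q (θ i)) q (by rw [hT, hL, Matrix.one_mul])
      rw [hT, hqy, Matrix.det_one, one_pow, one_mul] at h1
      exact h1.trans_ne hy
  · rintro A ⟨a, ha, hPa⟩ x
    have hdet := hP1 a hPa
    set Ta := (Matrix.of fun i j => F.tauCoord j (a (θ.symm i))) with hTa
    have htr : A.1 ⊓ Submodule.span ℂ (Set.range F.lam) = ⊥ := by
      rw [eq_bot_iff]
      rintro z ⟨hz1, hz2⟩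
      rw [SetLike.mem_coe, ← ha] at hz1
      obtain ⟨c, rfl⟩ := (Submodule.mem_span_range_iff_exists_fun ℂ).1 hz1
      obtain ⟨r, hr⟩ := (Submodule.mem_span_range_iff_exists_fun ℂ).1 hz2
      have h1 : Matrix.vecMul (fun i => c (θ.symm i)) Ta = 0 := by
        funext j
        have h2 := congrArg (F.tauCoord j) hr
        simp only [map_sum, map_smul, F.tauCoord_lam, smul_zero, Finset.sum_const_zero] at h2
        rw [Pi.zero_apply, h2, ← θ.symm.sum_comp]
        rfl
      have h2 : (fun i => c (θ.symm i)) = 0 := by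
        by_contra hne
        exact hdet (Matrix.exists_vecMul_eq_zero_iff.1 ⟨_, hne, h1⟩)
      have h3 : c = 0 := by
        funext i
        have := congrFun h2 (θ i)
        simpa using this
      simp [h3]
    obtain ⟨q, hq, hAq⟩ := F.exists_eq_span_graphFamily hκ A.2 htr
    have hLa : (Matrix.of fun i j => F.lamCoord j (a (θ.symm i))) = Ta * q := by
      refine Matrix.ext fun i j => ?_
      have h1 : a (θ.symm i) ∈ Submodule.span ℂ (Set.range (F.graphFamily q)) := by
        rw [← hAq, ← ha]
        exact Submodule.subset_span ⟨_, rfl⟩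
      obtain ⟨c, hc⟩ := (Submodule.mem_span_range_iff_exists_fun ℂ).1 h1
      rw [F.sum_smul_graphFamily] at hc
      rw [Matrix.mul_apply, hTa]
      simp only [Matrix.of_apply, ← hc, F.lamCoord_sum, F.tauCoord_sum]
    have hGq : MvPolynomial.eval (fun z : Sym2 (Option (Fin 3 × Fin 3)) => q z.out.1 z.out.2) G ≠ 0 := by
      rw [hP2 a q hLa] at hPa
      exact right_ne_zero_of_mul hPa
    by_contra! h4
    refine hGq (hG q x hq (h4.trans ?_))
    rw [tangentSubspace_graphSubspace, hAq]
    have hQx : (stdQ (MvPolynomial.X : Fin 3 × Fin 3 → ChartRing)).map (MvPolynomial.eval x) =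
        stdQ x := by
      refine Matrix.ext fun i j => ?_
      rw [Matrix.map_apply, ← map_stdQ]
      simp
    rw [hQx]
    exact F.finrank_inf_span_graphFamily_le q (stdQ x)

theorem exists_isOpen_dense_locusGE_four_eq_empty (e : Basis (Fin 3 ⊕ Fin 3) ℂ V) :
    ∃ O : Set (LagrangianGrassmannian V), IsOpen O ∧ Dense O ∧
      ∀ A ∈ O, locusGE A.1 4 = ∅ := by
  choose O hO hd h using fun σ : Equiv.Perm (Fin 3 ⊕ Fin 3) =>
    exists_isOpen_dense_of_chart (e.reindex σ)
  refine ⟨⋂ σ, O σ, isOpen_iInter_of_finite hO, ?_, fun A hA => ?_⟩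
  · rw [← Set.sInter_range]
    exact (Set.finite_range O).dense_sInter (Set.forall_mem_range.2 hO) (Set.forall_mem_range.2 hd)
  rw [Set.eq_empty_iff_forall_notMem]
  rintro U ⟨hU3, hU4⟩
  obtain ⟨σ, x, rfl⟩ := exists_eq_graphSubspace e hU3
  exact absurd (h σ A (Set.mem_iInter.1 hA σ) x) (by omega)

end EPW
end

/-! ### Assembly of the local and global statements -/

open scoped TensorProduct
noncomputable section
namespace EPW
open ExteriorAlgebra Module IsLocalRing

variable {V : Type*} [AddCommGroup V] [Module ℂ V] {A : Submodule ℂ (ExteriorAlgebra ℂ V)}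

theorem exists_chartBasis (hV : finrank ℂ V = 6) :
    Nonempty (Basis (Fin 3 ⊕ Fin 3) ℂ V) :=
  haveI : FiniteDimensional ℂ V := FiniteDimensional.of_finrank_pos (by rw [hV]; norm_num)
  ⟨(finBasisOfFinrankEq ℂ V hV).reindex (finSumFinEquiv (m := 3) (n := 3)).symm⟩

theorem finrank_eq_of_mem_locusEq {k : ℕ} {U : Submodule ℂ V} (h : U ∈ locusEq A k) :
    finrank ℂ (A ⊓ tangentSubspace U : Submodule ℂ _) = k := by
  obtain ⟨⟨h3, h1⟩, h2⟩ := h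
  by_contra hne
  exact h2 ⟨h3, by omega⟩

theorem IsLagrangian.finrank_eq_four (hA : IsLagrangian A) (hA' : NoDecomposable A)
    (hV : finrank ℂ V = 6) {U : Submodule ℂ V} (h : U ∈ locusGE A 4) :
    finrank ℂ (A ⊓ tangentSubspace U : Submodule ℂ _) = 4 := by
  obtain ⟨e⟩ := exists_chartBasis hV
  obtain ⟨e', he'⟩ := exists_isCentredAt e h.1
  exact le_antisymm (hA.finrank_inf_tangentSubspace_le hA' he') h.2

theorem IsLagrangian.locusGE_five_eq_empty (hA : IsLagrangian A) (hA' : NoDecomposable A)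
    (hV : finrank ℂ V = 6) : locusGE A 5 = ∅ := by
  ext U
  simp only [Set.mem_empty_iff_false, iff_false]
  intro h
  have h5 := h.2
  rw [hA.finrank_eq_four hA' hV ⟨h.1, by omega⟩] at h5
  omega

theorem IsLagrangian.singularLocus_three (hA : IsLagrangian A) (hA' : NoDecomposable A)
    (hV : finrank ℂ V = 6) : singularLocus A 3 = locusGE A 4 := by
  ext U
  constructor
  · rintro ⟨⟨hU, h3⟩, hs⟩
    refine ⟨hU, ?_⟩
    by_contra h4
    exact hs fun e he => (hA.isRegularLocalRing_localRingAt hA' he le_rfl (by omega)).1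
  · intro h
    refine ⟨⟨h.1, (by norm_num : 3 ≤ 4).trans h.2⟩, fun hs => ?_⟩
    obtain ⟨e⟩ := exists_chartBasis hV
    obtain ⟨e', he'⟩ := exists_isCentredAt e h.1
    exact hA.not_isRegularLocalRing_localRingAt_three hA' he' (hA.finrank_eq_four hA' hV h)
      (hs e' he')

end EPW
end

theorem mainTheorem5 {V : Type*} [AddCommGroup V] [Module ℂ V]
    (hV : Module.finrank ℂ V = 6) :
    (∀ A : Submodule ℂ (ExteriorAlgebra ℂ V), EPW.IsLagrangian A → EPW.NoDecomposable A →
      EPW.locusGE A 5 = ∅ ∧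
      (EPW.locusGE A 4).Finite ∧
      (∀ U ∈ EPW.locusGE A 4, EPW.IsSmoothAt A 4 U) ∧
      EPW.singularLocus A 3 = EPW.locusGE A 4 ∧
      (∀ k : ℕ, k ≤ 3 → ∀ U ∈ EPW.locusEq A k,
        EPW.IsSmoothAt A k U ∧ EPW.HasDimAt A k U (9 - k * (k + 1) / 2)) ∧
      (∀ U ∈ EPW.locusEq A 4, EPW.IsSmoothAt A 4 U ∧ EPW.HasDimAt A 4 U 0)) ∧
    ∃ O : Set (EPW.LagrangianGrassmannian V), IsOpen O ∧ Dense O ∧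
      ∀ A ∈ O, EPW.locusGE A.1 4 = ∅ := by
  refine ⟨fun A hA hA' => ?_, ?_⟩
  · obtain ⟨e⟩ := EPW.exists_chartBasis hV
    refine ⟨hA.locusGE_five_eq_empty hA' hV, hA.finite_locusGE_four hA' e, fun U hU e he => ?_,
      hA.singularLocus_three hA' hV, fun k hk U hU => ⟨fun e he => ?_, fun e he => ?_⟩,
      fun U hU => ⟨fun e he => ?_, fun e he => ?_⟩⟩
    · exact (hA.isRegularLocalRing_localRingAt_four hA' he (hA.finrank_eq_four hA' hV hU)).1
    · exact (hA.isRegularLocalRing_localRingAt hA' he hk (EPW.finrank_eq_of_mem_locusEq hU)).1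
    · exact (hA.isRegularLocalRing_localRingAt hA' he hk (EPW.finrank_eq_of_mem_locusEq hU)).2
    · exact (hA.isRegularLocalRing_localRingAt_four hA' he (EPW.finrank_eq_of_mem_locusEq hU)).1
    · exact (hA.isRegularLocalRing_localRingAt_four hA' he (EPW.finrank_eq_of_mem_locusEq hU)).2
  · obtain ⟨e⟩ := EPW.exists_chartBasis hV
    exact EPW.exists_isOpen_dense_locusGE_four_eq_empty e
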